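/- Let $a\in\mathbb R$, $a\ne 0,\frac89$, let $H=\frac12y^2+\frac12x^2-\frac23x^3+\frac a4x^4$, and for cubic polynomials $f(x,y)=\sum_{i+j\le3}a_{ij}x^iy^j$, $g(x,y)=\sum_{i+j\le3}b_{ij}x^iy^j$ with arbitrary real coefficients (independent of $\varepsilon$) consider $$\dot x=H_y+\varepsilon f(x,y),\qquad \dot y=-H_x+\varepsilon g(x,y).$$ Fix a period annulus $\mathcal A$ of the system with $\varepsilon=0$ (a connected component of the union of its nonconstant closed orbits), put $\Sigma=H(\mathcal A)$, and let $\delta(h)\subset\mathcal A\cap\{H=h\}$, $h\in\Sigma$, be the ovals of the annulus, oriented by the unperturbed flow; let $I_k(h)=\oint_{\delta(h)}x^k y\,dx$. Let $d(h,\varepsilon)$ be the displacement map (first return map minus identity) on a cross-section of $\mathcal A$ parametrized by the value $h$ of $H$, and let $M_k(h)$ be the coefficient of $\varepsilon^k$ in its expansion $d(h,\varepsilon)=\varepsilon M_1(h)+\varepsilon^2M_2(h)+\cdots$ as $\varepsilon\to0$. Let $1\le k\le 4$ and suppose that $M_j\equiv0$ on $\Sigma$ for all $1\le j<k$. Then: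 (i) $M_k(h)=\alpha_k(h)I_0(h)+\beta_k(h)I_1(h)+\gamma_k(h)I_2(h)$ for all $h\in\Sigma$, where $\alpha_k,\beta_k,\gamma_k$ are real polynomials in $h$ of degree at most one (depending on $a$, $f$, $g$). (ii) Among the $M_k$, the coefficient $M_2$ can have the maximum possible number of zeros in $\Sigma$: if $M_k\not\equiv0$ on $\Sigma$, there is a cubic perturbation $(\tilde f,\tilde g)$ of the same system whose coefficients satisfy $\tilde M_1\equiv0$ and $\tilde M_2\not\equiv0$ on $\Sigma$ and such that $\tilde M_2$ has at least as many zeros in $\Sigma$ as $M_k$, whether zeros are counted without or with multiplicity. -/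

import Mathlib

open Set Filter Topology

noncomputable section

namespace CubicPerturbation

/-- The Hamiltonian `H(x,y) = y²/2 + x²/2 - 2x³/3 + a x⁴/4`. -/
def H (a : ℝ) (p : ℝ × ℝ) : ℝ :=
  p.2 ^ 2 / 2 + p.1 ^ 2 / 2 - 2 / 3 * p.1 ^ 3 + a / 4 * p.1 ^ 4

/-- The cubic polynomial `∑_{i+j≤3} c_{ij} x^i y^j`. -/
def cubic (c : ℕ × ℕ → ℝ) (p : ℝ × ℝ) : ℝ :=
  ∑ n ∈ Finset.range 4, ∑ ij ∈ Finset.HasAntidiagonal.antidiagonal n, c ij * p.1 ^ ij.1 * p.2 ^ ij.2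

/-- The Hamiltonian vector field `X_0 = (H_y, -H_x)`. -/
def field₀ (a : ℝ) (p : ℝ × ℝ) : ℝ × ℝ :=
  (p.2, -(p.1 - 2 * p.1 ^ 2 + a * p.1 ^ 3))

/-- The perturbed vector field `X_ε = (H_y + ε f, -H_x + ε g)`, where `f`, `g` are the cubic
polynomials with coefficient families `A`, `B`. -/
def field (a : ℝ) (A B : ℕ × ℕ → ℝ) (ε : ℝ) (p : ℝ × ℝ) : ℝ × ℝ :=
  field₀ a p + ε • (cubic A p, cubic B p)

/-- Sanity check: `field₀` is the Hamiltonian vector field of `H`, that is, `(H_y, -H_x)`. -/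
theorem hasDerivAt_H (a x y : ℝ) :
    HasDerivAt (fun t => H a (x, t)) (field₀ a (x, y)).1 y ∧
      HasDerivAt (fun t => H a (t, y)) (-(field₀ a (x, y)).2) x := by
  constructor
  · have h := ((((hasDerivAt_pow 2 y).div_const 2).add_const (x ^ 2 / 2)).sub_const
      (2 / 3 * x ^ 3)).add_const (a / 4 * x ^ 4)
    refine (h.congr_deriv ?_)
    simp only [field₀]
    ring
  · have h := ((((hasDerivAt_pow 2 x).div_const 2).const_add (y ^ 2 / 2)).sub
      ((hasDerivAt_pow 3 x).const_mul (2 / 3))).add ((hasDerivAt_pow 4 x).const_mul (a / 4))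
    refine (h.congr_deriv ?_)
    simp only [field₀]
    ring

/-- `γ`, restricted to `[0,T]`, runs exactly once through a nonconstant closed orbit of `X_0`
which starts and ends at `p`. -/
structure IsClosedOrbit (a : ℝ) (p : ℝ × ℝ) (γ : ℝ → ℝ × ℝ) (T : ℝ) : Prop where
  solves : ∀ t, HasDerivAt γ (field₀ a (γ t)) t
  nonsingular : field₀ a p ≠ 0
  period_pos : 0 < T
  starts : γ 0 = p
  closes : γ T = p
  simple : ∀ t ∈ Ioo 0 T, γ t ≠ p

/-- The union of all nonconstant closed orbits of `X_0`. -/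
def periodicSet (a : ℝ) : Set (ℝ × ℝ) :=
  {p | ∃ γ T, IsClosedOrbit a p γ T}

/-- A period annulus of `X_0`: a connected component of the union of the nonconstant closed
orbits. -/
def IsPeriodAnnulus (a : ℝ) (𝒜 : Set (ℝ × ℝ)) : Prop :=
  ∃ p ∈ periodicSet a, 𝒜 = connectedComponentIn (periodicSet a) p

/-- The integral `∮ x^k y dx` over the closed orbit of `X_0` through `p`, oriented by `X_0`. -/
def ovalIntegral (a : ℝ) (k : ℕ) (p : ℝ × ℝ) : ℝ :=
  Classical.epsilon fun v : ℝ => ∃ γ T, IsClosedOrbit a p γ T ∧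
    v = ∫ t in (0 : ℝ)..T, (γ t).1 ^ k * (γ t).2 * deriv (fun s => (γ s).1) t

/-- A `C¹` cross-section of the period annulus `𝒜`, parametrized by the value `h` of the
Hamiltonian, `h ∈ Σ = H(𝒜)`. -/
structure IsCrossSection (a : ℝ) (𝒜 : Set (ℝ × ℝ)) (σ : ℝ → ℝ × ℝ) : Prop where
  smooth : ContDiffOn ℝ 1 σ (H a '' 𝒜)
  mem : ∀ h ∈ H a '' 𝒜, σ h ∈ 𝒜
  level : ∀ h ∈ H a '' 𝒜, H a (σ h) = h

/-- The orbit of `X_ε` which starts at the point `σ h` of the section `{σ s | s ∈ S}` returns to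
the section for the first time at the point `σ h'`. -/
def FirstReturn (a : ℝ) (A B : ℕ × ℕ → ℝ) (S : Set ℝ) (σ : ℝ → ℝ × ℝ) (ε h h' : ℝ) : Prop :=
  ∃ (γ : ℝ → ℝ × ℝ) (T : ℝ), 0 < T ∧
    (∀ t ∈ Icc 0 T, HasDerivWithinAt γ (field a A B ε (γ t)) (Icc 0 T) t) ∧
    γ 0 = σ h ∧ h' ∈ S ∧ γ T = σ h' ∧ ∀ t ∈ Ioo 0 T, γ t ∉ σ '' S

/-- The displacement map `d(h,ε)`: the first return map to the section, written in the
parameter `h`, minus `h`. -/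
def displacement (a : ℝ) (A B : ℕ × ℕ → ℝ) (S : Set ℝ) (σ : ℝ → ℝ × ℝ) (h ε : ℝ) : ℝ :=
  Classical.epsilon fun d : ℝ => FirstReturn a A B S σ ε h (h + d)

/-- The coefficient `c_k` in the expansion `D(ε) = c_0 + ε c_1 + ε² c_2 + ⋯` as `ε → 0`,
obtained recursively as the limit of `(D(ε) - ∑_{j<k} ε^j c_j) / ε^k`. -/
def expansionCoeff (D : ℝ → ℝ) (k : ℕ) : ℝ :=
  limUnder (𝓝[≠] (0 : ℝ)) fun ε => (D ε - ∑ j : Fin k, ε ^ (j : ℕ) * expansionCoeff D j) / ε ^ k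
termination_by k
decreasing_by exact j.2

/-- The Melnikov coefficient `M_k(h)`: the coefficient at `ε^k` in the expansion
`d(h,ε) = ε M_1(h) + ε² M_2(h) + ⋯` of the displacement map. -/
def melnikov (a : ℝ) (A B : ℕ × ℕ → ℝ) (S : Set ℝ) (σ : ℝ → ℝ × ℝ) (k : ℕ) (h : ℝ) : ℝ :=
  expansionCoeff (displacement a A B S σ h) k

/-- The number of zeros of `M` in `S`, each counted once. -/
def zeroCount (S : Set ℝ) (M : ℝ → ℝ) : ℕ∞ := {h ∈ S | M h = 0}.encard

/-- The number of zeros of `M` in `S`, counted with multiplicity. -/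
def zeroCountMult (S : Set ℝ) (M : ℝ → ℝ) : ℕ∞ := ∑' h : S, analyticOrderAt M (h : ℝ)

end CubicPerturbation

end

/-! Write U for `pot a`, so that H = y²/2 + U(x), and ω = g dx − f dy. Along an orbit of the
perturbed system dH = ε ω. If ω = dQ₀ + q₁ dH, q₁ω = dQ₁ + q₂ dH, and so on, repeated substitution
leaves a displacement of leading order ε^(m+1) with coefficient ∮ q_m ω (Françoise's recursion,
`displacement_isLittleO`).

Every cubic perturbation can be put in the form ω = dQ + (κ y² + n y + ν y³) dx, with Q a quartic
polynomial. In this form the multipliers q₁, q₂, q₃ are explicit, and each M_k with k ≤ 4 becomes an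
integral ∮ N(x) y dx with deg N ≤ 6 (`exists_reduced`). The integrands are n + 3νxU', then 2κP₁ +
6LU' with L' = κP₃, then 2sP₀' + 6s(P₂ + K/3)U' with K' = κ and κP₁ = sU', then 2sP₁P₁'; in
degenerate cases the integral is zero.

To pass from one order to the next one must know what M_k ≡ 0 means. The central fact is
`exists_eq_smul_of_annulus`: for deg N ≤ 6, ∮ N y dx vanishes on the annulus only if N = bU'. For
ovals around one equilibrium, a half-order Abel integral gives ∫ N (k − U) dx = 0 on each oval,
hence W(l) = W(r) for a polynomial W of degree at most 11. Since a ≠ 8/9, the curve U(x) = U(z), x ≠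
z, is rationally parametrized by x + z, and comparing degrees makes W a polynomial in U
(`exists_comp_pot`). For ovals around all equilibria the inner levels are not in the annulus; there
a Laplace transform with t = τ⁴ equates an even and an odd entire function of τ, so both vanish and
the integrals vanish on all levels.

Part (i) follows from integration by parts, which lowers deg N to 2 at the price of coefficients
affine in h (`exists_reduction`). For (ii), every N of degree at most 6 occurs, modulo U', as the
integrand of some M₂ with M₁ ≡ 0 (`exists_second_melnikov`). Thus M_k is itself an M₂, and the zero
counts even agree. -/

noncomputable section
namespace CubicPerturbation

/-! ### Uniqueness and global existence for autonomous differential equations. -/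

section ODE
variable {E : Type*} [NormedAddCommGroup E] [NormedSpace ℝ E]

theorem eqOn_Icc_of_solutions {v : E → E} (hv : ContDiff ℝ 1 v) {f g : ℝ → E} {T : ℝ}
    (hf : ∀ t ∈ Icc 0 T, HasDerivWithinAt f (v (f t)) (Icc 0 T) t)
    (hg : ∀ t ∈ Icc 0 T, HasDerivWithinAt g (v (g t)) (Icc 0 T) t)
    (h0 : f 0 = g 0) : EqOn f g (Icc 0 T) := by
  have hfc : ContinuousOn f (Icc 0 T) := fun t ht => (hf t ht).continuousWithinAt
  have hgc : ContinuousOn g (Icc 0 T) := fun t ht => (hg t ht).continuousWithinAt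
  have hcomp : IsCompact (f '' Icc 0 T ∪ g '' Icc 0 T) :=
    (isCompact_Icc.image_of_continuousOn hfc).union (isCompact_Icc.image_of_continuousOn hgc)
  obtain ⟨K, hK⟩ := (hv.locallyLipschitz.locallyLipschitzOn).exists_lipschitzOnWith_of_compact hcomp
  have key : ∀ {f : ℝ → E} {d : E} {t : ℝ}, t ∈ Ico 0 T → HasDerivWithinAt f d (Icc 0 T) t →
      HasDerivWithinAt f d (Ici t) t := fun ht h =>
    h.mono_of_mem_nhdsWithin (Icc_mem_nhdsGE_of_mem ht)
  exact ODE_solution_unique_of_mem_Icc_right (v := fun _ => v)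
    (s := fun _ => f '' Icc 0 T ∪ g '' Icc 0 T) (K := K) (fun _ _ => hK) hfc
    (fun t ht => key ht (hf t (Ico_subset_Icc_self ht)))
    (fun t ht => Or.inl (mem_image_of_mem f (Ico_subset_Icc_self ht))) hgc
    (fun t ht => key ht (hg t (Ico_subset_Icc_self ht)))
    (fun t ht => Or.inr (mem_image_of_mem g (Ico_subset_Icc_self ht))) h0

theorem eq_of_solutions {v : E → E} (hv : LocallyLipschitz v) {f g : ℝ → E} {t₀ : ℝ}
    (hf : ∀ t, HasDerivAt f (v (f t)) t) (hg : ∀ t, HasDerivAt g (v (g t)) t)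
    (h0 : f t₀ = g t₀) : f = g := by
  have hfc : Continuous f := continuous_iff_continuousAt.2 fun t => (hf t).continuousAt
  have hgc : Continuous g := continuous_iff_continuousAt.2 fun t => (hg t).continuousAt
  ext t
  obtain ⟨A, B, Ht, Ht₀⟩ : ∃ A B, t ∈ Ioo A B ∧ t₀ ∈ Ioo A B := by
    use (min (-|t|) (-|t₀|) - 1), (max |t| |t₀| + 1)
    grind
  have hcomp : IsCompact (f '' Icc A B ∪ g '' Icc A B) :=
    (isCompact_Icc.image hfc).union (isCompact_Icc.image hgc)
  obtain ⟨K, hK⟩ := (hv.locallyLipschitzOn).exists_lipschitzOnWith_of_compact hcomp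
  exact ODE_solution_unique_of_mem_Icc (v := fun _ => v)
    (s := fun _ => f '' Icc A B ∪ g '' Icc A B) (K := K) (fun _ _ => hK) Ht₀ hfc.continuousOn
    (fun t _ => hf t)
    (fun t ht => Or.inl (mem_image_of_mem f (Ioo_subset_Icc_self ht))) hgc.continuousOn
    (fun t _ => hg t)
    (fun t ht => Or.inr (mem_image_of_mem g (Ioo_subset_Icc_self ht))) h0 (Ioo_subset_Icc_self Ht)

/-- For a bounded field, Picard–Lindelöf applies on [−(n+1), n+1] in a single step with ball radius
L(n+1). Uniqueness makes these solutions agree on overlaps, so they can be glued. -/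
theorem exists_global_solution [CompleteSpace E] {v : E → E} {K L : NNReal}
    (hv : LipschitzWith K v) (hL : ∀ x, ‖v x‖ ≤ L) (x : E) :
    ∃ γ : ℝ → E, γ 0 = x ∧ ∀ t, HasDerivAt γ (v (γ t)) t := by
  have step : ∀ n : ℕ, ∃ α : ℝ → E, α 0 = x ∧
      ∀ t ∈ Icc (-((n : ℝ) + 1)) ((n : ℝ) + 1),
        HasDerivWithinAt α (v (α t)) (Icc (-((n : ℝ) + 1)) ((n : ℝ) + 1)) t := by
    intro n
    have h0 : (0 : ℝ) ∈ Icc (-((n : ℝ) + 1)) ((n : ℝ) + 1) := ⟨by linarith [n.cast_nonneg (α := ℝ)],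
      by positivity⟩
    have hp : IsPicardLindelof (fun _ => v) (⟨0, h0⟩ : Icc (-((n : ℝ) + 1)) ((n : ℝ) + 1)) x
        (L * (n + 1)) 0 L K := by
      refine IsPicardLindelof.of_time_independent (fun y _ => hL y) hv.lipschitzOnWith ?_
      simp
    exact hp.exists_eq_forall_mem_Icc_hasDerivWithinAt₀
  choose α hα0 hα using step
  have hsub : ∀ n : ℕ, ∀ t ∈ Ioo (-((n : ℝ) + 1)) ((n : ℝ) + 1), HasDerivAt (α n) (v (α n t)) t :=
    fun n t ht => (hα n t (Ioo_subset_Icc_self ht)).hasDerivAt (Icc_mem_nhds ht.1 ht.2)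
  have agree : ∀ n m : ℕ, n ≤ m → ∀ t ∈ Ioo (-((n : ℝ) + 1)) ((n : ℝ) + 1), α n t = α m t := by
    intro n m hnm t ht
    have hc : (n : ℝ) ≤ m := by exact_mod_cast hnm
    refine ODE_solution_unique_of_mem_Ioo (v := fun _ => v) (s := fun _ => univ) (K := K)
      (fun _ _ => hv.lipschitzOnWith) (t₀ := 0) ⟨by linarith [n.cast_nonneg (α := ℝ)], by positivity⟩
      (fun s hs => ⟨hsub n s hs, trivial⟩) (fun s hs => ⟨hsub m s ⟨?_, ?_⟩, trivial⟩)
      ((hα0 n).trans (hα0 m).symm) ht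
    · linarith [hs.1]
    · linarith [hs.2]
  refine ⟨fun t => α ⌈|t|⌉₊ t, by simp [hα0], fun t => ?_⟩
  obtain ⟨n, hn⟩ := exists_nat_gt |t|
  have hmem : ∀ s : ℝ, |s| < n → α ⌈|s|⌉₊ s = α n s := by
    intro s hs
    refine agree _ _ (Nat.ceil_le.2 hs.le) s ?_
    have := Nat.le_ceil |s|
    rw [mem_Ioo, ← abs_lt]
    linarith
  have hd : HasDerivAt (α n) (v (α n t)) t := hsub n t (by
    rw [mem_Ioo, ← abs_lt]; linarith)
  have hev : (fun s => α ⌈|s|⌉₊ s) =ᶠ[𝓝 t] α n := by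
    filter_upwards [(continuous_abs.isOpen_preimage _ isOpen_Iio).mem_nhds hn] with s hs
    exact hmem s hs
  have := hd.congr_of_eventuallyEq hev
  rwa [← hmem t hn] at this

end ODE

/-- A function which converges at infinity has no nonzero limit slope. -/
theorem eq_zero_of_tendsto_of_deriv_tendsto {f f' : ℝ → ℝ} {A c : ℝ}
    (hf : ∀ t, HasDerivAt f (f' t) t) (hA : Tendsto f atTop (𝓝 A))
    (hc : Tendsto f' atTop (𝓝 c)) : c = 0 := by
  have hx : ∀ t : ℝ, ∃ s ∈ Ioo t (t + 1), f' s = (f (t + 1) - f t) / (t + 1 - t) := fun t =>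
    exists_hasDerivAt_eq_slope f f' (by linarith)
      (fun s _ => (hf s).continuousAt.continuousWithinAt) (fun s _ => hf s)
  choose ξ hξ hξ' using hx
  have h1 : Tendsto ξ atTop atTop := tendsto_atTop_mono (fun t => (hξ t).1.le) tendsto_id
  have h2 : Tendsto (fun t => f (t + 1) - f t) atTop (𝓝 (A - A)) :=
    (hA.comp (tendsto_atTop_add_const_right _ 1 tendsto_id)).sub hA
  have h3 : (fun t => f (t + 1) - f t) = f' ∘ ξ := by
    ext t; simp [hξ']
  rw [h3, sub_self] at h2
  exact tendsto_nhds_unique (hc.comp h1) h2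

/-! ### The potential and the solutions of the unperturbed system. -/

/-- The potential `U`, so that `H = y² / 2 + U(x)`. -/
def pot (a x : ℝ) : ℝ := x ^ 2 / 2 - 2 / 3 * x ^ 3 + a / 4 * x ^ 4

/-- The derivative of the potential. -/
def frc (a x : ℝ) : ℝ := x - 2 * x ^ 2 + a * x ^ 3

theorem H_eq (a : ℝ) (p : ℝ × ℝ) : H a p = p.2 ^ 2 / 2 + pot a p.1 := by
  simp only [H, pot]; ring

theorem field₀_eq (a : ℝ) (p : ℝ × ℝ) : field₀ a p = (p.2, -frc a p.1) := rfl

theorem hasDerivAt_pot (a x : ℝ) : HasDerivAt (pot a) (frc a x) x := by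
  have h := (((hasDerivAt_pow 2 x).div_const 2).sub
      ((hasDerivAt_pow 3 x).const_mul (2 / 3))).add ((hasDerivAt_pow 4 x).const_mul (a / 4))
  refine h.congr_deriv ?_
  simp only [frc]
  ring

@[fun_prop]
theorem continuous_pot (a : ℝ) : Continuous (pot a) := by unfold pot; fun_prop

@[fun_prop]
theorem continuous_frc (a : ℝ) : Continuous (frc a) := by unfold frc; fun_prop

theorem contDiff_field₀ (a : ℝ) : ContDiff ℝ 1 (field₀ a) := by unfold field₀; fun_prop

/-- `γ` is a solution of the unperturbed system, defined for all times. -/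
def IsSol (a : ℝ) (γ : ℝ → ℝ × ℝ) : Prop := ∀ t, HasDerivAt γ (field₀ a (γ t)) t

namespace IsSol
variable {a : ℝ} {γ γ' : ℝ → ℝ × ℝ}

theorem fst (h : IsSol a γ) (t : ℝ) : HasDerivAt (fun s => (γ s).1) (γ t).2 t :=
  (hasFDerivAt_fst (p := γ t)).comp_hasDerivAt t (h t)

theorem snd (h : IsSol a γ) (t : ℝ) : HasDerivAt (fun s => (γ s).2) (-frc a (γ t).1) t :=
  (hasFDerivAt_snd (p := γ t)).comp_hasDerivAt t (h t)

theorem continuous (h : IsSol a γ) : Continuous γ :=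
  continuous_iff_continuousAt.2 fun t => (h t).continuousAt

theorem shift (h : IsSol a γ) (s : ℝ) : IsSol a fun t => γ (s + t) := fun t =>
  (h (s + t)).comp_const_add s t

theorem unique (h : IsSol a γ) (h' : IsSol a γ') {t₀ : ℝ} (h0 : γ t₀ = γ' t₀) : γ = γ' :=
  eq_of_solutions (contDiff_field₀ a).locallyLipschitz h h' h0

theorem energy (h : IsSol a γ) (t s : ℝ) : H a (γ t) = H a (γ s) := by
  have hd : ∀ t, HasDerivAt (fun s => H a (γ s)) 0 t := by
    intro t
    have h1 := (((h.snd t).pow 2).div_const 2).add ((hasDerivAt_pot a _).comp t (h.fst t))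
    have h2 : (fun s => H a (γ s)) = (fun s => (γ s).2 ^ 2 / 2 + pot a (γ s).1) := by
      ext s; exact H_eq a _
    rw [h2]
    refine h1.congr_deriv ?_
    simp only [Nat.cast_ofNat]
    ring
  exact is_const_of_deriv_eq_zero (fun t => (hd t).differentiableAt) (fun t => (hd t).deriv) t s

theorem reflect (h : IsSol a γ) (s : ℝ) : IsSol a fun t => ((γ (s - t)).1, -(γ (s - t)).2) := by
  intro t
  have e1 := (h.fst (s - t)).comp_const_sub s t
  have e2 := ((h.snd (s - t)).comp_const_sub s t).neg
  refine (e1.prodMk e2).congr_deriv ?_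
  simp [field₀_eq]

theorem periodic (h : IsSol a γ) {T : ℝ} (hT : γ T = γ 0) (t : ℝ) : γ (T + t) = γ t :=
  congrFun ((h.shift T).unique h (t₀ := 0) (by simpa using hT)) t

theorem const_of_singular (h : IsSol a γ) {t₀ : ℝ} (h0 : field₀ a (γ t₀) = 0) (t : ℝ) :
    γ t = γ t₀ := by
  have hc : IsSol a fun _ => γ t₀ := fun t => by rw [h0]; exact hasDerivAt_const _ _
  exact congrFun (h.unique hc (t₀ := t₀) rfl) t

end IsSol

/-! ### Ovals of H and the closed orbits that run through them. -/

/-- The interval `[l, r]` is the projection to the `x`-axis of an oval of `H = h`. -/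
structure IsOval (a h l r : ℝ) : Prop where
  lt : l < r
  left : pot a l = h
  right : pot a r = h
  inside : ∀ x ∈ Ioo l r, pot a x < h
  frc_left : frc a l < 0
  frc_right : 0 < frc a r

namespace IsOval
variable {a h l r : ℝ}

theorem le (o : IsOval a h l r) {x : ℝ} (hx : x ∈ Icc l r) : pot a x ≤ h := by
  rcases eq_or_lt_of_le hx.1 with rfl | h1
  · exact o.left.le
  rcases eq_or_lt_of_le hx.2 with rfl | h2
  · exact o.right.le
  exact (o.inside x ⟨h1, h2⟩).le

/-- The field need not be complete, so it is frozen outside a box around the oval by clamping x to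
[l, r] and y to [−M, M]. The clamped field is bounded and Lipschitz and still conserves an energy.
That energy confines the solution to the box, where clamping has no effect. -/
theorem exists_sol (o : IsOval a h l r) :
    ∃ γ, IsSol a γ ∧ γ 0 = (r, 0) ∧ ∀ t, (γ t).1 ∈ Icc l r := by
  obtain ⟨B, hB⟩ := (isCompact_Icc.image (f := fun x => h - pot a x) (s := Icc l r)
    (by fun_prop)).bddAbove
  have hB' : ∀ x ∈ Icc l r, h - pot a x ≤ B := fun x hx => hB (mem_image_of_mem _ hx)
  -- Any M with M²/2 above the maximum of h − U on [l, r] works: energy then forbids |y| > M.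
  set M := |B| + 2 with hM
  have hM2 : B < M ^ 2 / 2 := by nlinarith [abs_nonneg B, le_abs_self B]
  have hM0 : 0 < M := by positivity
  set cl : ℝ → ℝ := fun x => max l (min r x) with hcl
  set cm : ℝ → ℝ := fun y => max (-M) (min M y) with hcm
  have lcl : LipschitzWith 1 cl := (LipschitzWith.id.const_min r).const_max l
  have lcm : LipschitzWith 1 cm := (LipschitzWith.id.const_min M).const_max (-M)
  have ccl : Continuous cl := lcl.continuous
  have ccm : Continuous cm := lcm.continuous
  have mcl : ∀ x, cl x ∈ Icc l r := fun x => ⟨le_max_left _ _, max_le o.lt.le (min_le_left _ _)⟩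
  have mcm : ∀ x, |cm x| ≤ M := fun x =>
    abs_le.2 ⟨le_max_left _ _, max_le (by linarith) (min_le_left _ _)⟩
  have clid : ∀ x ∈ Icc l r, cl x = x := fun x hx => by
    simp only [hcl]; rw [min_eq_right hx.2, max_eq_right hx.1]
  have hfl : LocallyLipschitz (frc a) :=
    ContDiff.locallyLipschitz (𝕂 := ℝ) (by unfold frc; fun_prop)
  obtain ⟨K, hK⟩ := hfl.locallyLipschitzOn.exists_lipschitzOnWith_of_compact
    (isCompact_Icc (a := l) (b := r))
  have hfc : LipschitzWith (K * 1) (fun x => frc a (cl x)) := by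
    rw [← lipschitzOnWith_univ]
    exact hK.comp lcl.lipschitzOnWith (fun x _ => mcl x)
  obtain ⟨F, hF⟩ := (isCompact_Icc.image (f := fun x => |frc a x|) (s := Icc l r)
    (by fun_prop)).bddAbove
  have hF' : ∀ x ∈ Icc l r, |frc a x| ≤ F := fun x hx => hF (mem_image_of_mem _ hx)
  have hv : LipschitzWith (max (1 * 1) (K * 1 * 1))
      (fun q : ℝ × ℝ => (cm q.2, -frc a (cl q.1))) :=
    (lcm.comp LipschitzWith.prod_snd).prodMk ((hfc.comp LipschitzWith.prod_fst).neg)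
  obtain ⟨γ, h0, hγ⟩ := exists_global_solution (L := (max M F).toNNReal) hv (fun q => by
    rw [Real.coe_toNNReal _ (le_max_of_le_left hM0.le), Prod.norm_def]
    refine max_le_max (by simpa using mcm q.2) ?_
    simpa using hF' _ (mcl q.1)) (r, 0)
  -- the modified energy
  have e1 : ∀ t, HasDerivAt (fun s => (γ s).1) (cm (γ t).2) t := fun t =>
    (hasFDerivAt_fst (p := γ t)).comp_hasDerivAt t (hγ t)
  have e2 : ∀ t, HasDerivAt (fun s => (γ s).2) (-frc a (cl (γ t).1)) t := fun t =>
    (hasFDerivAt_snd (p := γ t)).comp_hasDerivAt t (hγ t)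
  have hfcc : Continuous fun x => frc a (cl x) := by fun_prop
  have dκ : ∀ y, HasDerivAt (fun y => ∫ s in (0:ℝ)..y, cm s) (cm y) y := fun y =>
    intervalIntegral.integral_hasDerivAt_right (ccm.intervalIntegrable _ _)
      ccm.stronglyMeasurable.stronglyMeasurableAtFilter ccm.continuousAt
  have dU : ∀ y, HasDerivAt (fun y => ∫ s in r..y, frc a (cl s)) (frc a (cl y)) y := fun y =>
    intervalIntegral.integral_hasDerivAt_right (hfcc.intervalIntegrable _ _)
      hfcc.stronglyMeasurable.stronglyMeasurableAtFilter hfcc.continuousAt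
  have dE : ∀ t, HasDerivAt (fun t => (∫ s in (0:ℝ)..(γ t).2, cm s) +
      ∫ s in r..(γ t).1, frc a (cl s)) 0 t := by
    intro t
    refine (((dκ _).comp t (e2 t)).add ((dU _).comp t (e1 t))).congr_deriv ?_
    ring
  have hE : ∀ t, (∫ s in (0:ℝ)..(γ t).2, cm s) + ∫ s in r..(γ t).1, frc a (cl s) = 0 := by
    intro t
    rw [is_const_of_deriv_eq_zero (fun t => (dE t).differentiableAt) (fun t => (dE t).deriv) t 0]
    simp [h0]
  have κnn : ∀ y, 0 ≤ ∫ s in (0:ℝ)..y, cm s := by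
    intro y
    rcases le_total 0 y with hy | hy
    · exact intervalIntegral.integral_nonneg hy fun s hs =>
        le_max_of_le_right (le_min hM0.le hs.1)
    · rw [intervalIntegral.integral_symm, ← intervalIntegral.integral_neg]
      refine intervalIntegral.integral_nonneg hy fun s hs => ?_
      rw [neg_nonneg]
      exact max_le (by linarith) (min_le_of_right_le hs.2)
  have Ûin : ∀ x ∈ Icc l r, ∫ s in r..x, frc a (cl s) = pot a x - h := by
    intro x hx
    rw [← o.right, ← intervalIntegral.integral_eq_sub_of_hasDerivAt
      (fun s _ => hasDerivAt_pot a s) ((continuous_frc a).intervalIntegrable _ _)]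
    refine intervalIntegral.integral_congr fun s hs => ?_
    rw [uIcc_of_ge hx.2] at hs
    rw [clid s ⟨hx.1.trans hs.1, hs.2⟩]
  have Uconst : ∀ c x : ℝ, (∀ s ∈ uIcc c x, cl s = cl c) →
      ∫ s in c..x, frc a (cl s) = (x - c) * frc a (cl c) := by
    intro c x hc
    rw [intervalIntegral.integral_congr (g := fun _ => frc a (cl c))
      (fun s hs => by simp only; rw [hc s hs])]
    simp
  -- Outside [l, r] the modified potential grows linearly from 0 because U' points outwards at both
  -- ends, so it is positive. The kinetic part is nonnegative and the total energy is 0.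
  have hx : ∀ t, (γ t).1 ∈ Icc l r := by
    intro t
    by_contra hcon
    have hneg : ∫ s in r..(γ t).1, frc a (cl s) ≤ 0 := by linarith [hE t, κnn (γ t).2]
    rw [mem_Icc, not_and_or, not_le, not_le] at hcon
    rcases hcon with hlt | hlt
    · rw [← intervalIntegral.integral_add_adjacent_intervals
        (hfcc.intervalIntegrable r l) (hfcc.intervalIntegrable l _),
        Ûin l ⟨le_rfl, o.lt.le⟩, o.left, Uconst l _ (fun s hs => by
          rw [uIcc_of_ge hlt.le] at hs
          simp only [hcl]
          rw [max_eq_left (min_le_of_right_le hs.2), max_eq_left (min_le_right _ _)]),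
        clid l ⟨le_rfl, o.lt.le⟩] at hneg
      nlinarith [o.frc_left]
    · rw [Uconst r _ (fun s hs => by
          rw [uIcc_of_le hlt.le] at hs
          simp only [hcl]
          rw [min_eq_left hs.1, min_self]),
        clid r ⟨o.lt.le, le_rfl⟩] at hneg
      nlinarith [o.frc_right]
  have cmid : ∀ y, |y| ≤ M → cm y = y := fun y hy => by
    simp only [hcm]; rw [min_eq_right (abs_le.1 hy).2, max_eq_right (abs_le.1 hy).1]
  have κM : ∀ y, M < |y| → M ^ 2 / 2 ≤ ∫ s in (0:ℝ)..y, cm s := by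
    have base : ∀ y, |y| ≤ M → ∫ s in (0:ℝ)..y, cm s = y ^ 2 / 2 := by
      intro y hy
      rw [intervalIntegral.integral_congr (g := fun s => s) (fun s hs => cmid s ?_)]
      · rw [integral_id]; ring
      · rcases le_total 0 y with h' | h'
        · rw [uIcc_of_le h'] at hs
          rw [abs_of_nonneg hs.1]; exact hs.2.trans ((le_abs_self _).trans hy)
        · rw [uIcc_of_ge h'] at hs
          rw [abs_of_nonpos hs.2]
          rw [abs_of_nonpos h'] at hy
          linarith [hs.1]
    intro y hy
    rcases lt_abs.1 hy with h' | h'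
    · rw [← intervalIntegral.integral_add_adjacent_intervals
        (ccm.intervalIntegrable 0 M) (ccm.intervalIntegrable M _), base M (abs_of_pos hM0).le]
      have : 0 ≤ ∫ s in M..y, cm s := intervalIntegral.integral_nonneg h'.le fun s hs =>
        le_max_of_le_right (le_min hM0.le (hM0.le.trans hs.1))
      linarith
    · rw [← intervalIntegral.integral_add_adjacent_intervals
        (ccm.intervalIntegrable 0 (-M)) (ccm.intervalIntegrable (-M) _),
        base (-M) (by rw [abs_neg, abs_of_pos hM0])]
      have : 0 ≤ ∫ s in (-M)..y, cm s := by
        rw [intervalIntegral.integral_symm, ← intervalIntegral.integral_neg]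
        refine intervalIntegral.integral_nonneg (by linarith) fun s hs => ?_
        rw [neg_nonneg]
        exact max_le (by linarith) (min_le_of_right_le (by linarith [hs.2]))
      linarith [neg_sq M]
  have hy : ∀ t, |(γ t).2| ≤ M := by
    intro t
    by_contra hcon
    have := κM _ (not_le.1 hcon)
    have h3 := hE t
    rw [Ûin _ (hx t)] at h3
    linarith [hB' _ (hx t)]
  refine ⟨γ, fun t => (hγ t).congr_deriv ?_, h0, hx⟩
  simp only [field₀_eq, cmid _ (hy t), clid _ (hx t)]

end IsOval

theorem pot_near_of_pos {a c : ℝ} (hc : 0 < frc a c) :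
    ∀ᶠ x in 𝓝 c, (c < x → pot a c < pot a x) ∧ (x < c → pot a x < pot a c) := by
  have h := (hasDerivAt_iff_tendsto_slope.1 (hasDerivAt_pot a c)).eventually (lt_mem_nhds hc)
  rw [eventually_nhdsWithin_iff] at h
  filter_upwards [h] with x hx
  refine ⟨fun hlt => ?_, fun hlt => ?_⟩
  · have := hx hlt.ne'
    rw [slope_def_field, div_pos_iff_of_pos_right (by linarith)] at this
    linarith
  · have := hx hlt.ne
    rw [slope_def_field, div_pos_iff] at this
    rcases this with h1 | h1 <;> linarith

theorem pot_near_of_neg {a c : ℝ} (hc : frc a c < 0) :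
    ∀ᶠ x in 𝓝 c, (c < x → pot a x < pot a c) ∧ (x < c → pot a c < pot a x) := by
  have h := (hasDerivAt_iff_tendsto_slope.1 (hasDerivAt_pot a c)).eventually (gt_mem_nhds hc)
  rw [eventually_nhdsWithin_iff] at h
  filter_upwards [h] with x hx
  refine ⟨fun hlt => ?_, fun hlt => ?_⟩
  · have := hx hlt.ne'
    rw [slope_def_field, div_neg_iff] at this
    rcases this with h1 | h1 <;> linarith
  · have := hx hlt.ne
    rw [slope_def_field, div_neg_iff] at this
    rcases this with h1 | h1 <;> linarith

namespace IsOval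
variable {a h l r : ℝ}

/-- The half of the oval `l ≤ x ≤ r`, `y ≤ 0` is run through in finite time. -/
theorem exists_half (o : IsOval a h l r) :
    ∃ γ T, IsSol a γ ∧ 0 < T ∧ γ 0 = (r, 0) ∧ γ T = (l, 0) ∧ (∀ t, (γ t).1 ∈ Icc l r) ∧
      ∀ t ∈ Ioo 0 T, (γ t).2 < 0 := by
  obtain ⟨γ, hγ, h0, hx⟩ := o.exists_sol
  have hH : ∀ t, (γ t).2 ^ 2 / 2 + pot a (γ t).1 = h := by
    intro t
    have := hγ.energy t 0
    rw [H_eq, H_eq, h0] at this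
    simpa [o.right] using this
  have hyc : Continuous fun t => (γ t).2 := hγ.continuous.snd
  have hxc : Continuous fun t => (γ t).1 := hγ.continuous.fst
  -- the motion starts downwards
  obtain ⟨δ, hδ, hδy⟩ : ∃ δ > 0, ∀ t ∈ Ioc 0 δ, (γ t).2 < 0 := by
    have hev : ∀ᶠ t in 𝓝 (0 : ℝ), 0 < frc a (γ t).1 := by
      have : Continuous (fun t => frc a (γ t).1) := by fun_prop
      refine this.continuousAt.eventually (lt_mem_nhds ?_)
      simpa [h0] using o.frc_right
    obtain ⟨δ, hδ, hb⟩ := Metric.eventually_nhds_iff.1 hev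
    have anti : StrictAntiOn (fun t => (γ t).2) (Icc 0 (δ / 2)) := by
      refine strictAntiOn_of_deriv_neg (convex_Icc _ _) hyc.continuousOn fun t ht => ?_
      rw [interior_Icc] at ht
      rw [(hγ.snd t).deriv]
      have := hb (y := t) (by rw [Real.dist_eq, sub_zero, abs_of_pos ht.1]; linarith [ht.2])
      linarith
    refine ⟨δ / 2, by positivity, fun t ht => ?_⟩
    have := anti (left_mem_Icc.2 (by positivity)) (Ioc_subset_Icc_self ht) ht.1
    simpa [h0] using this
  -- and comes back to the axis
  have hex : ∃ t, δ ≤ t ∧ (γ t).2 = 0 := by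
    by_contra hne
    push Not at hne
    have hneg : ∀ t, 0 < t → (γ t).2 < 0 := by
      intro t ht
      rcases le_total t δ with h' | h'
      · exact hδy t ⟨ht, h'⟩
      by_contra hcon
      obtain ⟨s, hs, hs0⟩ := intermediate_value_Icc h' hyc.continuousOn
        ⟨(hδy δ ⟨hδ, le_rfl⟩).le, not_lt.1 hcon⟩
      exact hne s hs.1 hs0
    have anti : StrictAntiOn (fun t => (γ t).1) (Ici 0) := by
      refine strictAntiOn_of_deriv_neg (convex_Ici _) hxc.continuousOn fun t ht => ?_
      rw [interior_Ici] at ht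
      rw [(hγ.fst t).deriv]
      exact hneg t ht
    obtain ⟨X, hX⟩ : ∃ X, Tendsto (fun t => (γ t).1) atTop (𝓝 X) := by
      have hanti : Antitone fun t : ℝ => (γ (max t 0)).1 := fun s t hst =>
        anti.antitoneOn (mem_Ici.2 (le_max_right _ _)) (mem_Ici.2 (le_max_right _ _)) (max_le_max_right 0 hst)
      refine ⟨_, (tendsto_atTop_ciInf hanti ⟨l, ?_⟩).congr' ?_⟩
      · rintro _ ⟨t, rfl⟩; exact (hx _).1
      · filter_upwards [eventually_ge_atTop 0] with t ht
        rw [max_eq_left ht]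
    have hXmem : X ∈ Icc l r := isClosed_Icc.mem_of_tendsto hX (Eventually.of_forall hx)
    have hXr : X < r := by
      have h1 : (γ 1).1 < (γ 0).1 := anti (by simp) (by simp) one_pos
      have h2 : X ≤ (γ 1).1 := le_of_tendsto hX (by
        filter_upwards [eventually_ge_atTop 1] with t ht
        exact anti.antitoneOn (by simp) (by simp; linarith) ht)
      rw [h0] at h1
      exact h2.trans_lt h1
    have hyeq : ∀ t, 0 < t → (γ t).2 = -√(2 * (h - pot a (γ t).1)) := by
      intro t ht
      have : √(2 * (h - pot a (γ t).1)) = -(γ t).2 := by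
        rw [Real.sqrt_eq_iff_mul_self_eq (by nlinarith [hH t, sq_nonneg (γ t).2])
          (by linarith [hneg t ht])]
        linarith [hH t]
      rw [this, neg_neg]
    have hY : Tendsto (fun t => (γ t).2) atTop (𝓝 (-√(2 * (h - pot a X)))) := by
      have : ContinuousAt (fun x => -√(2 * (h - pot a x))) X := by fun_prop
      refine (this.tendsto.comp hX).congr' ?_
      filter_upwards [eventually_gt_atTop 0] with t ht
      exact (hyeq t ht).symm
    -- An orbit that never returned to the axis would converge to a rest point: U(X) = h and U'(X) =
    -- 0 with l ≤ X < r. Inside the oval U < h, and U'(l) ≠ 0.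
    have z1 := eq_zero_of_tendsto_of_deriv_tendsto hγ.fst hX hY
    have hF : Tendsto (fun t => -frc a (γ t).1) atTop (𝓝 (-frc a X)) :=
      ((continuous_frc a).continuousAt.tendsto.comp hX).neg
    have z2 := eq_zero_of_tendsto_of_deriv_tendsto hγ.snd hY hF
    rw [neg_eq_zero] at z1 z2
    rw [Real.sqrt_eq_zero (by linarith [o.le hXmem])] at z1
    rcases eq_or_lt_of_le hXmem.1 with rfl | h1
    · linarith [o.frc_left]
    · linarith [o.inside X ⟨h1, hXr⟩]
  set Z := {t | δ ≤ t ∧ (γ t).2 = 0} with hZ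
  have hZc : IsClosed Z := isClosed_Ici.inter (isClosed_eq hyc continuous_const)
  have hZb : BddBelow Z := ⟨δ, fun t ht => ht.1⟩
  set T := sInf Z with hT
  have hTZ : T ∈ Z := hZc.csInf_mem hex hZb
  have hT0 : 0 < T := hδ.trans_le hTZ.1
  have hneg : ∀ t ∈ Ioo 0 T, (γ t).2 < 0 := by
    intro t ht
    rcases le_total t δ with h' | h'
    · exact hδy t ⟨ht.1, h'⟩
    by_contra hcon
    obtain ⟨s, hs, hs0⟩ := intermediate_value_Icc h' hyc.continuousOn
      ⟨(hδy δ ⟨hδ, le_rfl⟩).le, not_lt.1 hcon⟩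
    exact absurd (csInf_le hZb (show s ∈ Z from ⟨hs.1, hs0⟩)) (not_le.2 (hs.2.trans_lt ht.2))
  refine ⟨γ, T, hγ, hT0, h0, ?_, hx, hneg⟩
  have anti : StrictAntiOn (fun t => (γ t).1) (Icc 0 T) := by
    refine strictAntiOn_of_deriv_neg (convex_Icc _ _) hxc.continuousOn fun t ht => ?_
    rw [interior_Icc] at ht
    rw [(hγ.fst t).deriv]
    exact hneg t ht
  have hlt := anti (left_mem_Icc.2 hT0.le) (right_mem_Icc.2 hT0.le) hT0
  simp only [h0] at hlt
  have hU := hH T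
  rw [hTZ.2] at hU
  rcases eq_or_lt_of_le (hx T).1 with h1 | h1
  · exact Prod.ext h1.symm hTZ.2
  · have := o.inside _ ⟨h1, hlt⟩
    norm_num at hU
    linarith

/-- The system is reversible under (t, y) ↦ (−t, −y), so the lower half-orbit of duration T closes
up after time 2T. Both halves contribute equally, and on the lower one dx = y dt with y = −√(2(h −
U)). This is the bridge between time integrals and Abel integrals. -/
theorem exists_closedOrbit (o : IsOval a h l r) :
    ∃ γ T, IsClosedOrbit a (r, 0) γ T ∧ ∀ N : ℝ → ℝ, Continuous N →
      ∫ t in (0 : ℝ)..T, N (γ t).1 * (γ t).2 ^ 2 = 2 * ∫ x in l..r, N x * √(2 * (h - pot a x)) := by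
  obtain ⟨γ, T, hγ, hT, h0, hγT, hx, hneg⟩ := o.exists_half
  -- Both sides solve the system and pass through (l, 0) at time T.
  have hrefl : (fun t => (((γ (2 * T - t)).1, -(γ (2 * T - t)).2) : ℝ × ℝ)) = γ := by
    refine (hγ.reflect (2 * T)).unique hγ (t₀ := T) ?_
    have : 2 * T - T = T := by ring
    simp [this, hγT]
  have hr1 : ∀ t, (γ (2 * T - t)).1 = (γ t).1 := fun t => (Prod.ext_iff.1 (congrFun hrefl t)).1
  have hr2 : ∀ t, -(γ (2 * T - t)).2 = (γ t).2 := fun t => (Prod.ext_iff.1 (congrFun hrefl t)).2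
  have hH : ∀ t, (γ t).2 ^ 2 / 2 + pot a (γ t).1 = h := by
    intro t
    have := hγ.energy t 0
    rw [H_eq, H_eq, h0] at this
    simpa [o.right] using this
  refine ⟨γ, 2 * T, ⟨hγ, ?_, by linarith, h0, ?_, ?_⟩, fun N hN => ?_⟩
  · have := o.frc_right.ne'
    simp [field₀_eq, this]
  · have e1 := hr1 0
    have e2 := hr2 0
    rw [sub_zero, h0] at e1 e2
    exact Prod.ext e1 (neg_eq_zero.1 e2)
  · intro t ht hcon
    rcases lt_trichotomy t T with h' | rfl | h'
    · have := hneg t ⟨ht.1, h'⟩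
      rw [hcon] at this
      exact lt_irrefl _ this
    · rw [hγT] at hcon
      exact o.lt.ne (congrArg Prod.fst hcon)
    · have := hneg (2 * T - t) ⟨by linarith [ht.2], by linarith⟩
      have e2 := hr2 t
      rw [hcon] at e2
      simp only [neg_eq_zero] at e2
      linarith
  · have hc : Continuous fun t => N (γ t).1 * (γ t).2 ^ 2 := by
      have := hγ.continuous
      fun_prop
    rw [← intervalIntegral.integral_add_adjacent_intervals (hc.intervalIntegrable 0 T)
      (hc.intervalIntegrable T (2 * T))]
    have e2 : ∫ t in T..2 * T, N (γ t).1 * (γ t).2 ^ 2 = ∫ t in (0:ℝ)..T, N (γ t).1 * (γ t).2 ^ 2 := by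
      have := intervalIntegral.integral_comp_sub_left (fun t => N (γ t).1 * (γ t).2 ^ 2)
        (a := 0) (b := T) (2 * T)
      rw [show 2 * T - T = T by ring, sub_zero] at this
      rw [← this]
      refine intervalIntegral.integral_congr fun t _ => ?_
      rw [hr1, ← hr2 t]
      ring
    have e1 : ∫ t in (0:ℝ)..T, N (γ t).1 * (γ t).2 ^ 2 = ∫ x in l..r, N x * √(2 * (h - pot a x)) := by
      have hs := intervalIntegral.integral_comp_mul_deriv (a := 0) (b := T)
        (f := fun t => (γ t).1) (f' := fun t => (γ t).2)
        (g := fun x => -(N x * √(2 * (h - pot a x)))) (fun t _ => hγ.fst t)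
        (hγ.continuous.snd.continuousOn) (by fun_prop)
      rw [h0, hγT] at hs
      simp only at hs
      rw [intervalIntegral.integral_neg, ← intervalIntegral.integral_symm] at hs
      rw [← hs]
      refine intervalIntegral.integral_congr fun t ht => ?_
      rw [uIcc_of_le hT.le] at ht
      have hle : (γ t).2 ≤ 0 := by
        rcases eq_or_lt_of_le ht.1 with rfl | h1
        · rw [h0]
        rcases eq_or_lt_of_le ht.2 with rfl | h2
        · rw [hγT]
        exact (hneg t ⟨h1, h2⟩).le
      have : √(2 * (h - pot a (γ t).1)) = -(γ t).2 := by
        rw [Real.sqrt_eq_iff_mul_self_eq (by linarith [o.le (hx t)]) (by linarith)]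
        linarith [hH t]
      simp only [Function.comp, this]
      ring
    rw [e2, e1]
    ring

end IsOval

/-! ### Every closed orbit is an oval. -/

namespace IsClosedOrbit
variable {a : ℝ} {p : ℝ × ℝ} {γ γ' : ℝ → ℝ × ℝ} {T T' : ℝ}

theorem sol (h : IsClosedOrbit a p γ T) : IsSol a γ := h.solves

theorem periodic (h : IsClosedOrbit a p γ T) : Function.Periodic γ T := fun t => by
  rw [add_comm]; exact h.sol.periodic (h.closes.trans h.starts.symm) t

theorem unique (h : IsClosedOrbit a p γ T) (h' : IsClosedOrbit a p γ' T') : γ = γ' ∧ T = T' := by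
  have e : γ = γ' := h.sol.unique h'.sol (t₀ := 0) (h.starts.trans h'.starts.symm)
  subst e
  refine ⟨rfl, ?_⟩
  rcases lt_trichotomy T T' with h1 | h1 | h1
  · exact absurd h.closes (h'.simple T ⟨h.period_pos, h1⟩)
  · exact h1
  · exact absurd h'.closes (h.simple T' ⟨h'.period_pos, h1⟩)

theorem regular (h : IsClosedOrbit a p γ T) (t : ℝ) : field₀ a (γ t) ≠ 0 := by
  intro h0
  apply h.nonsingular
  rw [← h.starts, h.sol.const_of_singular h0 0, h0]

theorem shift (h : IsClosedOrbit a p γ T) (s : ℝ) :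
    IsClosedOrbit a (γ s) (fun t => γ (s + t)) T where
  solves := h.sol.shift s
  nonsingular := h.regular s
  period_pos := h.period_pos
  starts := by simp
  closes := h.periodic s
  simple := by
    intro t ht hcon
    refine h.simple t ht ?_
    have := congrFun (((h.sol.shift t).unique h.sol (t₀ := s)) (by rw [add_comm]; exact hcon)) 0
    simpa [h.starts] using this

theorem energy (h : IsClosedOrbit a p γ T) (t : ℝ) :
    (γ t).2 ^ 2 / 2 + pot a (γ t).1 = H a p := by
  rw [← H_eq, h.sol.energy t 0, h.starts]

/-- Every closed orbit is an oval of `H`. -/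
theorem exists_oval (h : IsClosedOrbit a p γ T) :
    ∃ l r, IsOval a (H a p) l r ∧ (∀ t, (γ t).1 ∈ Icc l r) ∧ ∃ s, γ s = (r, 0) := by
  have hc := h.sol.continuous
  have hcx : Continuous fun t => (γ t).1 := hc.fst
  have ext : ∀ t, ∃ s ∈ Icc 0 T, γ s = γ t := fun t => by
    obtain ⟨s, hs, e⟩ := h.periodic.exists_mem_Ico₀ h.period_pos t
    exact ⟨s, Ico_subset_Icc_self hs, e.symm⟩
  obtain ⟨sl, -, hsl⟩ := isCompact_Icc.exists_isMinOn
    (nonempty_Icc.2 h.period_pos.le) hcx.continuousOn (s := Icc 0 T)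
  obtain ⟨sr, -, hsr⟩ := isCompact_Icc.exists_isMaxOn
    (nonempty_Icc.2 h.period_pos.le) hcx.continuousOn (s := Icc 0 T)
  have hmin : ∀ t, (γ sl).1 ≤ (γ t).1 := fun t => by
    obtain ⟨s, hs, e⟩ := ext t
    rw [← e]; exact hsl hs
  have hmax : ∀ t, (γ t).1 ≤ (γ sr).1 := fun t => by
    obtain ⟨s, hs, e⟩ := ext t
    rw [← e]; exact hsr hs
  have y0 : ∀ s, (IsLocalExtr (fun t => (γ t).1) s) → (γ s).2 = 0 := fun s hs =>
    hs.hasDerivAt_eq_zero (h.sol.fst s)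
  have yl : (γ sl).2 = 0 := y0 sl (Or.inl (Eventually.of_forall hmin))
  have yr : (γ sr).2 = 0 := y0 sr (Or.inr (Eventually.of_forall hmax))
  have Ul := h.energy sl
  have Ur := h.energy sr
  rw [yl] at Ul
  rw [yr] at Ur
  norm_num at Ul Ur
  have fne : ∀ s, (γ s).2 = 0 → frc a (γ s).1 ≠ 0 := fun s hs h0 =>
    h.regular s (by rw [field₀_eq, hs, h0]; simp)
  have hatt : ∀ x ∈ Icc (γ sl).1 (γ sr).1, ∃ t, (γ t).1 = x := by
    intro x hx
    exact intermediate_value_univ sl sr hcx hx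
  have hle : ∀ x ∈ Icc (γ sl).1 (γ sr).1, pot a x ≤ H a p := by
    intro x hx
    obtain ⟨t, rfl⟩ := hatt x hx
    nlinarith [h.energy t, sq_nonneg (γ t).2]
  have hin : ∀ x ∈ Ioo (γ sl).1 (γ sr).1, pot a x < H a p := by
    intro x hx
    refine lt_of_le_of_ne (hle x (Ioo_subset_Icc_self hx)) fun he => ?_
    obtain ⟨t, rfl⟩ := hatt x (Ioo_subset_Icc_self hx)
    have hy : (γ t).2 = 0 := by
      have := h.energy t
      rw [he] at this
      simpa using this
    -- U ≤ H on the whole x-range of the orbit, so equality at an interior point makes it a local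
    -- maximum of U, that is, an equilibrium on the orbit.
    refine fne t hy ?_
    refine IsLocalMax.hasDerivAt_eq_zero (f := pot a) ?_ (hasDerivAt_pot a _)
    filter_upwards [Ioo_mem_nhds hx.1 hx.2] with z hz
    rw [he]
    exact hle z (Ioo_subset_Icc_self hz)
  have hlt : (γ sl).1 < (γ sr).1 := by
    refine lt_of_le_of_ne (hmin sr) fun he => ?_
    have hconst : ∀ t, (γ t).1 = (γ sl).1 := fun t => le_antisymm (he ▸ hmax t) (hmin t)
    have h0 : ∀ t, (γ t).2 = 0 := fun t => by
      refine y0 t (Or.inl (Eventually.of_forall fun s => ?_))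
      simp only [hconst s, hconst t]; exact le_rfl
    refine fne sl yl ?_
    have d := h.sol.snd sl
    have : (fun s => (γ s).2) = fun _ => 0 := funext h0
    rw [this] at d
    have := d.unique (hasDerivAt_const _ _)
    linarith
  refine ⟨(γ sl).1, (γ sr).1, ⟨hlt, Ul, Ur, hin, ?_, ?_⟩, fun t => ⟨hmin t, hmax t⟩, sr,
    Prod.ext rfl yr⟩
  · refine lt_of_le_of_ne ?_ (fne sl yl)
    by_contra hcon
    rw [not_le] at hcon
    have hev := eventually_nhdsWithin_of_eventually_nhds (s := Ioi (γ sl).1) (pot_near_of_pos hcon)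
    have hev2 : ∀ᶠ x in 𝓝[>] (γ sl).1, x ∈ Ioo (γ sl).1 (γ sr).1 :=
      Ioo_mem_nhdsGT hlt
    obtain ⟨x, hx1, hx2⟩ := (hev.and hev2).exists
    linarith [hin x hx2, hx1.1 hx2.1]
  · refine lt_of_le_of_ne ?_ (fne sr yr).symm
    by_contra hcon
    rw [not_le] at hcon
    have hev := eventually_nhdsWithin_of_eventually_nhds (s := Iio (γ sr).1) (pot_near_of_neg hcon)
    have hev2 : ∀ᶠ x in 𝓝[<] (γ sr).1, x ∈ Ioo (γ sl).1 (γ sr).1 :=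
      Ioo_mem_nhdsLT hlt
    obtain ⟨x, hx1, hx2⟩ := (hev.and hev2).exists
    linarith [hin x hx2, hx1.2 hx2.2]

end IsClosedOrbit

/-- A time shift makes the orbit start at (r, 0), where uniqueness identifies it with the orbit
built from the oval. Periodicity makes the integral independent of the shift. -/
theorem IsClosedOrbit.exists_oval_integral {a : ℝ} {p : ℝ × ℝ} {γ : ℝ → ℝ × ℝ} {T : ℝ}
    (h : IsClosedOrbit a p γ T) :
    ∃ l r, IsOval a (H a p) l r ∧ p.1 ∈ Icc l r ∧ (∃ s, γ s = (r, 0)) ∧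
      ∀ N : ℝ → ℝ, Continuous N → ∫ t in (0 : ℝ)..T, N (γ t).1 * (γ t).2 ^ 2 =
        2 * ∫ x in l..r, N x * √(2 * (H a p - pot a x)) := by
  obtain ⟨l, r, o, hx, s, hs⟩ := h.exists_oval
  refine ⟨l, r, o, by simpa [h.starts] using hx 0, ⟨s, hs⟩, fun N hN => ?_⟩
  obtain ⟨γ', T', h', hI⟩ := o.exists_closedOrbit
  have hsh := h.shift s
  rw [hs] at hsh
  obtain ⟨rfl, rfl⟩ := h'.unique hsh
  rw [← hI N hN]
  have hper : Function.Periodic (fun t => N (γ t).1 * (γ t).2 ^ 2) T' := fun t => by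
    simp only [h.periodic t]
  have e := hper.intervalIntegral_add_eq 0 s
  rw [zero_add] at e
  rw [e]
  have := intervalIntegral.integral_comp_add_left (fun t => N (γ t).1 * (γ t).2 ^ 2)
    (a := 0) (b := T') s
  rw [add_zero] at this
  exact this.symm

theorem IsOval.mem_periodicSet {a h l r : ℝ} (o : IsOval a h l r) : (r, (0 : ℝ)) ∈ periodicSet a := by
  obtain ⟨γ, T, h, -⟩ := o.exists_closedOrbit
  exact ⟨γ, T, h⟩

/-! ### Persistence and shape of ovals. -/

theorem pot_lt_of_frc_pos {a u v : ℝ} (h : ∀ x ∈ Ioo u v, 0 < frc a x) {x y : ℝ}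
    (hx : u ≤ x) (hxy : x < y) (hy : y ≤ v) : pot a x < pot a y := by
  have : StrictMonoOn (pot a) (Icc u v) :=
    strictMonoOn_of_deriv_pos (convex_Icc _ _) (continuous_pot a).continuousOn fun t ht => by
      rw [interior_Icc] at ht
      rw [(hasDerivAt_pot a t).deriv]
      exact h t ht
  exact this ⟨hx, hxy.le.trans hy⟩ ⟨hx.trans hxy.le, hy⟩ hxy

theorem pot_lt_of_frc_neg {a u v : ℝ} (h : ∀ x ∈ Ioo u v, frc a x < 0) {x y : ℝ}
    (hx : u ≤ x) (hxy : x < y) (hy : y ≤ v) : pot a y < pot a x := by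
  have : StrictAntiOn (pot a) (Icc u v) :=
    strictAntiOn_of_deriv_neg (convex_Icc _ _) (continuous_pot a).continuousOn fun t ht => by
      rw [interior_Icc] at ht
      rw [(hasDerivAt_pot a t).deriv]
      exact h t ht
  exact this ⟨hx, hxy.le.trans hy⟩ ⟨hx.trans hxy.le, hy⟩ hxy

/-- U is strictly monotone near l and near r and stays strictly below h on the compact piece
between. Moving the right end slightly therefore moves the left end slightly and creates no new
contact with the level. -/
theorem IsOval.eventually_oval {a h l r : ℝ} (o : IsOval a h l r) :
    ∀ᶠ x in 𝓝 r, ∃ l', IsOval a (pot a x) l' x := by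
  have e1 : ∀ᶠ x in 𝓝 l, frc a x < 0 :=
    (continuous_frc a).continuousAt.eventually (gt_mem_nhds o.frc_left)
  have e2 : ∀ᶠ x in 𝓝 r, 0 < frc a x :=
    (continuous_frc a).continuousAt.eventually (lt_mem_nhds o.frc_right)
  obtain ⟨η₁, hη₁, h1⟩ := Metric.eventually_nhds_iff_ball.1 e1
  obtain ⟨η₂, hη₂, h2⟩ := Metric.eventually_nhds_iff_ball.1 e2
  obtain ⟨η, hη, hη1, hη2, hη3⟩ : ∃ η > 0, η < η₁ ∧ η < η₂ ∧ η < (r - l) / 2 := by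
    have : 0 < min (min η₁ η₂) ((r - l) / 2) :=
      lt_min (lt_min hη₁ hη₂) (by linarith [o.lt])
    refine ⟨min (min η₁ η₂) ((r - l) / 2) / 2, by positivity, ?_, ?_, ?_⟩
    · linarith [min_le_left (min η₁ η₂) ((r - l) / 2), min_le_left η₁ η₂]
    · linarith [min_le_left (min η₁ η₂) ((r - l) / 2), min_le_right η₁ η₂]
    · linarith [min_le_right (min η₁ η₂) ((r - l) / 2)]
  have h1' : ∀ x ∈ Icc (l - η) (l + η), frc a x < 0 := fun x hx => h1 x (by
    rw [Real.ball_eq_Ioo]; exact ⟨by linarith [hx.1], by linarith [hx.2]⟩)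
  have h2' : ∀ x ∈ Icc (r - η) (r + η), 0 < frc a x := fun x hx => h2 x (by
    rw [Real.ball_eq_Ioo]; exact ⟨by linarith [hx.1], by linarith [hx.2]⟩)
  obtain ⟨z, hz, hzmax⟩ := (isCompact_Icc (a := l + η) (b := r - η)).exists_isMaxOn
    (nonempty_Icc.2 (by linarith)) (continuous_pot a).continuousOn
  have hzh : pot a z < pot a r := o.right ▸ o.inside z ⟨by linarith [hz.1], by linarith [hz.2]⟩
  have hll : pot a r < pot a (l - η) := by
    rw [o.right, ← o.left]
    exact pot_lt_of_frc_neg (u := l - η) (v := l) (fun x hx => h1' x ⟨hx.1.le, by linarith [hx.2]⟩)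
      le_rfl (by linarith) le_rfl
  filter_upwards [(continuous_pot a).continuousAt.eventually (lt_mem_nhds hzh),
    (continuous_pot a).continuousAt.eventually (gt_mem_nhds hll),
    Ioo_mem_nhds (show r - η < r by linarith) (show r < r + η by linarith)] with x hx1 hx2 hx3
  have hzl : pot a (l + η) ≤ pot a z := hzmax ⟨le_rfl, by linarith⟩
  obtain ⟨l', hl', hUl'⟩ := intermediate_value_Icc' (show l - η ≤ l + η by linarith)
    (continuous_pot a).continuousOn ⟨(hzl.trans_lt hx1).le, hx2.le⟩
  have hlt : l' < l + η := lt_of_le_of_ne hl'.2 fun he => by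
    rw [he] at hUl'; linarith
  refine ⟨l', ⟨by linarith [hx3.1], hUl', rfl, fun y hy => ?_, h1' l' hl',
    h2' x (Ioo_subset_Icc_self hx3)⟩⟩
  rcases lt_or_ge y (l + η) with hy1 | hy1
  · rw [← hUl']
    exact pot_lt_of_frc_neg (u := l - η) (v := l + η)
      (fun x hx => h1' x (Ioo_subset_Icc_self hx)) hl'.1 hy.1 hy1.le
  rcases le_or_gt y (r - η) with hy2 | hy2
  · exact (hzmax ⟨hy1, hy2⟩).trans_lt hx1
  · exact pot_lt_of_frc_pos (u := r - η) (v := r + η)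
      (fun x hx => h2' x (Ioo_subset_Icc_self hx)) hy2.le hy.2 hx3.2.le

/-- The third linear factor comes from the sum 2/a of the roots, written so that no division by a is
needed. -/
theorem frc_factor {a c d : ℝ} (hc : frc a c = 0) (hd : frc a d = 0) (hcd : c ≠ d)
    (t : ℝ) : frc a t = (t - c) * ((t - d) * (a * (t + c + d) - 2)) := by
  have h1 : 1 - 2 * (c + d) + a * (c ^ 2 + c * d + d ^ 2) = 0 := by
    have : (c - d) * (1 - 2 * (c + d) + a * (c ^ 2 + c * d + d ^ 2)) = 0 := by
      simp only [frc] at hc hd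
      linear_combination hc - hd
    exact (mul_eq_zero.1 this).resolve_left (sub_ne_zero.2 hcd)
  simp only [frc] at hc ⊢
  linear_combination hc + (t - c) * h1

/-- An oval either surrounds exactly one equilibrium, or all of them. -/
theorem IsOval.unimodal_or {a h l r : ℝ} (o : IsOval a h l r) :
    (∃ c ∈ Ioo l r, (∀ x ∈ Ico l c, frc a x < 0) ∧ ∀ x ∈ Ioc c r, 0 < frc a x) ∨
      ((∀ x, r ≤ x → 0 < frc a x) ∧ ∀ x, x ≤ l → frc a x < 0) := by
  by_cases hd : ∃ d, frc a d = 0 ∧ (d < l ∨ r < d)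
  · left
    obtain ⟨d, hd0, hd⟩ := hd
    obtain ⟨c, hc, hc0⟩ := intermediate_value_Ioo o.lt.le (continuous_frc a).continuousOn
      (show (0 : ℝ) ∈ Ioo (frc a l) (frc a r) from ⟨o.frc_left, o.frc_right⟩)
    have hcd : c ≠ d := by
      rintro rfl
      rcases hd with hd | hd
      · linarith [hc.1]
      · linarith [hc.2]
    have hf := frc_factor hc0 hd0 hcd
    have hl := o.frc_left
    have hr := o.frc_right
    rw [hf] at hl hr
    have hl' : 0 < (l - d) * (a * (l + c + d) - 2) := by nlinarith [hc.1]
    have hr' : 0 < (r - d) * (a * (r + c + d) - 2) := by nlinarith [hc.2]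
    have key : ∀ t ∈ Icc l r, 0 < (t - d) * (a * (t + c + d) - 2) := by
      intro t ht
      have hlr : 0 < r - l := by linarith [o.lt]
      -- The cofactor of t − c is a product of two affine functions of t. The sign of t − d is fixed
      -- on [l, r] because d lies outside, which determines the sign of the other factor at both
      -- ends and, by interpolation, in between.
      have aff : (r - l) * (a * (t + c + d) - 2) =
          (t - l) * (a * (r + c + d) - 2) + (r - t) * (a * (l + c + d) - 2) := by ring
      rcases hd with hd | hd
      · have p1 : 0 < a * (l + c + d) - 2 := by
          exact (pos_iff_pos_of_mul_pos hl').1 (by linarith)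
        have p2 : 0 < a * (r + c + d) - 2 :=
          (pos_iff_pos_of_mul_pos hr').1 (by linarith [o.lt])
        have : 0 < a * (t + c + d) - 2 := by
          rcases le_total t ((l + r) / 2) with h' | h'
          · nlinarith [mul_nonneg (sub_nonneg.2 ht.1) p2.le,
              mul_pos (show 0 < r - t by linarith) p1]
          · nlinarith [mul_nonneg (sub_nonneg.2 ht.2) p1.le,
              mul_pos (show 0 < t - l by linarith) p2]
        exact mul_pos (by linarith [ht.1]) this
      · have p1 : a * (l + c + d) - 2 < 0 := by
          by_contra hcon
          nlinarith [mul_nonneg (show 0 ≤ d - l by linarith [o.lt]) (not_lt.1 hcon)]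
        have p2 : a * (r + c + d) - 2 < 0 := by
          by_contra hcon
          nlinarith [mul_nonneg (show 0 ≤ d - r by linarith [o.lt]) (not_lt.1 hcon)]
        have : a * (t + c + d) - 2 < 0 := by
          rcases le_total t ((l + r) / 2) with h' | h'
          · nlinarith [mul_nonneg (sub_nonneg.2 ht.1) (neg_nonneg.2 p2.le),
              mul_pos (show 0 < r - t by linarith) (neg_pos.2 p1)]
          · nlinarith [mul_nonneg (sub_nonneg.2 ht.2) (neg_nonneg.2 p1.le),
              mul_pos (show 0 < t - l by linarith) (neg_pos.2 p2)]
        exact mul_pos_of_neg_of_neg (by linarith [ht.2]) this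
    refine ⟨c, hc, fun x hx => ?_, fun x hx => ?_⟩
    · rw [hf]
      exact mul_neg_of_neg_of_pos (by linarith [hx.2]) (key x ⟨hx.1, by linarith [hx.2, hc.2]⟩)
    · rw [hf]
      exact mul_pos (by linarith [hx.1]) (key x ⟨by linarith [hx.1, hc.1], hx.2⟩)
  · right
    push Not at hd
    refine ⟨fun x hx => ?_, fun x hx => ?_⟩
    · by_contra hcon
      obtain ⟨d, hd1, hd0⟩ := intermediate_value_Icc' hx (continuous_frc a).continuousOn
        ⟨not_lt.1 hcon, o.frc_right.le⟩
      have := (hd d hd0).2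
      have e : d = r := le_antisymm this hd1.1
      rw [e] at hd0
      exact o.frc_right.ne' hd0
    · by_contra hcon
      obtain ⟨d, hd1, hd0⟩ := intermediate_value_Icc' hx (continuous_frc a).continuousOn
        ⟨o.frc_left.le, not_lt.1 hcon⟩
      have := (hd d hd0).1
      have e : d = l := le_antisymm hd1.2 this
      rw [e] at hd0
      exact o.frc_left.ne hd0

theorem tendsto_pot_atTop {a : ℝ} (ha : 0 < a) : Tendsto (pot a) atTop atTop := by
  have h : Tendsto (fun x : ℝ => x * (x * (x * (x * (a / 4) + (-2 / 3)) + 1 / 2))) atTop atTop := by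
    refine tendsto_id.atTop_mul_atTop₀ (tendsto_id.atTop_mul_atTop₀ ?_)
    refine tendsto_atTop_add_const_right _ _ (tendsto_id.atTop_mul_atTop₀ ?_) 
    exact tendsto_atTop_add_const_right _ _ (tendsto_id.atTop_mul_const (by positivity))
  refine h.congr fun x => ?_
  simp only [pot]; ring

theorem tendsto_pot_atBot {a : ℝ} (ha : 0 < a) : Tendsto (pot a) atBot atTop := by
  have h : Tendsto (fun x : ℝ => x * (x * (x * (x * (a / 4) + (2 / 3)) + 1 / 2))) atTop atTop := by
    refine tendsto_id.atTop_mul_atTop₀ (tendsto_id.atTop_mul_atTop₀ ?_)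
    refine tendsto_atTop_add_const_right _ _ (tendsto_id.atTop_mul_atTop₀ ?_) 
    exact tendsto_atTop_add_const_right _ _ (tendsto_id.atTop_mul_const (by positivity))
  refine (h.comp tendsto_neg_atBot_atTop).congr fun x => ?_
  simp only [pot, Function.comp]; ring

/-! ### Period annuli and the interval of their energies. -/

section Annulus
variable {a : ℝ} {𝒜 : Set (ℝ × ℝ)}

theorem IsPeriodAnnulus.eq_component (h : IsPeriodAnnulus a 𝒜) {p : ℝ × ℝ} (hp : p ∈ 𝒜) :
    𝒜 = connectedComponentIn (periodicSet a) p := by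
  obtain ⟨q, hq, rfl⟩ := h
  exact connectedComponentIn_eq hp

theorem IsPeriodAnnulus.subset_periodicSet (h : IsPeriodAnnulus a 𝒜) : 𝒜 ⊆ periodicSet a := by
  obtain ⟨q, hq, rfl⟩ := h
  exact connectedComponentIn_subset _ _

theorem IsPeriodAnnulus.subset_of_connected (h : IsPeriodAnnulus a 𝒜) {C : Set (ℝ × ℝ)}
    (hC : IsPreconnected C) (hCp : C ⊆ periodicSet a) {p : ℝ × ℝ} (hpC : p ∈ C) (hp : p ∈ 𝒜) :
    C ⊆ 𝒜 := by
  rw [h.eq_component hp]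
  exact hC.subset_connectedComponentIn hpC hCp

theorem IsPeriodAnnulus.isPreconnected (h : IsPeriodAnnulus a 𝒜) : IsPreconnected 𝒜 := by
  obtain ⟨q, hq, rfl⟩ := h
  exact isPreconnected_connectedComponentIn

theorem IsPeriodAnnulus.orbit_mem (h : IsPeriodAnnulus a 𝒜) {p : ℝ × ℝ} (hp : p ∈ 𝒜)
    {γ : ℝ → ℝ × ℝ} {T : ℝ} (hγ : IsClosedOrbit a p γ T) (t : ℝ) : γ t ∈ 𝒜 := by
  refine h.subset_of_connected (C := range γ) (isPreconnected_range hγ.sol.continuous) ?_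
    ⟨0, hγ.starts⟩ hp ⟨t, rfl⟩
  rintro _ ⟨s, rfl⟩
  exact ⟨_, T, hγ.shift s⟩

theorem IsPeriodAnnulus.segment_subset (h : IsPeriodAnnulus a 𝒜) {J : Set ℝ}
    (hJ : IsPreconnected J) (hov : ∀ x ∈ J, ∃ l', IsOval a (pot a x) l' x) {r : ℝ} (hr : r ∈ J)
    (hr𝒜 : (r, (0 : ℝ)) ∈ 𝒜) : ∀ x ∈ J, (x, (0 : ℝ)) ∈ 𝒜 := by
  intro x hx
  refine h.subset_of_connected (C := (fun x => (x, (0 : ℝ))) '' J)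
    (hJ.image _ (by fun_prop)) ?_ (mem_image_of_mem _ hr) hr𝒜 (mem_image_of_mem _ hx)
  rintro _ ⟨y, hy, rfl⟩
  obtain ⟨l', o⟩ := hov y hy
  exact o.mem_periodicSet

theorem H_axis (a x : ℝ) : H a (x, 0) = pot a x := by rw [H_eq]; simp

/-- Slide the right end of an oval along the x-axis: nearby points are again right ends of ovals, so
they stay in the same component, and U'(r) > 0 makes their energies fill a neighbourhood. -/
theorem IsPeriodAnnulus.isOpen_image (h : IsPeriodAnnulus a 𝒜) : IsOpen (H a '' 𝒜) := by
  rw [isOpen_iff_mem_nhds]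
  rintro _ ⟨p, hp, rfl⟩
  obtain ⟨γ, T, hγ⟩ := h.subset_periodicSet hp
  obtain ⟨l, r, o, -, ⟨s, hs⟩, -⟩ := hγ.exists_oval_integral
  have hr : (r, (0 : ℝ)) ∈ 𝒜 := hs ▸ h.orbit_mem hp hγ s
  obtain ⟨η, hη, hb⟩ := Metric.eventually_nhds_iff_ball.1 o.eventually_oval
  have hseg := h.segment_subset (convex_ball r η).isPreconnected hb (Metric.mem_ball_self hη) hr
  obtain ⟨δ, hδ, hδ2⟩ := Metric.eventually_nhds_iff_ball.1 (pot_near_of_pos o.frc_right)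
  set ρ := min η δ / 2 with hρ
  have hρ0 : 0 < ρ := by positivity
  have hρη : ρ < η := by linarith [min_le_left η δ]
  have hρδ : ρ < δ := by linarith [min_le_right η δ]
  have e1 : pot a r < pot a (r + ρ) := (hδ2 (r + ρ) (by
    rw [Real.ball_eq_Ioo]; exact ⟨by linarith, by linarith⟩)).1 (by linarith)
  have e2 : pot a (r - ρ) < pot a r := (hδ2 (r - ρ) (by
    rw [Real.ball_eq_Ioo]; exact ⟨by linarith, by linarith⟩)).2 (by linarith)
  rw [← o.right]
  filter_upwards [Icc_mem_nhds e2 e1] with k hk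
  obtain ⟨x, hx, rfl⟩ := intermediate_value_Icc (show r - ρ ≤ r + ρ by linarith)
    (continuous_pot a).continuousOn hk
  exact ⟨(x, 0), hseg x (by
    rw [Real.ball_eq_Ioo]; exact ⟨by linarith [hx.1], by linarith [hx.2]⟩), H_axis a x⟩

theorem IsPeriodAnnulus.ordConnected_image (h : IsPeriodAnnulus a 𝒜) :
    OrdConnected (H a '' 𝒜) :=
  (h.isPreconnected.image _ (by unfold H; fun_prop)).ordConnected

theorem IsPeriodAnnulus.nonempty (h : IsPeriodAnnulus a 𝒜) : 𝒜.Nonempty := by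
  obtain ⟨p, hp, rfl⟩ := h
  exact ⟨p, mem_connectedComponentIn hp⟩

end Annulus

/-! ### The family of ovals met by a cross-section. -/

/-- A level set may contain several ovals, and this selects the right one. By continuity of σ,
leaving [l, r] would require a point just outside, where U > h, while U ≤ s ≤ h at σ s for all s
between k and h. -/
theorem isCrossSection_track {a : ℝ} {𝒜 : Set (ℝ × ℝ)} (h𝒜 : IsPeriodAnnulus a 𝒜)
    {σ : ℝ → ℝ × ℝ} (hσ : IsCrossSection a 𝒜 σ) {h l r : ℝ} (hS : h ∈ H a '' 𝒜)
    (o : IsOval a h l r) (hx : (σ h).1 ∈ Icc l r) {k : ℝ} (hk : k ∈ H a '' 𝒜) (hkh : k < h) :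
    (σ k).1 ∈ Ioo l r := by
  have hc : ContinuousOn (fun s => (σ s).1) (Icc k h) :=
    continuous_fst.comp_continuousOn (hσ.smooth.continuousOn.mono
      (h𝒜.ordConnected_image.out hk hS))
  have hU : ∀ s ∈ Icc k h, pot a (σ s).1 ≤ s := fun s hs => by
    have := hσ.level s (h𝒜.ordConnected_image.out hk hS hs)
    rw [H_eq] at this
    nlinarith [sq_nonneg (σ s).2]
  have hUk := hU k ⟨le_rfl, hkh.le⟩
  constructor
  · by_contra hcon
    have hlt : (σ k).1 < l := lt_of_le_of_ne (not_lt.1 hcon) fun he => by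
      rw [he, o.left] at hUk; linarith
    have ev := eventually_nhdsWithin_of_eventually_nhds (s := Iio l) (pot_near_of_neg o.frc_left)
    obtain ⟨z, hz1, hz2⟩ := (ev.and (Ioo_mem_nhdsLT hlt)).exists
    obtain ⟨s, hs, hsz⟩ := intermediate_value_Icc hkh.le hc
      ⟨hz2.1.le, (hz2.2.le.trans hx.1)⟩
    have h1 := hU s hs
    simp only at hsz
    rw [hsz] at h1
    have h2 := hz1.2 hz2.2
    rw [o.left] at h2
    linarith [hs.2]
  · by_contra hcon
    have hlt : r < (σ k).1 := lt_of_le_of_ne (not_lt.1 hcon) fun he => by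
      rw [← he, o.right] at hUk; linarith
    have ev := eventually_nhdsWithin_of_eventually_nhds (s := Ioi r) (pot_near_of_pos o.frc_right)
    obtain ⟨z, hz1, hz2⟩ := (ev.and (Ioo_mem_nhdsGT hlt)).exists
    obtain ⟨s, hs, hsz⟩ := intermediate_value_Icc' hkh.le hc
      ⟨hx.2.trans hz2.1.le, hz2.2.le⟩
    have h1 := hU s hs
    simp only at hsz
    rw [hsz] at h1
    have h2 := hz1.1 hz2.1
    rw [o.right] at h2
    linarith [hs.2]

/-- A continuous integrand whose integral over all ovals of the annulus vanishes has vanishing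
integrals over all ovals around one equilibrium, or over all ovals outside of a given one. -/
theorem vanishing_ovals {a : ℝ} (ha : a ≠ 0) {𝒜 : Set (ℝ × ℝ)} (h𝒜 : IsPeriodAnnulus a 𝒜)
    {σ : ℝ → ℝ × ℝ} (hσ : IsCrossSection a 𝒜 σ) {N : ℝ → ℝ} (hN : Continuous N)
    (h0 : ∀ h ∈ H a '' 𝒜, ∀ γ T, IsClosedOrbit a (σ h) γ T →
      ∫ t in (0 : ℝ)..T, N (γ t).1 * (γ t).2 ^ 2 = 0) :
    (∃ l₀ c r₀, l₀ < c ∧ c < r₀ ∧ (∀ x ∈ Ico l₀ c, frc a x < 0) ∧ (∀ x ∈ Ioc c r₀, 0 < frc a x) ∧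
      ∀ k ∈ Ioo (pot a c) (pot a r₀), ∃ l r, l₀ < l ∧ l < c ∧ c < r ∧ r < r₀ ∧ IsOval a k l r ∧
        ∫ x in l..r, N x * √(2 * (k - pot a x)) = 0) ∨
    (0 < a ∧ ∃ l₀ r₀, l₀ < r₀ ∧ (∀ x, r₀ ≤ x → 0 < frc a x) ∧ (∀ x, x ≤ l₀ → frc a x < 0) ∧
      (∀ x ∈ Icc l₀ r₀, pot a x ≤ pot a r₀) ∧
      ∀ k, pot a r₀ < k → ∃ l r, l < l₀ ∧ r₀ < r ∧ IsOval a k l r ∧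
        ∫ x in l..r, N x * √(2 * (k - pot a x)) = 0) := by
  obtain ⟨p, hp⟩ := h𝒜.nonempty
  have hS : H a p ∈ H a '' 𝒜 := mem_image_of_mem _ hp
  set h := H a p with hh
  have hσ𝒜 := hσ.mem h hS
  obtain ⟨γ, T, hγ⟩ := h𝒜.subset_periodicSet hσ𝒜
  obtain ⟨l, r, o, hx, ⟨s, hs⟩, -⟩ := hγ.exists_oval_integral
  rw [hσ.level h hS] at o
  have hr : (r, (0 : ℝ)) ∈ 𝒜 := hs ▸ h𝒜.orbit_mem hσ𝒜 hγ s
  have hint : ∀ k ∈ H a '' 𝒜, ∃ l r, IsOval a k l r ∧ (σ k).1 ∈ Icc l r ∧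
      ∫ x in l..r, N x * √(2 * (k - pot a x)) = 0 := by
    intro k hk
    obtain ⟨γ, T, hγ⟩ := h𝒜.subset_periodicSet (hσ.mem k hk)
    obtain ⟨l, r, o, hx, -, hI⟩ := hγ.exists_oval_integral
    rw [hσ.level k hk] at o hI
    refine ⟨l, r, o, hx, ?_⟩
    have := hI N hN
    rw [h0 k hk γ T hγ] at this
    linarith
  -- One oval of the annulus decides the case. If it surrounds a single equilibrium, all levels down
  -- to that equilibrium belong to the annulus; otherwise all higher levels do.
  rcases o.unimodal_or with ⟨c, hc, hneg, hpos⟩ | ⟨hpos, hneg⟩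
  · left
    refine ⟨l, c, r, hc.1, hc.2, hneg, hpos, fun k hk => ?_⟩
    have hlc : ∀ {x y}, l ≤ x → x < y → y ≤ c → pot a y < pot a x := fun h1 h2 h3 =>
      pot_lt_of_frc_neg (u := l) (v := c) (fun x hx => hneg x ⟨hx.1.le, hx.2⟩) h1 h2 h3
    have hcr : ∀ {x y}, c ≤ x → x < y → y ≤ r → pot a x < pot a y := fun h1 h2 h3 =>
      pot_lt_of_frc_pos (u := c) (v := r) (fun x hx => hpos x ⟨hx.1, hx.2.le⟩) h1 h2 h3
    have hov : ∀ x ∈ Ioc c r, ∃ l', IsOval a (pot a x) l' x := by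
      intro x hx
      have h1 : pot a c < pot a x := hcr le_rfl hx.1 hx.2
      have h2 : pot a x ≤ pot a l := by
        rw [o.left, ← o.right]
        rcases eq_or_lt_of_le hx.2 with rfl | h'
        · exact le_rfl
        · exact (hcr hx.1.le h' le_rfl).le
      obtain ⟨l', hl', hU⟩ := intermediate_value_Icc' hc.1.le (continuous_pot a).continuousOn
        ⟨h1.le, h2⟩
      have hlt : l' < c := lt_of_le_of_ne hl'.2 fun he => by rw [he] at hU; linarith
      refine ⟨l', hlt.trans hx.1, hU, rfl, fun y hy => ?_, hneg l' ⟨hl'.1, hlt⟩, hpos x hx⟩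
      rcases le_or_gt y c with h' | h'
      · rw [← hU]; exact hlc hl'.1 hy.1 h'
      · exact hcr h'.le hy.2 hx.2
    have hseg := h𝒜.segment_subset (convex_Ioc c r).isPreconnected hov ⟨hc.2, le_rfl⟩ hr
    have hkS : k ∈ H a '' 𝒜 := by
      obtain ⟨x, hx, rfl⟩ := intermediate_value_Ioo hc.2.le (continuous_pot a).continuousOn hk
      exact ⟨(x, 0), hseg x ⟨hx.1, hx.2.le⟩, H_axis a x⟩
    obtain ⟨l', r', o', hx', hI⟩ := hint k hkS
    have hkh : k < h := o.right ▸ hk.2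
    have htr := isCrossSection_track h𝒜 hσ hS o hx hkS hkh
    -- The oval through σ k meets (l, r) and cannot reach l or r, where U equals h > k; hence it is
    -- nested in the given one.
    have hll' : l < l' := by
      by_contra hcon
      have := o'.le (x := l) ⟨not_lt.1 hcon, htr.1.le.trans hx'.2⟩
      rw [o.left] at this; linarith
    have hrr' : r' < r := by
      by_contra hcon
      have := o'.le (x := r) ⟨hx'.1.trans htr.2.le, not_lt.1 hcon⟩
      rw [o.right] at this; linarith
    refine ⟨l', r', hll', ?_, ?_, hrr', o', hI⟩
    · by_contra hcon
      rcases eq_or_lt_of_le (not_lt.1 hcon) with he | he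
      · rw [← he] at o'
        linarith [o'.left, hk.1]
      · linarith [hpos l' ⟨he, by linarith [o'.lt]⟩, o'.frc_left]
    · by_contra hcon
      rcases eq_or_lt_of_le (not_lt.1 hcon) with he | he
      · rw [he] at o'
        linarith [o'.right, hk.1]
      · linarith [hneg r' ⟨by linarith [o'.lt], he⟩, o'.frc_right]
  · right
    have ha0 : 0 < a := by
      by_contra hcon
      have ha' : a < 0 := lt_of_le_of_ne (not_lt.1 hcon) ha
      have hM := hpos (max r 1) (le_max_left _ _)
      simp only [frc] at hM
      have h1 : 1 ≤ max r 1 := le_max_right _ _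
      nlinarith [mul_nonneg (sub_nonneg.2 h1) (sub_nonneg.2 h1),
        mul_pos (neg_pos.2 ha') (pow_pos (zero_lt_one.trans_le h1) 3)]
    have hlt : ∀ {x y}, r ≤ x → x < y → pot a x < pot a y := fun {x y} h1 h2 =>
      pot_lt_of_frc_pos (u := r) (v := y) (fun x hx => hpos x hx.1.le) h1 h2 le_rfl
    have hgt : ∀ {x y}, x < y → y ≤ l → pot a y < pot a x := fun {x y} h1 h2 =>
      pot_lt_of_frc_neg (u := x) (v := l) (fun x hx => hneg x hx.2.le) le_rfl h1 h2
    refine ⟨ha0, l, r, o.lt, hpos, hneg, fun x hx => o.right ▸ o.le hx, fun k hk => ?_⟩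
    have hov : ∀ x ∈ Ici r, ∃ l', IsOval a (pot a x) l' x := by
      intro x hx
      have hrx : pot a r ≤ pot a x := by
        rcases eq_or_lt_of_le (mem_Ici.1 hx) with rfl | h'
        · exact le_rfl
        · exact (hlt le_rfl h').le
      -- Since a > 0, U tends to infinity on both sides, so every level above the given oval has a
      -- left end too.
      obtain ⟨m, hm1, hm2⟩ := (((tendsto_pot_atBot ha0).eventually_ge_atTop (pot a x)).and
        (eventually_le_atBot l)).exists
      obtain ⟨l', hl', hU⟩ := intermediate_value_Icc' hm2 (continuous_pot a).continuousOn
        ⟨show pot a l ≤ pot a x by rw [o.left, ← o.right]; exact hrx, hm1⟩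
      refine ⟨l', hl'.2.trans_lt (o.lt.trans_le hx), hU, rfl, fun y hy => ?_, hneg l' hl'.2,
        hpos x hx⟩
      rcases lt_or_ge y l with h1 | h1
      · rw [← hU]; exact hgt hy.1 h1.le
      rcases lt_or_ge r y with h2 | h2
      · exact hlt h2.le hy.2
      rcases eq_or_lt_of_le h1 with rfl | h1
      · rw [← hU]; exact hgt hy.1 le_rfl
      rcases eq_or_lt_of_le h2 with rfl | h2
      · exact hlt le_rfl hy.2
      · have := o.inside y ⟨h1, h2⟩
        rw [← o.right] at this
        exact this.trans_le hrx
    have hseg := h𝒜.segment_subset (convex_Ici r).isPreconnected hov self_mem_Ici hr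
    have hkS : k ∈ H a '' 𝒜 := by
      obtain ⟨m, hm1, hm2⟩ := (((tendsto_pot_atTop ha0).eventually_ge_atTop k).and
        (eventually_ge_atTop r)).exists
      obtain ⟨x, hx, rfl⟩ := intermediate_value_Icc hm2 (continuous_pot a).continuousOn ⟨hk.le, hm1⟩
      exact ⟨(x, 0), hseg x hx.1, H_axis a x⟩
    obtain ⟨l', r', o', -, hI⟩ := hint k hkS
    refine ⟨l', r', ?_, ?_, o', hI⟩
    · by_contra hcon
      rcases le_or_gt l' r with h1 | h1
      · have := o.le ⟨not_lt.1 hcon, h1⟩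
        rw [o'.left, ← o.right] at this; linarith
      · linarith [hpos l' h1.le, o'.frc_left]
    · by_contra hcon
      rcases le_or_gt l r' with h1 | h1
      · have := o.le ⟨h1, not_lt.1 hcon⟩
        rw [o'.right, ← o.right] at this; linarith
      · linarith [hneg r' h1.le, o'.frc_right]

/-! ### Polynomials that agree at the two ends of infinitely many ovals. -/

open Polynomial

/-- The potential as a polynomial. -/
def potPoly (a : ℝ) : ℝ[X] := C (1 / 2) * X ^ 2 - C (2 / 3) * X ^ 3 + C (a / 4) * X ^ 4

/-- The derivative of the potential as a polynomial. -/
def frcPoly (a : ℝ) : ℝ[X] := X - C 2 * X ^ 2 + C a * X ^ 3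

@[simp] theorem eval_potPoly (a x : ℝ) : (potPoly a).eval x = pot a x := by
  simp [potPoly, pot]; ring

@[simp] theorem eval_frcPoly (a x : ℝ) : (frcPoly a).eval x = frc a x := by
  simp [frcPoly, frc]

theorem derivative_potPoly (a : ℝ) : derivative (potPoly a) = frcPoly a := by
  refine Polynomial.funext fun x => ?_
  rw [eval_frcPoly, ← Polynomial.deriv]
  simp only [eval_potPoly]
  exact (hasDerivAt_pot a x).deriv

theorem natDegree_potPoly {a : ℝ} (ha : a ≠ 0) : (potPoly a).natDegree = 4 := by
  unfold potPoly
  compute_degree!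

theorem natDegree_frcPoly {a : ℝ} (ha : a ≠ 0) : (frcPoly a).natDegree = 3 := by
  unfold frcPoly
  compute_degree!

theorem exists_antiderivative (p : ℝ[X]) :
    ∃ q : ℝ[X], derivative q = p ∧ q.natDegree ≤ p.natDegree + 1 := by
  refine ⟨∑ i ∈ Finset.range (p.natDegree + 1), monomial (i + 1) (p.coeff i / (i + 1)), ?_, ?_⟩
  · conv_rhs => rw [p.as_sum_range]
    rw [derivative_sum]
    refine Finset.sum_congr rfl fun i _ => ?_
    rw [derivative_monomial]
    congr 1
    push_cast
    field_simp
  · refine natDegree_sum_le_of_forall_le _ _ fun i hi => (natDegree_monomial_le _).trans ?_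
    rw [Finset.mem_range] at hi
    omega

theorem exists_eq_cubic {R : ℝ[X]} (h : R.natDegree ≤ 3) :
    ∃ b₀ b₁ b₂ b₃ : ℝ, R = C b₀ + C b₁ * X + C b₂ * X ^ 2 + C b₃ * X ^ 3 := by
  refine ⟨R.coeff 0, R.coeff 1, R.coeff 2, R.coeff 3, ?_⟩
  conv_lhs => rw [R.as_sum_range_C_mul_X_pow' (Nat.lt_succ_of_le h)]
  simp [Finset.sum_range_succ]

section Curve
variable (a : ℝ)

/-- The common denominator of the parametrization of the curve `U(x) = U(z)`, `x ≠ z`, by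
`e = x + z`. -/
def curveDen : ℝ[X] := C (2 / 3) + C (-(a / 2)) * X

/-- The numerator of `x z` on the curve `U(x) = U(z)`, `x ≠ z`, in terms of `e = x + z`. -/
def curveNum (e : ℝ) : ℝ := 2 / 3 * e ^ 2 - 1 / 2 * e - a / 4 * e ^ 3

/-- The numerator of `(R(x) - R(z)) / (x - z)` on the curve, for a cubic polynomial `R`. -/
def curveSlope (b₁ b₂ b₃ : ℝ) : ℝ[X] :=
  C (2 / 3 * b₁) + C (b₃ / 2 + 2 / 3 * b₂ - a / 2 * b₁) * X + C (-(a / 2) * b₂) * X ^ 2 +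
    C (-(a / 4) * b₃) * X ^ 3

/-- The numerator of `U(x)` on the curve. -/
def curvePot : ℝ[X] :=
  C (-(a ^ 3 / 64)) * X ^ 6 + C (a ^ 2 / 8) * X ^ 5 + C (-(a / 3) - a ^ 2 / 16) * X ^ 4 +
    C (8 / 27 + a / 3) * X ^ 3 + C (-(4 / 9) - a / 16) * X ^ 2 + C (1 / 6) * X

variable {a}

theorem natDegree_curveDen (ha : a ≠ 0) : (curveDen a).natDegree = 1 := by
  unfold curveDen
  have : -(a / 2) ≠ 0 := by simpa using ha
  compute_degree!

theorem natDegree_curvePot (ha : a ≠ 0) : (curvePot a).natDegree = 6 := by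
  unfold curvePot
  have : -(a ^ 3 / 64) ≠ 0 := by simpa using ha
  compute_degree!

theorem natDegree_curveSlope_le (b₁ b₂ b₃ : ℝ) : (curveSlope a b₁ b₂ b₃).natDegree ≤ 3 := by
  unfold curveSlope
  compute_degree

theorem coeff_cubic_eq (c₀ c₁ c₂ c₃ : ℝ) :
    let p : ℝ[X] := C c₀ + C c₁ * X + C c₂ * X ^ 2 + C c₃ * X ^ 3
    p.coeff 0 = c₀ ∧ p.coeff 1 = c₁ ∧ p.coeff 2 = c₂ ∧ p.coeff 3 = c₃ := by
  simp [coeff_X, coeff_C, coeff_X_pow]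

theorem eq_zero_of_natDegree_curveSlope (ha : a ≠ 0) {b₁ b₂ b₃ : ℝ}
    (h : (curveSlope a b₁ b₂ b₃).natDegree = 0) : b₁ = 0 ∧ b₂ = 0 ∧ b₃ = 0 := by
  obtain ⟨-, e1, e2, e3⟩ := coeff_cubic_eq (2 / 3 * b₁) (b₃ / 2 + 2 / 3 * b₂ - a / 2 * b₁)
    (-(a / 2) * b₂) (-(a / 4) * b₃)
  change (curveSlope a b₁ b₂ b₃).coeff _ = _ at e1 e2 e3
  rw [coeff_eq_zero_of_natDegree_lt (by omega)] at e1 e2 e3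
  have h3 : b₃ = 0 := by simpa [ha] using e3.symm
  have h2 : b₂ = 0 := by simpa [ha] using e2.symm
  subst h3 h2
  exact ⟨by simpa [ha] using e1.symm, rfl, rfl⟩

/-- Dividing U(l) − U(r) by l − r leaves a relation that is linear in lr once l + r is fixed. This
expresses lr, then U (symmetrized over the two ends) and difference quotients of cubics, rationally
in e = l + r. A zero of the denominator would force e = 3/2 and a = 8/9, the case in which U is
symmetric about 3/4. -/
theorem curve_relations (ha8 : a ≠ 8 / 9) {l r : ℝ} (hlr : l ≠ r) (hU : pot a l = pot a r) :
    (curveDen a).eval (l + r) ≠ 0 ∧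
    (curveDen a).eval (l + r) * (l * r) = curveNum a (l + r) ∧
    (curveDen a).eval (l + r) ^ 2 * pot a l = (curvePot a).eval (l + r) ∧
    ∀ b₁ b₂ b₃, (curveSlope a b₁ b₂ b₃).eval (l + r) * (l - r) = (curveDen a).eval (l + r) *
      ((b₁ * l + b₂ * l ^ 2 + b₃ * l ^ 3) - (b₁ * r + b₂ * r ^ 2 + b₃ * r ^ 3)) := by
  have hd : (curveDen a).eval (l + r) = 2 / 3 - a / 2 * (l + r) := by simp [curveDen]; ring
  have h1 : (curveDen a).eval (l + r) * (l * r) = curveNum a (l + r) := by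
    have : (l - r) * ((curveDen a).eval (l + r) * (l * r) - curveNum a (l + r)) = 0 := by
      simp only [pot] at hU
      rw [hd]
      simp only [curveNum]
      linear_combination hU
    linarith [(mul_eq_zero.1 this).resolve_left (sub_ne_zero.2 hlr)]
  refine ⟨fun h0 => ?_, h1, ?_, fun b₁ b₂ b₃ => ?_⟩
  · rw [h0, zero_mul] at h1
    rw [hd] at h0
    simp only [curveNum] at h1
    apply ha8
    have hs : a * (l + r) = 4 / 3 := by linarith
    have hne : l + r ≠ 0 := fun h => by rw [h] at hs; norm_num at hs
    have h2 : (l + r) * (2 / 3 * (l + r) - 1 / 2 - 1 / 3 * (l + r)) = 0 := by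
      linear_combination -h1 + (l + r) ^ 2 / 4 * hs
    have h3 := (mul_eq_zero.1 h2).resolve_left hne
    have h4 : l + r = 3 / 2 := by linarith
    rw [h4] at hs
    linarith
  · have hs : pot a l = 1 / 2 * (((l + r) ^ 2 - 2 * (l * r)) / 2
        - 2 / 3 * ((l + r) ^ 3 - 3 * ((l + r) * (l * r)))
        + a / 4 * ((l + r) ^ 4 - 4 * ((l + r) ^ 2 * (l * r)) + 2 * (l * r) ^ 2)) := by
      simp only [pot] at hU ⊢
      linear_combination 1 / 2 * hU
    rw [hs]
    have he : (curvePot a).eval (l + r) = -(a ^ 3 / 64) * (l + r) ^ 6 + a ^ 2 / 8 * (l + r) ^ 5 +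
        (-(a / 3) - a ^ 2 / 16) * (l + r) ^ 4 + (8 / 27 + a / 3) * (l + r) ^ 3 +
        (-(4 / 9) - a / 16) * (l + r) ^ 2 + 1 / 6 * (l + r) := by
      simp [curvePot]
    rw [he]
    rw [hd] at h1 ⊢
    simp only [curveNum] at h1
    generalize l + r = e at *
    generalize l * r = p at *
    linear_combination (1 / 2 * (-1 + 2 * e - a * e ^ 2) * (2 / 3 - a / 2 * e) + a / 4 *
      ((2 / 3 - a / 2 * e) * p + (2 / 3 * e ^ 2 - 1 / 2 * e - a / 4 * e ^ 3))) * h1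
  · rw [hd] at h1 ⊢
    simp only [curveNum] at h1
    have he : (curveSlope a b₁ b₂ b₃).eval (l + r) = 2 / 3 * b₁ +
        (b₃ / 2 + 2 / 3 * b₂ - a / 2 * b₁) * (l + r) + -(a / 2) * b₂ * (l + r) ^ 2 +
        -(a / 4) * b₃ * (l + r) ^ 3 := by simp [curveSlope]
    rw [he]
    linear_combination b₃ * (l - r) * h1

/-- Expand W in base U with digits of degree at most 3; degree at most 11 means three digits. On the
curve, equality at the two ends becomes one polynomial identity in e. The degrees of its three terms
then force the digits to be constant, starting from the highest. -/
theorem exists_comp_pot (ha : a ≠ 0) (ha8 : a ≠ 8 / 9) {W : ℝ[X]} (hW : W.natDegree ≤ 11)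
    (hinf : {k | ∃ l r, l < r ∧ pot a l = k ∧ pot a r = k ∧ W.eval l = W.eval r}.Infinite) :
    ∃ c₀ c₁ c₂, W = C c₀ + C c₁ * potPoly a + C c₂ * potPoly a ^ 2 := by
  have hP4 := natDegree_potPoly ha
  have hdiv : ∀ p : ℝ[X], (p / potPoly a).natDegree + 4 ≤ max p.natDegree 4 := by
    intro p
    rcases lt_or_ge p.degree (potPoly a).degree with h | h
    · rw [(Polynomial.div_eq_zero_iff (by intro h0; simp [h0] at hP4)).2 h]; simp
    · have h1 := degree_add_div (by intro h0; simp [h0] at hP4) h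
      by_cases hp0 : p / potPoly a = 0
      · simp [hp0]
      have h2 := natDegree_eq_of_degree_eq (p := potPoly a * (p / potPoly a)) (q := p)
        (by rw [degree_mul, h1])
      rw [natDegree_mul (by intro h0; simp [h0] at hP4) hp0, hP4] at h2
      omega
  have hmod : ∀ p : ℝ[X], (p % potPoly a).natDegree ≤ 3 := fun p => by
    have := natDegree_mod_lt p (q := potPoly a) (by omega)
    omega
  set W₁ := W / potPoly a with hW₁
  have hW₁d : W₁.natDegree ≤ 7 := by have : W₁.natDegree + 4 ≤ _ := hdiv W; omega
  have hW₂d : (W₁ / potPoly a).natDegree ≤ 3 := by have := hdiv W₁; omega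
  obtain ⟨x₀, x₁, x₂, x₃, hx⟩ := exists_eq_cubic (hmod W)
  obtain ⟨y₀, y₁, y₂, y₃, hy⟩ := exists_eq_cubic (hmod W₁)
  obtain ⟨z₀, z₁, z₂, z₃, hz⟩ := exists_eq_cubic hW₂d
  have hWe : W = W % potPoly a + potPoly a * (W₁ % potPoly a) +
      potPoly a ^ 2 * (W₁ / potPoly a) := by
    have e1 := EuclideanDomain.div_add_mod W (potPoly a)
    have e2 := EuclideanDomain.div_add_mod W₁ (potPoly a)
    rw [← hW₁] at e1
    linear_combination -e1 - potPoly a * e2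
  set S₀ := curveSlope a x₁ x₂ x₃ with hS₀
  set S₁ := curveSlope a y₁ y₂ y₃ with hS₁
  set S₂ := curveSlope a z₁ z₂ z₃ with hS₂
  -- With d the denominator, the slopes of the digits are Sᵢ/d and U is `curvePot`/d². Multiplying
  -- the vanishing difference quotient of W by d⁵ gives Q.
  set Q := S₀ * curveDen a ^ 4 + S₁ * (curvePot a * curveDen a ^ 2) + S₂ * curvePot a ^ 2 with hQ
  have hroot : ∀ l r, l < r → pot a l = pot a r → W.eval l = W.eval r → Q.eval (l + r) = 0 := by
    intro l r hlr hU hWlr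
    obtain ⟨hd, -, h2, h3⟩ := curve_relations ha8 hlr.ne hU
    have hx' := h3 x₁ x₂ x₃
    have hy' := h3 y₁ y₂ y₃
    have hz' := h3 z₁ z₂ z₃
    have hlr' : l - r ≠ 0 := sub_ne_zero.2 hlr.ne
    rw [hWe, hx, hy, hz] at hWlr
    simp only [eval_add, eval_mul, eval_pow, eval_C, eval_X, eval_potPoly, ← hU] at hWlr
    have : (l - r) * Q.eval (l + r) = 0 := by
      simp only [hQ, eval_add, eval_mul, eval_pow, ← h2]
      generalize (curveDen a).eval (l + r) = d at *
      linear_combination d ^ 4 * hx' + d ^ 4 * pot a l * hy' + d ^ 4 * pot a l ^ 2 * hz'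
        + d ^ 5 * hWlr
    exact (mul_eq_zero.1 this).resolve_left hlr'
  -- The level k is a function of e, so infinitely many levels give infinitely many roots e.
  have hQ0 : Q = 0 := by
    refine eq_zero_of_infinite_isRoot Q fun hfin => hinf ?_
    refine (hfin.image fun e => (curvePot a).eval e / (curveDen a).eval e ^ 2).subset ?_
    rintro k ⟨l, r, hlr, hl, hr, hWlr⟩
    obtain ⟨hd, -, h2, -⟩ := curve_relations ha8 hlr.ne (hl.trans hr.symm)
    refine ⟨l + r, hroot l r hlr (hl.trans hr.symm) hWlr, ?_⟩
    simp only
    rw [← h2, hl]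
    field_simp
  have dD := natDegree_curveDen ha
  have dP := natDegree_curvePot ha
  have hDne : curveDen a ≠ 0 := by intro h0; simp [h0] at dD
  have hPne : curvePot a ≠ 0 := by intro h0; simp [h0] at dP
  have dS₀ : S₀.natDegree ≤ 3 := natDegree_curveSlope_le ..
  have dS₁ : S₁.natDegree ≤ 3 := natDegree_curveSlope_le ..
  have t₀ : (S₀ * curveDen a ^ 4).natDegree ≤ 7 :=
    natDegree_mul_le.trans (by rw [natDegree_pow, dD]; omega)
  have t₁ : (S₁ * (curvePot a * curveDen a ^ 2)).natDegree ≤ 11 :=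
    natDegree_mul_le.trans (by rw [natDegree_mul hPne (pow_ne_zero _ hDne), natDegree_pow, dD, dP]; omega)
  -- The last term would have degree at least 12, but the other two have degree at most 7 and 11.
  -- Afterwards the middle term would have degree at least 8 against 7.
  have z2 : S₂.natDegree = 0 := by
    by_contra hne
    have hS : S₂ ≠ 0 := by intro h0; simp [h0] at hne
    have e : S₂ * curvePot a ^ 2 = -(S₀ * curveDen a ^ 4 + S₁ * (curvePot a * curveDen a ^ 2)) := by
      linear_combination hQ0
    have e' := congrArg natDegree e
    rw [natDegree_mul hS (pow_ne_zero _ hPne), natDegree_pow, dP, natDegree_neg] at e'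
    have := natDegree_add_le (S₀ * curveDen a ^ 4) (S₁ * (curvePot a * curveDen a ^ 2))
    omega
  obtain ⟨hz1, hz2, hz3⟩ := eq_zero_of_natDegree_curveSlope ha z2
  have hS₂0 : S₂ = 0 := by rw [hS₂, hz1, hz2, hz3]; simp [curveSlope]
  have z1 : S₁.natDegree = 0 := by
    by_contra hne
    have hS : S₁ ≠ 0 := by intro h0; simp [h0] at hne
    have e : S₁ * (curvePot a * curveDen a ^ 2) = -(S₀ * curveDen a ^ 4) := by
      rw [hQ, hS₂0] at hQ0
      linear_combination hQ0
    have e' := congrArg natDegree e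
    rw [natDegree_mul hS (mul_ne_zero hPne (pow_ne_zero _ hDne)),
      natDegree_mul hPne (pow_ne_zero _ hDne), natDegree_pow, dD, dP, natDegree_neg] at e'
    omega
  obtain ⟨hy1, hy2, hy3⟩ := eq_zero_of_natDegree_curveSlope ha z1
  have hS₁0 : S₁ = 0 := by rw [hS₁, hy1, hy2, hy3]; simp [curveSlope]
  have hS₀0 : S₀ = 0 := by
    rw [hQ, hS₂0, hS₁0] at hQ0
    simpa [hDne] using hQ0
  obtain ⟨hx1, hx2, hx3⟩ := eq_zero_of_natDegree_curveSlope (a := a) ha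
    (show (curveSlope a x₁ x₂ x₃).natDegree = 0 by rw [← hS₀, hS₀0]; simp)
  refine ⟨x₀, y₀, z₀, ?_⟩
  rw [hWe, hx, hy, hz, hx1, hx2, hx3, hy1, hy2, hy3, hz1, hz2, hz3]
  simp only [C_0, zero_mul, add_zero]
  ring

end Curve

/-- If `W' = M U'` and `W` takes equal values at the two ends of infinitely many ovals, then `M` is
an affine function of `U`. -/
theorem exists_eq_smul_frcPoly {a : ℝ} (ha : a ≠ 0) (ha8 : a ≠ 8 / 9) {N M W : ℝ[X]}
    (hN : N.natDegree ≤ 6) (hM : derivative M = N) (hMd : M.natDegree ≤ N.natDegree + 1)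
    (hW : derivative W = M * frcPoly a) (hWd : W.natDegree ≤ (M * frcPoly a).natDegree + 1)
    (hinf : {k | ∃ l r, l < r ∧ pot a l = k ∧ pot a r = k ∧ W.eval l = W.eval r}.Infinite) :
    ∃ c, N = C c * frcPoly a := by
  have h3 := natDegree_frcPoly ha
  have hf0 : frcPoly a ≠ 0 := by intro h0; simp [h0] at h3
  have := natDegree_mul_le (p := M) (q := frcPoly a)
  obtain ⟨c₀, c₁, c₂, h⟩ := exists_comp_pot ha ha8 (by omega) hinf
  rw [h] at hW
  simp only [derivative_add, derivative_C, derivative_mul, derivative_pow, derivative_potPoly] at hW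
  have hM' : M = C c₁ + C (2 * c₂) * potPoly a := by
    refine mul_right_cancel₀ hf0 ?_
    rw [← hW, C_mul]
    simp
    ring
  refine ⟨2 * c₂, ?_⟩
  rw [← hM, hM']
  simp [derivative_potPoly]

/-! ### From vanishing Abel integrals to N = bU': ovals around one equilibrium. -/

open MeasureTheory

theorem integral_sqrt_sub_sq {m Z : ℝ} (hm : 0 ≤ m) (hZ : 0 ≤ Z) (hmZ : m ≤ Z ^ 2) :
    ∫ z in (-Z)..Z, √(m - z ^ 2) = m * (Real.pi / 2) := by
  have hc : Continuous fun z : ℝ => √(m - z ^ 2) := by fun_prop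
  set s := √m with hs
  have hs0 : 0 ≤ s := Real.sqrt_nonneg _
  have hsm : s ^ 2 = m := Real.sq_sqrt hm
  have hsZ : s ≤ Z := Real.sqrt_le_left hZ |>.2 hmZ
  have out : ∀ u v : ℝ, (∀ z ∈ uIcc u v, s ^ 2 ≤ z ^ 2) → ∫ z in u..v, √(m - z ^ 2) = 0 := by
    intro u v h
    rw [intervalIntegral.integral_congr (g := fun _ => 0) fun z hz =>
      Real.sqrt_eq_zero_of_nonpos (by linarith [h z hz])]
    simp
  rw [← intervalIntegral.integral_add_adjacent_intervals (hc.intervalIntegrable (-Z) (-s))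
    (hc.intervalIntegrable (-s) Z), ← intervalIntegral.integral_add_adjacent_intervals
    (hc.intervalIntegrable (-s) s) (hc.intervalIntegrable s Z), out, out s Z, zero_add, add_zero]
  · have := intervalIntegral.smul_integral_comp_mul_left (fun z => √(m - z ^ 2)) s
      (a := -1) (b := 1)
    rw [mul_one, mul_neg, mul_one] at this
    rw [← this, intervalIntegral.integral_congr (g := fun z => s * √(1 - z ^ 2)) fun z _ => ?_,
      intervalIntegral.integral_const_mul, integral_sqrt_one_sub_sq, smul_eq_mul, ← hsm]
    · ring
    · simp only
      rw [← hsm, show s ^ 2 - (s * z) ^ 2 = s ^ 2 * (1 - z ^ 2) by ring,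
        Real.sqrt_mul (sq_nonneg s), Real.sqrt_sq hs0]
  · intro z hz
    rw [uIcc_of_le hsZ] at hz
    nlinarith [hz.1]
  · intro z hz
    rw [uIcc_of_le (by linarith)] at hz
    nlinarith [hz.2]

/-- If the Abel integrals of order one half vanish, so do those of order one. -/
theorem integral_mul_sub_eq_zero {a l r k : ℝ} {N : ℝ → ℝ} (hN : Continuous N) (hlr : l ≤ r)
    (hU : ∀ x ∈ Icc l r, pot a x ≤ k)
    (h : ∀ h ≤ k, ∫ x in l..r, N x * √(2 * (h - pot a x)) = 0) :
    ∫ x in l..r, N x * (k - pot a x) = 0 := by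
  obtain ⟨B, hB⟩ := (isCompact_Icc.image (f := fun x => 2 * (k - pot a x)) (s := Icc l r)
    (by fun_prop)).bddAbove
  have hB' : ∀ x ∈ Icc l r, 2 * (k - pot a x) ≤ B := fun x hx => hB (mem_image_of_mem _ hx)
  set Z := |B| + 1 with hZ
  have hZ0 : 0 ≤ Z := by positivity
  have hBZ : B ≤ Z ^ 2 := by nlinarith [abs_nonneg B, le_abs_self B]
  have hcF : Continuous (Function.uncurry fun z x : ℝ => N x * √(2 * (k - z ^ 2 / 2 - pot a x))) := by
    unfold Function.uncurry
    fun_prop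
  -- This is a half-order fractional integration in the energy, at level k − z²/2. After exchanging
  -- the integrals, the inner one is the area of a half-disc of squared radius 2(k − U(x)), namely
  -- π(k − U(x)).
  have e1 : ∫ z in (-Z)..Z, ∫ x in l..r, N x * √(2 * (k - z ^ 2 / 2 - pot a x)) = 0 := by
    rw [intervalIntegral.integral_congr (g := fun _ => 0) fun z _ => h _ (by
      linarith [sq_nonneg z])]
    simp
  rw [intervalIntegral_intervalIntegral_swap ((hcF.continuousOn.integrableOn_compact
    (isCompact_uIcc.prod isCompact_uIcc)).mono_set (prod_mono uIoc_subset_uIcc uIoc_subset_uIcc)),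
    intervalIntegral.integral_congr (g := fun x => N x * (k - pot a x) * Real.pi) fun x hx => ?_,
    intervalIntegral.integral_mul_const] at e1
  · exact (mul_eq_zero.1 e1).resolve_right Real.pi_ne_zero
  · rw [uIcc_of_le hlr] at hx
    simp only
    rw [intervalIntegral.integral_const_mul, intervalIntegral.integral_congr
      (g := fun z => √(2 * (k - pot a x) - z ^ 2)) fun z _ => by
        simp only; congr 1; ring,
      integral_sqrt_sub_sq (by linarith [hU x hx]) hZ0 ((hB' x hx).trans hBZ)]
    ring

/-- M (k − U) + W is a primitive of N (k − U), and its first term vanishes at both ends. -/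
theorem eval_eq_of_integral_eq_zero {a l r k : ℝ} {N M W : ℝ[X]} (hM : derivative M = N)
    (hW : derivative W = M * frcPoly a) (hl : pot a l = k) (hr : pot a r = k)
    (h : ∫ x in l..r, N.eval x * (k - pot a x) = 0) : W.eval l = W.eval r := by
  have hd : ∀ x, HasDerivAt (fun x => M.eval x * (k - pot a x) + W.eval x)
      (N.eval x * (k - pot a x)) x := by
    intro x
    refine (((M.hasDerivAt x).mul ((hasDerivAt_pot a x).const_sub k)).add
      (W.hasDerivAt x)).congr_deriv ?_
    rw [hM, hW]
    simp
  rw [intervalIntegral.integral_eq_sub_of_hasDerivAt (fun x _ => hd x)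
    (Continuous.intervalIntegrable (by fun_prop) _ _), hl, hr] at h
  simp at h
  linarith

/-- An integral whose Abel transform vanishes on all ovals around one equilibrium. -/
theorem exists_eq_smul_of_center {a : ℝ} (ha : a ≠ 0) (ha8 : a ≠ 8 / 9) {N : ℝ[X]}
    (hN : N.natDegree ≤ 6) {l₀ c r₀ : ℝ} (hc2 : c < r₀)
    (hneg : ∀ x ∈ Ico l₀ c, frc a x < 0) (hpos : ∀ x ∈ Ioc c r₀, 0 < frc a x)
    (h : ∀ k ∈ Ioo (pot a c) (pot a r₀), ∃ l r, l₀ < l ∧ l < c ∧ c < r ∧ r < r₀ ∧ IsOval a k l r ∧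
        ∫ x in l..r, N.eval x * √(2 * (k - pot a x)) = 0) :
    ∃ b, N = C b * frcPoly a := by
  have hlc : ∀ {x y}, l₀ ≤ x → x < y → y ≤ c → pot a y < pot a x := fun h1 h2 h3 =>
    pot_lt_of_frc_neg (u := l₀) (v := c) (fun x hx => hneg x ⟨hx.1.le, hx.2⟩) h1 h2 h3
  have hcr : ∀ {x y}, c ≤ x → x < y → y ≤ r₀ → pot a x < pot a y := fun h1 h2 h3 =>
    pot_lt_of_frc_pos (u := c) (v := r₀) (fun x hx => hpos x ⟨hx.1, hx.2.le⟩) h1 h2 h3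
  obtain ⟨M, hM, hMd⟩ := exists_antiderivative N
  obtain ⟨W, hW, hWd⟩ := exists_antiderivative (M * frcPoly a)
  refine exists_eq_smul_frcPoly ha ha8 hN hM hMd hW hWd
    ((Ioo_infinite (hcr le_rfl hc2 le_rfl)).mono fun k hk => ?_)
  obtain ⟨l, r, hl0, hlc', hcr', hr0, o, -⟩ := h k hk
  refine ⟨l, r, o.lt, o.left, o.right, eval_eq_of_integral_eq_zero hM hW o.left o.right
    (integral_mul_sub_eq_zero N.continuous o.lt.le (fun x hx => o.le hx) fun h' hh' => ?_)⟩
  have hcont : Continuous fun x => N.eval x * √(2 * (h' - pot a x)) := by fun_prop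
  have out : ∀ u v : ℝ, (∀ x ∈ uIcc u v, h' ≤ pot a x) →
      ∫ x in u..v, N.eval x * √(2 * (h' - pot a x)) = 0 := by
    intro u v huv
    rw [intervalIntegral.integral_congr (g := fun _ => 0) fun x hx => by
      simp only; rw [Real.sqrt_eq_zero_of_nonpos (by linarith [huv x hx]), mul_zero]]
    simp
  -- On the fixed interval [l, r], the root vanishes wherever U ≥ h'. The integral at a lower level
  -- is therefore zero below the equilibrium value and otherwise reduces to the smaller oval at
  -- level h'.
  rcases le_or_gt h' (pot a c) with hle | hgt
  · refine out _ _ fun x hx => hle.trans ?_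
    rw [uIcc_of_le o.lt.le] at hx
    rcases lt_trichotomy x c with h1 | rfl | h1
    · exact (hlc (hl0.le.trans hx.1) h1 le_rfl).le
    · exact le_rfl
    · exact (hcr le_rfl h1 (hx.2.trans hr0.le)).le
  · obtain ⟨l', r', hl0', hlc'', hcr'', hr0', o', hI⟩ := h h' ⟨hgt, hh'.trans_lt hk.2⟩
    have hl : l ≤ l' := by
      by_contra hcon
      have := hlc hl0'.le (not_le.1 hcon) hlc'.le
      rw [o.left, o'.left] at this; linarith
    have hr : r' ≤ r := by
      by_contra hcon
      have := hcr hcr'.le (not_le.1 hcon) hr0'.le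
      rw [o.right, o'.right] at this; linarith
    rw [← intervalIntegral.integral_add_adjacent_intervals (hcont.intervalIntegrable l l')
      (hcont.intervalIntegrable l' r), ← intervalIntegral.integral_add_adjacent_intervals
      (hcont.intervalIntegrable l' r') (hcont.intervalIntegrable r' r), hI, out, out r' r]
    · simp
    · intro x hx
      rw [uIcc_of_le hr] at hx
      rcases eq_or_lt_of_le hx.1 with rfl | h1
      · exact o'.right.ge
      · rw [← o'.right]; exact (hcr hcr''.le h1 (hx.2.trans hr0.le)).le
    · intro x hx
      rw [uIcc_of_le hl] at hx
      rcases eq_or_lt_of_le hx.2 with rfl | h1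
      · exact o'.left.ge
      · rw [← o'.left]; exact (hlc (hl0.le.trans hx.1) h1 hlc''.le).le

/-! ### From vanishing Abel integrals to N = bU': exterior ovals, by Laplace transform. -/

/-- Half of A w⁴ absorbs the cubic term and the other half absorbs the quadratic ones, by completing
squares. It supplies Gaussian dominating functions. -/
theorem exists_quartic_bound {A : ℝ} (hA : 0 < A) (B D : ℝ) :
    ∃ K, ∀ w : ℝ, -A * w ^ 4 + B * |w| ^ 3 + D * w ^ 2 ≤ K - w ^ 2 := by
  refine ⟨(B ^ 2 / (2 * A) + D + 1) ^ 2 / (2 * A), fun w => ?_⟩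
  have h1 : B * |w| ^ 3 ≤ A / 2 * w ^ 4 + B ^ 2 / (2 * A) * w ^ 2 := by
    have : A / 2 * w ^ 4 + B ^ 2 / (2 * A) * w ^ 2 - B * |w| ^ 3 =
        A / 2 * (w ^ 2 - B / A * |w|) ^ 2 := by
      have e2 : w ^ 2 = |w| ^ 2 := (sq_abs w).symm
      have e4 : w ^ 4 = |w| ^ 4 := by rw [show w ^ 4 = (w ^ 2) ^ 2 by ring, e2]; ring
      rw [e4, e2]
      field_simp
      ring
    nlinarith [sq_nonneg (w ^ 2 - B / A * |w|)]
  have h2 : (B ^ 2 / (2 * A) + D + 1) * w ^ 2 ≤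
      A / 2 * w ^ 4 + (B ^ 2 / (2 * A) + D + 1) ^ 2 / (2 * A) := by
    generalize B ^ 2 / (2 * A) + D + 1 = E
    have : A / 2 * w ^ 4 + E ^ 2 / (2 * A) - E * w ^ 2 = A / 2 * (w ^ 2 - E / A) ^ 2 := by
      field_simp
      ring
    nlinarith [sq_nonneg (w ^ 2 - E / A)]
  linarith

theorem integrable_abs_pow_mul_exp (j : ℕ) (K : ℝ) :
    Integrable fun w : ℝ => |w| ^ j * Real.exp (K - w ^ 2) := by
  have h := (integrable_rpow_mul_exp_neg_mul_sq (b := 1) one_pos (s := j)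
    (by linarith [j.cast_nonneg (α := ℝ)])).norm.mul_const (Real.exp K)
  refine h.congr (Eventually.of_forall fun w => ?_)
  simp only [Real.rpow_natCast, norm_mul, norm_pow, Real.norm_eq_abs, Real.abs_exp]
  rw [sub_eq_add_neg, Real.exp_add, neg_one_mul]
  ring

/-- The rescaled Gibbs factor `exp (-τ⁴ U(w / τ))`. -/
def gibbs (a : ℝ) (τ : ℂ) (w : ℝ) : ℂ :=
  Complex.exp (-(τ ^ 2 * w ^ 2 / 2 - 2 / 3 * τ * w ^ 3 + a / 4 * w ^ 4))

/-- The quartic part of the exponent is real and independent of τ, so it dominates the τ-dependent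
terms uniformly on discs. This makes the rescaled integrals entire in τ. -/
theorem norm_gibbs_le {a : ℝ} (ha : 0 < a) (R : ℝ) :
    ∃ K, ∀ τ : ℂ, ‖τ‖ ≤ R → ∀ w : ℝ, ‖gibbs a τ w‖ ≤ Real.exp (K - w ^ 2) := by
  obtain ⟨K, hK⟩ := exists_quartic_bound (A := a / 4) (by positivity) (2 / 3 * R) (R ^ 2 / 2)
  refine ⟨K, fun τ hτ w => ?_⟩
  rw [gibbs, Complex.norm_exp, Real.exp_le_exp]
  refine le_trans ?_ (hK w)
  have e : (-(τ ^ 2 * w ^ 2 / 2 - 2 / 3 * τ * w ^ 3 + a / 4 * w ^ 4) : ℂ) =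
      (-τ ^ 2 * w ^ 2 / 2 + 2 / 3 * τ * w ^ 3) + ((-(a / 4) * w ^ 4 : ℝ) : ℂ) := by
    push_cast; ring
  rw [e, Complex.add_re, Complex.ofReal_re]
  have hR : 0 ≤ R := (norm_nonneg τ).trans hτ
  have h1 : (-τ ^ 2 * (w : ℂ) ^ 2 / 2 + 2 / 3 * τ * (w : ℂ) ^ 3).re ≤
      R ^ 2 / 2 * w ^ 2 + 2 / 3 * R * |w| ^ 3 := by
    refine (Complex.re_le_norm _).trans ((norm_add_le _ _).trans ?_)
    simp only [norm_mul, norm_div, norm_neg, norm_pow, Complex.norm_real, Real.norm_eq_abs]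
    norm_num
    have : ‖τ‖ ^ 2 ≤ R ^ 2 := by gcongr
    have h3 := mul_le_mul_of_nonneg_right this (sq_nonneg w)
    have h4 := mul_le_mul_of_nonneg_right hτ (pow_nonneg (abs_nonneg w) 3)
    linarith
  linarith

theorem differentiable_integral_gibbs {a : ℝ} (ha : 0 < a) (j : ℕ) :
    Differentiable ℂ fun τ => ∫ w : ℝ, (w : ℂ) ^ j * gibbs a τ w := by
  intro τ₀
  obtain ⟨K, hK⟩ := norm_gibbs_le ha (‖τ₀‖ + 1)
  have hcont : ∀ τ, Continuous fun w : ℝ => (w : ℂ) ^ j * gibbs a τ w := by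
    intro τ; unfold gibbs; fun_prop
  have hd : ∀ (τ : ℂ) (w : ℝ), HasDerivAt (fun τ => (w : ℂ) ^ j * gibbs a τ w)
      ((w : ℂ) ^ j * (gibbs a τ w * (-(τ * w ^ 2) + 2 / 3 * w ^ 3))) τ := by
    intro τ w
    have h1 : HasDerivAt (fun τ : ℂ => -(τ ^ 2 * w ^ 2 / 2 - 2 / 3 * τ * w ^ 3 + a / 4 * w ^ 4))
        (-(τ * w ^ 2) + 2 / 3 * w ^ 3) τ := by
      have h2 := (((((hasDerivAt_pow 2 τ).mul_const ((w : ℂ) ^ 2)).div_const 2).sub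
        (((hasDerivAt_id τ).const_mul (2 / 3 : ℂ)).mul_const ((w : ℂ) ^ 3))).add_const
        ((a : ℂ) / 4 * w ^ 4)).neg
      refine h2.congr_deriv ?_
      simp
      ring
    exact (h1.cexp).const_mul _
  refine (hasDerivAt_integral_of_dominated_loc_of_deriv_le
    (F' := fun τ w => (w : ℂ) ^ j * (gibbs a τ w * (-(τ * w ^ 2) + 2 / 3 * w ^ 3)))
    (bound := fun w => (‖τ₀‖ + 1) * (|w| ^ (j + 2) * Real.exp (K - w ^ 2)) +
      2 / 3 * (|w| ^ (j + 3) * Real.exp (K - w ^ 2)))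
    (Metric.ball_mem_nhds τ₀ one_pos) (Eventually.of_forall fun τ => (hcont τ).aestronglyMeasurable)
    ?_ ?_ ?_ ?_ ?_).2.differentiableAt
  · refine (integrable_abs_pow_mul_exp j K).mono' (hcont τ₀).aestronglyMeasurable
      (Eventually.of_forall fun w => ?_)
    rw [norm_mul, norm_pow, Complex.norm_real, Real.norm_eq_abs]
    gcongr
    exact hK τ₀ (by linarith) w
  · refine Continuous.aestronglyMeasurable ?_
    unfold gibbs; fun_prop
  · refine Eventually.of_forall fun w τ hτ => ?_
    have hτ' : ‖τ‖ ≤ ‖τ₀‖ + 1 := by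
      have : ‖τ‖ ≤ ‖τ₀‖ + ‖τ - τ₀‖ := by
        have := norm_add_le τ₀ (τ - τ₀); simpa using this
      rw [Metric.mem_ball, dist_eq_norm] at hτ
      linarith
    have h1 := hK τ hτ' w
    have h2 : ‖-(τ * (w : ℂ) ^ 2) + 2 / 3 * (w : ℂ) ^ 3‖ ≤ (‖τ₀‖ + 1) * |w| ^ 2 + 2 / 3 * |w| ^ 3 := by
      refine (norm_add_le _ _).trans ?_
      simp only [norm_mul, norm_div, norm_neg, norm_pow, Complex.norm_real, Real.norm_eq_abs]
      norm_num
      gcongr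
    rw [norm_mul, norm_mul, norm_pow, Complex.norm_real, Real.norm_eq_abs]
    calc |w| ^ j * (‖gibbs a τ w‖ * ‖-(τ * (w : ℂ) ^ 2) + 2 / 3 * (w : ℂ) ^ 3‖)
        ≤ |w| ^ j * (Real.exp (K - w ^ 2) * ((‖τ₀‖ + 1) * |w| ^ 2 + 2 / 3 * |w| ^ 3)) := by gcongr
      _ = _ := by ring
  · exact ((integrable_abs_pow_mul_exp _ K).const_mul _).add
      ((integrable_abs_pow_mul_exp _ K).const_mul _)
  · exact Eventually.of_forall fun w τ _ => hd τ w

theorem integrable_pow_mul_exp_pot {a t : ℝ} (ha : 0 < a) (ht : 0 < t) (j : ℕ) :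
    Integrable fun x : ℝ => x ^ j * Real.exp (-(t * pot a x)) := by
  obtain ⟨K, hK⟩ := exists_quartic_bound (A := t * a / 4) (by positivity) (2 / 3 * t) 0
  refine (integrable_abs_pow_mul_exp j K).mono'
    (Continuous.aestronglyMeasurable (by fun_prop)) (Eventually.of_forall fun w => ?_)
  rw [norm_mul, norm_pow, Real.norm_eq_abs, Real.norm_eq_abs, Real.abs_exp]
  gcongr
  refine le_trans ?_ (hK w)
  have h3 : w ^ 3 ≤ |w| ^ 3 := by rw [← abs_pow]; exact le_abs_self _
  simp only [pot]
  nlinarith [mul_le_mul_of_nonneg_left h3 ht.le, mul_nonneg ht.le (sq_nonneg w)]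

theorem integrable_eval_mul_exp_pot {a t : ℝ} (ha : 0 < a) (ht : 0 < t) (N : ℝ[X]) :
    Integrable fun x : ℝ => N.eval x * Real.exp (-(t * pot a x)) := by
  have : (fun x : ℝ => N.eval x * Real.exp (-(t * pot a x))) = fun x =>
      ∑ j ∈ Finset.range (N.natDegree + 1), N.coeff j * (x ^ j * Real.exp (-(t * pot a x))) := by
    ext x
    rw [eval_eq_sum_range, Finset.sum_mul]
    exact Finset.sum_congr rfl fun j _ => by ring
  rw [this]
  exact integrable_finsetSum _ fun j _ => (integrable_pow_mul_exp_pot ha ht j).const_mul _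

/-- The Laplace transform of `h ↦ √(2 (h - u))`. -/
theorem integral_sqrt_mul_exp {t : ℝ} (ht : 0 < t) (u : ℝ) :
    ∫ h : ℝ, √(2 * (h - u)) * Real.exp (-(t * h)) =
      √2 * Real.Gamma (3 / 2) * (1 / t) ^ (3 / 2 : ℝ) * Real.exp (-(t * u)) := by
  have e0 : ∫ h : ℝ, √(2 * (h - u)) * Real.exp (-(t * h)) =
      ∫ s : ℝ, √(2 * s) * Real.exp (-(t * s)) * Real.exp (-(t * u)) := by
    rw [← integral_add_right_eq_self _ u]
    refine integral_congr_ae (Eventually.of_forall fun s => ?_)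
    simp only [add_sub_cancel_right]
    rw [mul_assoc, ← Real.exp_add]
    congr 2
    ring
  rw [e0, integral_mul_const]
  congr 1
  rw [← setIntegral_eq_integral_of_forall_compl_eq_zero (s := Ioi 0) fun s hs => by
    rw [Real.sqrt_eq_zero_of_nonpos (by linarith [not_lt.1 (show ¬(0 < s) from hs)]), zero_mul]]
  have hG := Real.integral_rpow_mul_exp_neg_mul_Ioi (a := 3 / 2) (by norm_num) ht
  rw [setIntegral_congr_fun (g := fun s => √2 * (s ^ (3 / 2 - 1 : ℝ) * Real.exp (-(t * s))))
    measurableSet_Ioi fun s _ => ?_, integral_const_mul, hG]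
  · ring
  · simp only
    rw [Real.sqrt_mul zero_le_two, Real.sqrt_eq_rpow s]
    norm_num
    ring

theorem laplace_const_ne_zero {t : ℝ} (ht : 0 < t) (u : ℝ) :
    √2 * Real.Gamma (3 / 2) * (1 / t) ^ (3 / 2 : ℝ) * Real.exp (-(t * u)) ≠ 0 := by
  have := Real.Gamma_pos_of_pos (show (0 : ℝ) < 3 / 2 by norm_num)
  positivity

theorem integral_laplace_eq {a t : ℝ} (ha : 0 < a) (ht : 0 < t) (N : ℝ[X]) :
    ∫ h : ℝ, (∫ x : ℝ, N.eval x * √(2 * (h - pot a x))) * Real.exp (-(t * h)) =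
      √2 * Real.Gamma (3 / 2) * (1 / t) ^ (3 / 2 : ℝ) *
        ∫ x : ℝ, N.eval x * Real.exp (-(t * pot a x)) := by
  set f : ℝ → ℝ → ℝ := fun x h => N.eval x * √(2 * (h - pot a x)) * Real.exp (-(t * h)) with hf
  have hcont : Continuous (Function.uncurry f) := by
    unfold Function.uncurry
    fun_prop
  -- A nonintegrable function would have integral 0 by convention, contrary to the nonzero value
  -- just computed.
  have hint1 : ∀ x, Integrable fun h : ℝ => √(2 * (h - pot a x)) * Real.exp (-(t * h)) := fun x => by
    by_contra hcon
    exact laplace_const_ne_zero ht (pot a x)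
      ((integral_sqrt_mul_exp ht (pot a x)).symm.trans (integral_undef hcon))
  have hint : Integrable (Function.uncurry f) (volume.prod volume) := by
    rw [integrable_prod_iff hcont.aestronglyMeasurable]
    constructor
    · refine Eventually.of_forall fun x => ?_
      simp only [Function.uncurry, hf, mul_assoc]
      exact (hint1 x).const_mul _
    · have e : (fun x => ∫ h, ‖Function.uncurry f (x, h)‖) = fun x =>
          √2 * Real.Gamma (3 / 2) * (1 / t) ^ (3 / 2 : ℝ) *
            |N.eval x * Real.exp (-(t * pot a x))| := by
        ext x
        simp only [Function.uncurry, hf, mul_assoc, norm_mul, Real.norm_eq_abs, Real.abs_exp,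
          abs_of_nonneg (Real.sqrt_nonneg _)]
        rw [integral_const_mul, integral_sqrt_mul_exp ht]
        rw [abs_mul, Real.abs_exp]
        ring
      rw [e]
      exact ((integrable_eval_mul_exp_pot ha ht N).abs).const_mul _
  have hs := integral_integral_swap hint
  calc _ = ∫ h : ℝ, ∫ x : ℝ, f x h := by
        refine integral_congr_ae (Eventually.of_forall fun h => ?_)
        simp only [hf]
        rw [integral_mul_const]
    _ = ∫ x : ℝ, ∫ h : ℝ, f x h := hs.symm
    _ = _ := by
        rw [← integral_const_mul]
        refine integral_congr_ae (Eventually.of_forall fun x => ?_)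
        simp only [hf, mul_assoc]
        rw [integral_const_mul, integral_sqrt_mul_exp ht]
        ring

/-- A continuous function on an interval all of whose exponential moments vanish is zero. -/
theorem eq_zero_of_integral_exp {m M : ℝ} (hmM : m < M) {ψ : ℝ → ℝ} (hψ : Continuous ψ)
    (h : ∀ t : ℝ, 0 < t → ∫ s in m..M, ψ s * Real.exp (-(t * s)) = 0) :
    ∀ s ∈ Ioo m M, ψ s = 0 := by
  -- The moments are known for positive exponents only, hence the extra factor exp(−s), which turns
  -- the j-th power into the exponent j + 1.
  have hpoly : ∀ p : ℝ[X], ∫ s in m..M, ψ s * (Real.exp (-s) * p.eval (Real.exp (-s))) = 0 := by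
    intro p
    have e : ∀ s, ψ s * (Real.exp (-s) * p.eval (Real.exp (-s))) =
        ∑ j ∈ Finset.range (p.natDegree + 1), p.coeff j *
          (ψ s * Real.exp (-(((j : ℝ) + 1) * s))) := by
      intro s
      rw [eval_eq_sum_range, Finset.mul_sum, Finset.mul_sum]
      refine Finset.sum_congr rfl fun j _ => ?_
      rw [show -(((j : ℝ) + 1) * s) = (j : ℝ) * (-s) + -s by ring, Real.exp_add, Real.exp_nat_mul]
      ring
    simp_rw [e]
    rw [intervalIntegral.integral_finsetSum fun j _ =>
      Continuous.intervalIntegrable (by fun_prop) _ _]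
    refine Finset.sum_eq_zero fun j _ => ?_
    rw [intervalIntegral.integral_const_mul, h _ (by positivity), mul_zero]
  have hsq : ∫ s in m..M, ψ s * ψ s = 0 := by
    obtain ⟨B, hB⟩ := (isCompact_Icc.image (f := fun s => |ψ s * Real.exp (-s)|) (s := Icc m M)
      (by fun_prop)).bddAbove
    have hB' : ∀ x ∈ Icc m M, |ψ x * Real.exp (-x)| ≤ B := fun x hx => hB (mem_image_of_mem _ hx)
    have hB0 : 0 ≤ B := (abs_nonneg _).trans (hB' m ⟨le_rfl, hmM.le⟩)
    have key : ∀ ε > 0, |∫ s in m..M, ψ s * ψ s| ≤ B * ε * |M - m| := by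
      intro ε hε
      -- In the variable u = exp(−s) one has ψ(s) = u g(u). Weierstrass approximation of g makes ∫
      -- ψ² arbitrarily small.
      set g : ℝ → ℝ := fun u => ψ (-Real.log u) / u with hg
      have hpos : ∀ u ∈ Icc (Real.exp (-M)) (Real.exp (-m)), u ≠ 0 := fun u hu =>
        ((Real.exp_pos _).trans_le hu.1).ne'
      have hgc : ContinuousOn g (Icc (Real.exp (-M)) (Real.exp (-m))) := by
        refine ContinuousOn.div ?_ continuousOn_id hpos
        exact hψ.comp_continuousOn ((Real.continuousOn_log.mono fun u hu => hpos u hu).neg)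
      obtain ⟨p, hp⟩ := exists_polynomial_near_of_continuousOn _ _ g hgc ε hε
      have e : ∫ s in m..M, ψ s * ψ s =
          ∫ s in m..M, ψ s * Real.exp (-s) * (g (Real.exp (-s)) - p.eval (Real.exp (-s))) := by
        rw [← sub_zero (∫ s in m..M, ψ s * ψ s), ← hpoly p, ← intervalIntegral.integral_sub
          (Continuous.intervalIntegrable (by fun_prop) _ _)
          (Continuous.intervalIntegrable (by fun_prop) _ _)]
        refine intervalIntegral.integral_congr fun s _ => ?_
        simp only [hg, Real.log_exp, neg_neg]
        have := (Real.exp_pos (-s)).ne'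
        field_simp
      rw [e, ← Real.norm_eq_abs]
      refine intervalIntegral.norm_integral_le_of_norm_le_const fun s hs => ?_
      rw [uIoc_of_le hmM.le] at hs
      rw [norm_mul, Real.norm_eq_abs, Real.norm_eq_abs]
      have h1 := hB' s ⟨hs.1.le, hs.2⟩
      have h2 := hp (Real.exp (-s)) ⟨Real.exp_le_exp.2 (by linarith [hs.2]),
        Real.exp_le_exp.2 (by linarith [hs.1])⟩
      rw [abs_sub_comm] at h2
      gcongr
    by_contra hne
    have hpos := abs_pos.2 hne
    have hL : 0 < M - m := by linarith
    have := key (|∫ s in m..M, ψ s * ψ s| / (2 * (B + 1) * (M - m))) (by positivity)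
    rw [abs_of_pos hL] at this
    have h2 : B * (|∫ s in m..M, ψ s * ψ s| / (2 * (B + 1) * (M - m))) * (M - m) =
        |∫ s in m..M, ψ s * ψ s| * (B / (2 * (B + 1))) := by field_simp
    rw [h2] at this
    have h3 : B / (2 * (B + 1)) ≤ 1 / 2 := by
      rw [div_le_div_iff₀ (by positivity) (by positivity)]; linarith
    nlinarith
  intro s hs
  by_contra hne
  have : 0 < ∫ s in m..M, ψ s * ψ s := by
    refine intervalIntegral.integral_pos hmM (by fun_prop) (fun x _ => mul_self_nonneg _)
      ⟨s, Ioo_subset_Icc_self hs, mul_self_pos.2 hne⟩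
  exact this.ne' hsq

/-- The rescaled integral `∫ τ⁶ N(w/τ) exp (-τ⁴ U(w/τ)) dw`. -/
def rescaled (a : ℝ) (N : ℝ[X]) (τ : ℂ) : ℂ :=
  ∑ j ∈ Finset.range 7, (N.coeff j : ℂ) * τ ^ (6 - j) * ∫ w : ℝ, (w : ℂ) ^ j * gibbs a τ w

theorem differentiable_rescaled {a : ℝ} (ha : 0 < a) (N : ℝ[X]) :
    Differentiable ℂ (rescaled a N) := by
  unfold rescaled
  refine Differentiable.fun_sum fun j _ => ?_
  exact ((differentiable_const _).mul (differentiable_id.pow _)).mul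
    (differentiable_integral_gibbs ha j)

/-- The exponent in `gibbs` is invariant under (τ, w) ↦ (−τ, −w), and τ^(6−j) w^j has even total
degree 6. The exponent 6 − j needs j ≤ 6. -/
theorem rescaled_neg (a : ℝ) (N : ℝ[X]) (τ : ℂ) : rescaled a N (-τ) = rescaled a N τ := by
  refine Finset.sum_congr rfl fun j hj => ?_
  have hj' : j ≤ 6 := by rw [Finset.mem_range] at hj; omega
  have e : ∫ w : ℝ, (w : ℂ) ^ j * gibbs a (-τ) w =
      (-1) ^ j * ∫ w : ℝ, (w : ℂ) ^ j * gibbs a τ w := by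
    rw [← integral_neg_eq_self, ← integral_const_mul]
    refine integral_congr_ae (Eventually.of_forall fun w => ?_)
    simp only [gibbs]
    push_cast
    rw [neg_pow (w : ℂ) j, mul_assoc]
    congr 3
    ring
  rw [e]
  have h1 : (-τ) ^ (6 - j) * (-1) ^ j = τ ^ (6 - j) := by
    rw [neg_pow, mul_right_comm, ← pow_add, Nat.sub_add_cancel hj']
    norm_num
  linear_combination (N.coeff j : ℂ) * (∫ w : ℝ, (w : ℂ) ^ j * gibbs a τ w) * h1

theorem rescaled_of_pos {a : ℝ} (ha : 0 < a) {N : ℝ[X]} (hN : N.natDegree ≤ 6) {τ : ℝ}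
    (hτ : 0 < τ) :
    rescaled a N τ = (τ ^ 7 * ∫ x : ℝ, N.eval x * Real.exp (-(τ ^ 4 * pot a x)) : ℝ) := by
  have hg : ∀ w : ℝ, gibbs a τ w = (Real.exp (-(τ ^ 4 * pot a (w / τ))) : ℝ) := by
    intro w
    have hp : τ ^ 4 * pot a (w / τ) = τ ^ 2 * w ^ 2 / 2 - 2 / 3 * τ * w ^ 3 + a / 4 * w ^ 4 := by
      simp only [pot]; field_simp
    rw [Complex.ofReal_exp, gibbs, hp]
    congr 1
    push_cast
    ring
  have hI : ∀ j : ℕ, ∫ w : ℝ, (w : ℂ) ^ j * gibbs a τ w =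
      ((τ ^ (j + 1) * ∫ x : ℝ, x ^ j * Real.exp (-(τ ^ 4 * pot a x)) : ℝ) : ℂ) := by
    intro j
    have e1 : ∫ w : ℝ, (w : ℂ) ^ j * gibbs a τ w =
        ∫ w : ℝ, ((w ^ j * Real.exp (-(τ ^ 4 * pot a (w / τ))) : ℝ) : ℂ) := by
      refine integral_congr_ae (Eventually.of_forall fun w => ?_)
      simp only [hg]
      push_cast
      rfl
    rw [e1, integral_complex_ofReal]
    congr 1
    have e2 := Measure.integral_comp_div (fun x : ℝ => x ^ j * Real.exp (-(τ ^ 4 * pot a x))) τ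
    rw [abs_of_pos hτ, smul_eq_mul] at e2
    rw [show τ ^ (j + 1) = τ ^ j * τ from pow_succ τ j, mul_assoc, ← e2, ← integral_const_mul]
    refine integral_congr_ae (Eventually.of_forall fun w => ?_)
    simp only
    rw [← mul_assoc, ← mul_pow, mul_div_cancel₀ _ hτ.ne']
  have e3 : ∫ x : ℝ, N.eval x * Real.exp (-(τ ^ 4 * pot a x)) =
      ∑ j ∈ Finset.range 7, N.coeff j * ∫ x : ℝ, x ^ j * Real.exp (-(τ ^ 4 * pot a x)) := by
    simp_rw [eval_eq_sum_range' (Nat.lt_succ_of_le hN), Finset.sum_mul, mul_assoc]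
    rw [integral_finsetSum _ fun j _ =>
      (integrable_pow_mul_exp_pot ha (pow_pos hτ 4) j).const_mul _]
    simp_rw [integral_const_mul]
  rw [e3, rescaled, Finset.mul_sum]
  push_cast
  refine Finset.sum_congr rfl fun j hj => ?_
  rw [hI]
  push_cast
  have hj' : 7 = (6 - j) + (j + 1) := by rw [Finset.mem_range] at hj; omega
  have : (τ : ℂ) ^ 7 = τ ^ (6 - j) * τ ^ (j + 1) := by rw [← pow_add, ← hj']
  rw [this]
  ring

theorem differentiable_laplace {m M : ℝ} {ψ : ℝ → ℝ} (hψ : Continuous ψ) :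
    Differentiable ℂ fun z : ℂ => ∫ s in m..M, (ψ s : ℂ) * Complex.exp (-(z * s)) := by
  intro z₀
  obtain ⟨B, hB⟩ := (isCompact_uIcc (a := m) (b := M)).image
    (f := fun s => |ψ s| * (|s| * Real.exp ((‖z₀‖ + 1) * |s|))) (by fun_prop) |>.bddAbove
  refine (intervalIntegral.hasDerivAt_integral_of_dominated_loc_of_deriv_le
    (F' := fun z s => (ψ s : ℂ) * (Complex.exp (-(z * s)) * (-s)))
    (bound := fun s => |ψ s| * (|s| * Real.exp ((‖z₀‖ + 1) * |s|)))
    (Metric.ball_mem_nhds z₀ one_pos) (Eventually.of_forall fun z =>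
      Continuous.aestronglyMeasurable (by fun_prop))
    (Continuous.intervalIntegrable (by fun_prop) _ _)
    (Continuous.aestronglyMeasurable (by fun_prop)) ?_
    (Continuous.intervalIntegrable (by fun_prop) _ _) ?_).2.differentiableAt
  · refine Eventually.of_forall fun s _ z hz => ?_
    rw [norm_mul, norm_mul, norm_neg, Complex.norm_real, Complex.norm_real, Real.norm_eq_abs,
      Real.norm_eq_abs, Complex.norm_exp, mul_comm (Real.exp _)]
    gcongr
    refine (Complex.re_le_norm _).trans ?_
    rw [norm_neg, norm_mul, Complex.norm_real, Real.norm_eq_abs]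
    gcongr
    have : ‖z‖ ≤ ‖z₀‖ + ‖z - z₀‖ := by
      have := norm_add_le z₀ (z - z₀); simpa using this
    rw [Metric.mem_ball, dist_eq_norm] at hz
    linarith
  · refine Eventually.of_forall fun s _ z _ => ?_
    have h1 : HasDerivAt (fun z : ℂ => -(z * s)) (-s) z := by
      simpa using ((hasDerivAt_id z).mul_const (s : ℂ)).fun_neg
    exact h1.cexp.const_mul _

theorem eq_zero_of_even_odd {F : ℂ → ℂ} (hF : Differentiable ℂ F) {G : ℂ → ℂ}
    (hG : Differentiable ℂ G) (hFe : ∀ z, F (-z) = F z) (hGo : ∀ z, G (-z) = -G z)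
    (h : ∀ τ : ℝ, 0 < τ → F τ = G τ) : ∀ z, G z = 0 := by
  have hFG : F = G := by
    refine AnalyticOnNhd.eq_of_frequently_eq (z₀ := 1)
      (fun z _ => hF.analyticAt z) (fun z _ => hG.analyticAt z) ?_
    have hf : ∃ᶠ τ : ℝ in 𝓝[≠] 1, 0 < τ :=
      (eventually_nhdsWithin_of_eventually_nhds (lt_mem_nhds one_pos)).frequently
    have ht : Tendsto (fun τ : ℝ => (τ : ℂ)) (𝓝[≠] 1) (𝓝[≠] 1) := by
      refine tendsto_nhdsWithin_iff.2 ⟨?_, ?_⟩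
      · have := Complex.continuous_ofReal.tendsto (1 : ℝ)
        rw [Complex.ofReal_one] at this
        exact this.mono_left nhdsWithin_le_nhds
      · filter_upwards [self_mem_nhdsWithin] with τ hτ
        simpa using hτ
    exact ht.frequently (hf.mono fun τ hτ => h τ hτ)
  intro z
  have h1 := hFe z
  rw [hFG, hGo] at h1
  have h2 : (2 : ℂ) * G z = 0 := by linear_combination -h1
  simpa using h2

/-- An integral whose Abel transform vanishes on all ovals outside of a given one. -/
theorem exists_eq_smul_of_exterior {a : ℝ} (ha : 0 < a) (ha8 : a ≠ 8 / 9) {N : ℝ[X]}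
    (hN : N.natDegree ≤ 6) {l₀ r₀ : ℝ} (hlr₀ : l₀ < r₀)
    (hpos : ∀ x, r₀ ≤ x → 0 < frc a x) (hneg : ∀ x, x ≤ l₀ → frc a x < 0)
    (h : ∀ k, pot a r₀ < k → ∃ l r, l < l₀ ∧ r₀ < r ∧ IsOval a k l r ∧
        ∫ x in l..r, N.eval x * √(2 * (k - pot a x)) = 0) :
    ∃ b, N = C b * frcPoly a := by
  have hout : ∀ {k l r}, l < l₀ → r₀ < r → IsOval a k l r → ∀ x, x ∉ Ioc l r → k ≤ pot a x := by
    intro k l r hl hr o x hx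
    rw [mem_Ioc, not_and_or, not_lt, not_le] at hx
    rcases hx with hx | hx
    · rcases eq_or_lt_of_le hx with rfl | hx
      · exact o.left.ge
      · rw [← o.left]
        exact (pot_lt_of_frc_neg (u := x) (v := l) (fun y hy => hneg y (by linarith [hy.2])) le_rfl
          hx le_rfl).le
    · rw [← o.right]
      exact (pot_lt_of_frc_pos (u := r) (v := x) (fun y hy => hpos y (by linarith [hy.1])) le_rfl
        hx le_rfl).le
  -- Integrating over the whole line still gives an Abel integral at every level: it vanishes below
  -- min U, equals the oval integral on exterior levels, and so vanishes there too. Only the bounded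
  -- range of inner levels is left open.
  set Ψ : ℝ → ℝ := fun h => ∫ x : ℝ, N.eval x * √(2 * (h - pot a x)) with hΨ
  have hΨI : ∀ {k l r}, l < l₀ → r₀ < r → IsOval a k l r → ∀ h ≤ k,
      Ψ h = ∫ x in l..r, N.eval x * √(2 * (h - pot a x)) := by
    intro k l r hl hr o h hh
    rw [intervalIntegral.integral_of_le o.lt.le, hΨ]
    refine (setIntegral_eq_integral_of_forall_compl_eq_zero fun x hx => ?_).symm
    rw [Real.sqrt_eq_zero_of_nonpos (by linarith [hout hl hr o x hx]), mul_zero]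
  have hΨ0 : ∀ k, pot a r₀ < k → Ψ k = 0 := by
    intro k hk
    obtain ⟨l, r, hl, hr, o, hI⟩ := h k hk
    rw [hΨI hl hr o k le_rfl, hI]
  obtain ⟨l₁, r₁, hl₁, hr₁, o₁, -⟩ := h (pot a r₀ + 1) (by linarith)
  obtain ⟨z, hz, hzmin⟩ := (isCompact_Icc (a := l₁) (b := r₁)).exists_isMinOn
    (nonempty_Icc.2 o₁.lt.le) (continuous_pot a).continuousOn
  -- The shift by 1 ensures a strict inequality m < U(r₀).
  set m := pot a z - 1 with hm
  have hmr : m < pot a r₀ := by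
    have : pot a z ≤ pot a r₀ := hzmin ⟨by linarith, hr₁.le⟩
    linarith
  have hmle : ∀ x, m ≤ pot a x := by
    intro x
    by_cases hx : x ∈ Ioc l₁ r₁
    · have : pot a z ≤ pot a x := hzmin (Ioc_subset_Icc_self hx)
      linarith
    · linarith [hout hl₁ hr₁ o₁ x hx]
  have hΨm : ∀ k ≤ m, Ψ k = 0 := by
    intro k hk
    simp only [hΨ]
    rw [integral_congr_ae (g := fun _ => (0 : ℝ)) (Eventually.of_forall fun x => ?_)]
    · simp
    · simp only
      rw [Real.sqrt_eq_zero_of_nonpos (by linarith [hmle x]), mul_zero]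
  -- This agrees with Ψ on the levels up to U(r₀) + 1 but is taken over a fixed bounded interval, so
  -- that its continuity is immediate.
  set ψ : ℝ → ℝ := fun h => ∫ x in l₁..r₁, N.eval x * √(2 * (h - pot a x)) with hψ
  have hψc : Continuous ψ :=
    intervalIntegral.continuous_parametric_intervalIntegral_of_continuous' (by fun_prop) _ _
  set κ := √2 * Real.Gamma (3 / 2) with hκ
  have hκ0 : 0 < κ := by
    have := Real.Gamma_pos_of_pos (show (0 : ℝ) < 3 / 2 by norm_num)
    positivity
  have hL : ∀ t, 0 < t → ∫ s in m..pot a r₀, ψ s * Real.exp (-(t * s)) =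
      κ * (1 / t) ^ (3 / 2 : ℝ) * ∫ x : ℝ, N.eval x * Real.exp (-(t * pot a x)) := by
    intro t ht
    rw [hκ, ← integral_laplace_eq ha ht N, intervalIntegral.integral_of_le hmr.le,
      ← setIntegral_eq_integral_of_forall_compl_eq_zero (s := Ioc m (pot a r₀))
        (f := fun h => (∫ x, N.eval x * √(2 * (h - pot a x))) * Real.exp (-(t * h)))
        fun s hs => ?_]
    · refine setIntegral_congr_fun measurableSet_Ioc fun s hs => ?_
      rw [← show Ψ s = ψ s from hΨI hl₁ hr₁ o₁ s (by linarith [hs.2])]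
    · rw [mem_Ioc, not_and_or, not_lt, not_le] at hs
      rcases hs with hs | hs
      · rw [show (∫ x : ℝ, N.eval x * √(2 * (s - pot a x))) = 0 from hΨm s hs, zero_mul]
      · rw [show (∫ x : ℝ, N.eval x * √(2 * (s - pot a x))) = 0 from hΨ0 s hs, zero_mul]
  set E : ℂ → ℂ := fun z => ∫ s in m..pot a r₀, (ψ s : ℂ) * Complex.exp (-(z * s)) with hE
  have hEd : Differentiable ℂ E := differentiable_laplace hψc
  have hEreal : ∀ t : ℝ, E t = ((∫ s in m..pot a r₀, ψ s * Real.exp (-(t * s)) : ℝ) : ℂ) := by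
    intro t
    rw [← intervalIntegral.integral_ofReal]
    refine intervalIntegral.integral_congr fun s _ => ?_
    push_cast
    rfl
  -- With t = τ⁴ the Laplace identity reads E(τ⁴) = κ τ⁻⁶ ∫ N exp(−τ⁴U). Multiplying by τ¹³ gives κ
  -- · `rescaled`, which is even and entire, while τ¹³ E(τ⁴) is odd and entire because E is the
  -- transform of a function on a bounded interval.
  have hG0 : ∀ z : ℂ, z ^ 13 * E (z ^ 4) = 0 := by
    refine eq_zero_of_even_odd (F := fun z => (κ : ℂ) * rescaled a N z)
      ((differentiable_rescaled ha N).const_mul _)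
      ((differentiable_id.pow 13).mul (hEd.comp (differentiable_id.pow 4)))
      (fun z => by rw [rescaled_neg]) (fun z => ?_) (fun τ hτ => ?_)
    · rw [show (-z) ^ 4 = z ^ 4 by ring]
      ring
    · rw [rescaled_of_pos ha hN hτ, show (τ : ℂ) ^ 4 = ((τ ^ 4 : ℝ) : ℂ) by push_cast; rfl, hEreal,
        hL _ (pow_pos hτ 4)]
      have e : (1 / τ ^ 4 : ℝ) ^ (3 / 2 : ℝ) = 1 / τ ^ 6 := by
        rw [Real.div_rpow zero_le_one (by positivity), Real.one_rpow, ← Real.rpow_natCast τ 4,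
          ← Real.rpow_mul hτ.le, ← Real.rpow_natCast τ 6]
        norm_num
      rw [e, ← Complex.ofReal_pow, ← Complex.ofReal_mul, ← Complex.ofReal_mul]
      congr 1
      field_simp
  have hE0 : ∀ t : ℝ, 0 < t → ∫ s in m..pot a r₀, ψ s * Real.exp (-(t * s)) = 0 := by
    intro t ht
    set τ := t ^ (1 / 4 : ℝ) with hτ
    have hτ0 : 0 < τ := Real.rpow_pos_of_pos ht _
    have hτ4 : τ ^ 4 = t := by
      rw [hτ, ← Real.rpow_natCast, ← Real.rpow_mul ht.le]; norm_num
    have := hG0 (τ : ℂ)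
    rw [← Complex.ofReal_pow, ← Complex.ofReal_pow, hτ4, hEreal, ← Complex.ofReal_mul,
      Complex.ofReal_eq_zero] at this
    exact (mul_eq_zero.1 this).resolve_left (pow_pos hτ0 13).ne'
  have hψ0 := eq_zero_of_integral_exp hmr hψc hE0
  have hall : ∀ k, Ψ k = 0 := by
    have hcl : EqOn ψ (fun _ => 0) (Icc m (pot a r₀)) := by
      rw [← closure_Ioo hmr.ne]
      exact EqOn.closure (fun s hs => hψ0 s hs) hψc continuous_const
    intro k
    rcases le_or_gt k m with h1 | h1
    · exact hΨm k h1
    rcases lt_or_ge (pot a r₀) k with h2 | h2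
    · exact hΨ0 k h2
    · rw [hΨI hl₁ hr₁ o₁ k (by linarith)]
      exact hcl ⟨h1.le, h2⟩
  obtain ⟨M, hM, hMd⟩ := exists_antiderivative N
  obtain ⟨W, hW, hWd⟩ := exists_antiderivative (M * frcPoly a)
  refine exists_eq_smul_frcPoly ha.ne' ha8 hN hM hMd hW hWd
    ((Ioi_infinite (pot a r₀)).mono fun k hk => ?_)
  obtain ⟨l, r, hl, hr, o, -⟩ := h k hk
  exact ⟨l, r, o.lt, o.left, o.right, eval_eq_of_integral_eq_zero hM hW o.left o.right
    (integral_mul_sub_eq_zero N.continuous o.lt.le (fun x hx => o.le hx) fun h' hh' => by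
      rw [← hΨI hl hr o h' hh', hall])⟩

/-- An elliptic integral `∮ N(x) y dx`, `deg N ≤ 6`, which vanishes on a period annulus is trivial:
`N` is a multiple of `U'`. -/
theorem exists_eq_smul_of_annulus {a : ℝ} (ha : a ≠ 0) (ha8 : a ≠ 8 / 9) {𝒜 : Set (ℝ × ℝ)}
    (h𝒜 : IsPeriodAnnulus a 𝒜) {σ : ℝ → ℝ × ℝ} (hσ : IsCrossSection a 𝒜 σ) {N : ℝ[X]}
    (hN : N.natDegree ≤ 6)
    (h0 : ∀ h ∈ H a '' 𝒜, ∀ γ T, IsClosedOrbit a (σ h) γ T →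
      ∫ t in (0 : ℝ)..T, N.eval (γ t).1 * (γ t).2 ^ 2 = 0) : ∃ b, N = C b * frcPoly a := by
  rcases vanishing_ovals ha h𝒜 hσ N.continuous h0 with
    ⟨l₀, c, r₀, -, hc, hneg, hpos, h⟩ | ⟨ha0, l₀, r₀, hlr, hpos, hneg, -, h⟩
  · exact exists_eq_smul_of_center ha ha8 hN hc hneg hpos h
  · exact exists_eq_smul_of_exterior ha0 ha8 hN hlr hpos hneg h

/-! ### Perturbed orbits and the drift of H along them. -/

/-- Solutions of a perturbed `C¹` system stay close to a given solution of the unperturbed one. -/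
theorem exists_perturbed_solution {E : Type*} [NormedAddCommGroup E] [NormedSpace ℝ E]
    [FiniteDimensional ℝ E] {v w : E → E} (hv : ContDiff ℝ 1 v) (hw : ContDiff ℝ 1 w)
    {γ₀ : ℝ → E} (hγ₀ : ∀ t, HasDerivAt γ₀ (v (γ₀ t)) t) (T : ℝ) :
    ∃ C, 0 ≤ C ∧ ∀ᶠ ε in 𝓝 (0 : ℝ), ∃ γ : ℝ → E, γ 0 = γ₀ 0 ∧ ∀ t ∈ Icc 0 T,
      HasDerivAt γ (v (γ t) + ε • w (γ t)) t ∧ dist (γ t) (γ₀ t) ≤ C * |ε| := by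
  have hγ₀c : Continuous γ₀ := continuous_iff_continuousAt.2 fun t => (hγ₀ t).continuousAt
  obtain ⟨R, hR⟩ := (isCompact_Icc (a := (0 : ℝ)) (b := T)).exists_bound_of_continuousOn
    hγ₀c.continuousOn
  -- The cut-off equals 1 on a ball exceeding the unperturbed arc by 1 in radius. It makes the
  -- fields bounded and globally Lipschitz, and Grönwall's bound shows that the perturbed arc never
  -- leaves that ball for small ε.
  let χ : ContDiffBump (0 : E) := ⟨|R| + 1, |R| + 2, by positivity, by linarith⟩
  have hcut : ∀ {u : E → E}, ContDiff ℝ 1 u → ∃ K M : NNReal,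
      LipschitzWith K (fun x => χ x • u x) ∧ ∀ x, ‖χ x • u x‖ ≤ M := by
    intro u hu
    have hs : HasCompactSupport fun x => χ x • u x := χ.hasCompactSupport.smul_right
    have hd : ContDiff ℝ 1 fun x => χ x • u x := χ.contDiff.smul hu
    obtain ⟨K, hK⟩ := hd.lipschitzWith_of_hasCompactSupport hs one_ne_zero
    obtain ⟨M, hM⟩ := hs.exists_bound_of_continuous hd.continuous
    exact ⟨K, M.toNNReal, hK, fun x => (hM x).trans (Real.le_coe_toNNReal M)⟩
  obtain ⟨K, M, hK, hM⟩ := hcut hv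
  obtain ⟨K', M', hK', hM'⟩ := hcut hw
  have hin : ∀ x, ‖x‖ ≤ |R| + 1 → χ x = 1 := fun x hx =>
    χ.one_of_mem_closedBall (by simpa [χ] using hx)
  -- Enlarged so that the Lipschitz constant is nonzero in the closed form of Grönwall's bound.
  set K₁ : NNReal := K + 1 with hK₁
  have hK₁0 : (K₁ : ℝ) ≠ 0 := by
    have := K.coe_nonneg
    rw [hK₁]; push_cast; positivity
  have hK1 : LipschitzWith K₁ fun x => χ x • v x := hK.weaken (by simp [hK₁])
  set C : ℝ := M' * (Real.exp (K₁ * T) / K₁) with hC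
  have hC0 : 0 ≤ C := by positivity
  refine ⟨C, hC0, ?_⟩
  have hev : ∀ᶠ ε in 𝓝 (0 : ℝ), C * |ε| < 1 := by
    have : Tendsto (fun ε : ℝ => C * |ε|) (𝓝 0) (𝓝 (C * |0|)) :=
      (continuous_const.mul continuous_abs).tendsto 0
    rw [abs_zero, mul_zero] at this
    exact this.eventually (gt_mem_nhds one_pos)
  filter_upwards [hev] with ε hε
  have hL : LipschitzWith (K + ‖ε‖₊ * K') fun x => χ x • v x + ε • (χ x • w x) :=
    hK.add ((lipschitzWith_smul ε).comp hK')
  obtain ⟨γ, hγ0, hγ⟩ := exists_global_solution hL (L := M + ‖ε‖₊ * M') (fun x => by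
    refine (norm_add_le _ _).trans ?_
    rw [norm_smul ε]
    push_cast
    exact add_le_add (hM x) (mul_le_mul_of_nonneg_left (hM' x) (norm_nonneg _))) (γ₀ 0)
  have hγc : Continuous γ := continuous_iff_continuousAt.2 fun t => (hγ t).continuousAt
  have hdist : ∀ t ∈ Icc 0 T, dist (γ t) (γ₀ t) ≤ C * |ε| := by
    intro t ht
    have := dist_le_of_approx_trajectories_ODE (v := fun _ x => χ x • v x) (K := K₁)
      (f := γ) (g := γ₀) (a := 0) (b := T) (δ := 0) (εf := |ε| * M') (εg := 0)
      (fun _ => hK1) hγc.continuousOn (fun s _ => (hγ s).hasDerivWithinAt)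
      (fun s _ => by
        rw [dist_eq_norm, add_sub_cancel_left, norm_smul, Real.norm_eq_abs]
        exact mul_le_mul_of_nonneg_left (hM' _) (abs_nonneg _))
      hγ₀c.continuousOn (fun s _ => (hγ₀ s).hasDerivWithinAt)
      (fun s hs => by
        have hs' := hR s (Ico_subset_Icc_self hs)
        rw [hin _ (by linarith [le_abs_self R]), one_smul, dist_self])
      (by rw [hγ0, dist_self]) t ht
    refine this.trans ?_
    rw [gronwallBound_of_K_ne_0 hK₁0]
    simp only [zero_mul, zero_add, add_zero, sub_zero]
    have h1 : Real.exp (K₁ * t) - 1 ≤ Real.exp (K₁ * T) := by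
      have : Real.exp (K₁ * t) ≤ Real.exp (K₁ * T) :=
        Real.exp_le_exp.2 (mul_le_mul_of_nonneg_left ht.2 K₁.coe_nonneg)
      linarith
    calc |ε| * M' / K₁ * (Real.exp (K₁ * t) - 1) ≤ |ε| * M' / K₁ * Real.exp (K₁ * T) := by
          gcongr
      _ = C * |ε| := by rw [hC]; ring
  refine ⟨γ, hγ0, fun t ht => ⟨?_, hdist t ht⟩⟩
  have h1 : ‖γ t‖ ≤ |R| + 1 := by
    have e1 := hdist t ht
    have e2 := hR t ht
    have e3 : ‖γ t‖ ≤ ‖γ₀ t‖ + ‖γ t - γ₀ t‖ := by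
      simpa using norm_add_le (γ₀ t) (γ t - γ₀ t)
    rw [← dist_eq_norm] at e3
    linarith [le_abs_self R]
  have := hγ t
  rwa [hin _ h1, one_smul, one_smul] at this

theorem cubic_eq (c : ℕ × ℕ → ℝ) (x y : ℝ) : cubic c (x, y) =
    c (0, 0) + (c (0, 1) * y + c (1, 0) * x) + (c (0, 2) * y ^ 2 + c (1, 1) * x * y +
      c (2, 0) * x ^ 2) + (c (0, 3) * y ^ 3 + c (1, 2) * x * y ^ 2 + c (2, 1) * x ^ 2 * y +
      c (3, 0) * x ^ 3) := by
  simp [cubic, Finset.sum_range_succ, Finset.Nat.antidiagonal_succ]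
  ring

theorem contDiff_cubic (c : ℕ × ℕ → ℝ) : ContDiff ℝ 1 (cubic c) := by
  have : cubic c = fun p => c (0, 0) + (c (0, 1) * p.2 + c (1, 0) * p.1) + (c (0, 2) * p.2 ^ 2 +
      c (1, 1) * p.1 * p.2 + c (2, 0) * p.1 ^ 2) + (c (0, 3) * p.2 ^ 3 + c (1, 2) * p.1 * p.2 ^ 2 +
      c (2, 1) * p.1 ^ 2 * p.2 + c (3, 0) * p.1 ^ 3) := by
    ext p; exact cubic_eq c p.1 p.2
  rw [this]
  fun_prop

theorem contDiff_perturbation (A B : ℕ × ℕ → ℝ) :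
    ContDiff ℝ 1 fun p => (cubic A p, cubic B p) :=
  (contDiff_cubic A).prodMk (contDiff_cubic B)

theorem contDiff_field (a : ℝ) (A B : ℕ × ℕ → ℝ) (ε : ℝ) : ContDiff ℝ 1 (field a A B ε) :=
  (contDiff_field₀ a).add ((contDiff_perturbation A B).const_smul ε)

@[fun_prop]
theorem continuous_cubic (c : ℕ × ℕ → ℝ) : Continuous (cubic c) := (contDiff_cubic c).continuous

/-- The rate of change of `H` along the perturbation. -/
def drift (a : ℝ) (A B : ℕ × ℕ → ℝ) (p : ℝ × ℝ) : ℝ := cubic A p * frc a p.1 + cubic B p * p.2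

@[fun_prop]
theorem continuous_drift (a : ℝ) (A B : ℕ × ℕ → ℝ) : Continuous (drift a A B) := by
  unfold drift; fun_prop

/-- The differential of `H`. -/
def dH (a : ℝ) (p : ℝ × ℝ) : ℝ × ℝ →L[ℝ] ℝ :=
  frc a p.1 • ContinuousLinearMap.fst ℝ ℝ ℝ + p.2 • ContinuousLinearMap.snd ℝ ℝ ℝ

theorem dH_apply (a : ℝ) (p v : ℝ × ℝ) : dH a p v = frc a p.1 * v.1 + p.2 * v.2 := rfl

theorem hasFDerivAt_H (a : ℝ) (p : ℝ × ℝ) : HasFDerivAt (H a) (dH a p) p := by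
  have h1 := ((hasFDerivAt_snd (𝕜 := ℝ) (p := p)).pow 2).mul_const (1 / 2)
  have h2 := (hasDerivAt_pot a p.1).comp_hasFDerivAt p (hasFDerivAt_fst (𝕜 := ℝ) (p := p))
  have h3 := h1.add h2
  have e : H a = fun q => q.2 ^ 2 * (1 / 2) + pot a q.1 := by
    ext q; rw [H_eq]; ring
  rw [e]
  refine h3.congr_fderiv ?_
  ext <;> simp [dH_apply]

theorem continuous_H (a : ℝ) : Continuous (H a) := by unfold H; fun_prop

theorem dH_field (a : ℝ) (A B : ℕ × ℕ → ℝ) (ε : ℝ) (p : ℝ × ℝ) :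
    dH a p (field a A B ε p) = ε * drift a A B p := by
  simp only [dH_apply, field, drift, field₀_eq, Prod.fst_add, Prod.snd_add, Prod.smul_fst,
    Prod.smul_snd, smul_eq_mul]
  ring

theorem firstReturn_unique {a : ℝ} {A B : ℕ × ℕ → ℝ} {S : Set ℝ} {σ : ℝ → ℝ × ℝ}
    (hσ : ∀ h ∈ S, H a (σ h) = h) {ε h h₁ h₂ : ℝ} (h1 : FirstReturn a A B S σ ε h h₁)
    (h2 : FirstReturn a A B S σ ε h h₂) : h₁ = h₂ := by
  obtain ⟨γ₁, T₁, hT₁, hs₁, h01, hS₁, he₁, hn₁⟩ := h1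
  obtain ⟨γ₂, T₂, hT₂, hs₂, h02, hS₂, he₂, hn₂⟩ := h2
  wlog hle : T₁ ≤ T₂ generalizing γ₁ γ₂ T₁ T₂ h₁ h₂
  · exact (this γ₂ T₂ hT₂ hs₂ h02 hS₂ he₂ hn₂ γ₁ T₁ hT₁ hs₁ h01 hS₁ he₁ hn₁ (le_of_not_ge hle)).symm
  have heq := eqOn_Icc_of_solutions (contDiff_field a A B ε) hs₁
    (fun t ht => (hs₂ t ⟨ht.1, ht.2.trans hle⟩).mono (Icc_subset_Icc_right hle)) (h01.trans h02.symm)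
  have e1 : σ h₁ = γ₂ T₁ := by rw [← he₁]; exact heq ⟨hT₁.le, le_rfl⟩
  rcases eq_or_lt_of_le hle with rfl | hlt
  · rw [← hσ h₁ hS₁, ← hσ h₂ hS₂, e1, he₂]
  · exact absurd ⟨h₁, hS₁, e1⟩ (hn₂ T₁ ⟨hT₁, hlt⟩)

theorem eventually_mul_abs_lt (C : ℝ) {δ : ℝ} (hδ : 0 < δ) : ∀ᶠ ε in 𝓝 (0 : ℝ), C * |ε| < δ := by
  have : Tendsto (fun ε : ℝ => C * |ε|) (𝓝 0) (𝓝 (C * |0|)) :=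
    (continuous_const.mul continuous_abs).tendsto 0
  rw [abs_zero, mul_zero] at this
  exact this.eventually (gt_mem_nhds hδ)

theorem exists_perturbed_orbit {a : ℝ} {γ₀ : ℝ → ℝ × ℝ} (hγ₀ : IsSol a γ₀) (A B : ℕ × ℕ → ℝ)
    {T : ℝ} (hT : 0 ≤ T) : ∃ C, 0 ≤ C ∧ ∀ᶠ ε in 𝓝 (0 : ℝ), ∃ γ : ℝ → ℝ × ℝ, γ 0 = γ₀ 0 ∧
      ∀ t ∈ Icc 0 T, HasDerivAt γ (field a A B ε (γ t)) t ∧ dist (γ t) (γ₀ t) ≤ C * |ε| ∧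
        |H a (γ t) - H a (γ₀ 0)| ≤ C * |ε| := by
  obtain ⟨C, hC, hev⟩ := exists_perturbed_solution (contDiff_field₀ a) (contDiff_perturbation A B)
    hγ₀ T
  obtain ⟨R, hR⟩ := (isCompact_Icc (a := (0 : ℝ)) (b := T)).exists_bound_of_continuousOn
    hγ₀.continuous.continuousOn
  obtain ⟨M, hM⟩ := (isCompact_closedBall (0 : ℝ × ℝ) (R + 1)).exists_bound_of_continuousOn
    (continuous_drift a A B).continuousOn
  refine ⟨max C (|M| * T), le_max_of_le_left hC, ?_⟩
  filter_upwards [hev, eventually_mul_abs_lt C one_pos] with ε ⟨γ, h0, hγ⟩ hε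
  refine ⟨γ, h0, fun t ht => ⟨(hγ t ht).1, (hγ t ht).2.trans (by gcongr; exact le_max_left _ _), ?_⟩⟩
  have hd : ∀ s ∈ Icc 0 T, HasDerivWithinAt (fun s => H a (γ s)) (ε * drift a A B (γ s))
      (Icc 0 T) s := fun s hs => by
    rw [← dH_field]
    exact ((hasFDerivAt_H a (γ s)).comp_hasDerivAt s (hγ s hs).1).hasDerivWithinAt
  have := (convex_Icc (0 : ℝ) T).norm_image_sub_le_of_norm_hasDerivWithin_le (C := |ε| * |M|) hd
    (fun s hs => by
      rw [norm_mul, Real.norm_eq_abs]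
      refine mul_le_mul_of_nonneg_left ((hM _ ?_).trans (le_abs_self M)) (abs_nonneg _)
      rw [mem_closedBall_zero_iff]
      have e1 := (hγ s hs).2
      have e2 := hR s hs
      have e3 : ‖γ s‖ ≤ ‖γ₀ s‖ + ‖γ s - γ₀ s‖ := by
        simpa using norm_add_le (γ₀ s) (γ s - γ₀ s)
      rw [← dist_eq_norm] at e3
      linarith) (left_mem_Icc.2 hT) ht
  rw [← h0]
  refine this.trans ?_
  rw [sub_zero, Real.norm_eq_abs, abs_of_nonneg ht.1]
  calc |ε| * |M| * t ≤ |ε| * |M| * T := by gcongr; exact ht.2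
    _ = |M| * T * |ε| := by ring
    _ ≤ _ := by gcongr; exact le_max_right _ _

/-! ### The first return map. -/

section CrossSection
variable {a : ℝ} {𝒜 : Set (ℝ × ℝ)} {σ : ℝ → ℝ × ℝ} {h : ℝ}

theorem IsCrossSection.hasDerivAt (hσ : IsCrossSection a 𝒜 σ) (h𝒜 : IsPeriodAnnulus a 𝒜)
    (hh : h ∈ H a '' 𝒜) : HasDerivAt σ (deriv σ h) h :=
  ((hσ.smooth.differentiableOn one_ne_zero).differentiableAt
    (h𝒜.isOpen_image.mem_nhds hh)).hasDerivAt

theorem IsCrossSection.continuousAt_deriv (hσ : IsCrossSection a 𝒜 σ) (h𝒜 : IsPeriodAnnulus a 𝒜)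
    (hh : h ∈ H a '' 𝒜) : ContinuousAt (deriv σ) h :=
  (hσ.smooth.continuousOn_deriv_of_isOpen h𝒜.isOpen_image le_rfl).continuousAt
    (h𝒜.isOpen_image.mem_nhds hh)

theorem IsCrossSection.dH_deriv (hσ : IsCrossSection a 𝒜 σ) (h𝒜 : IsPeriodAnnulus a 𝒜)
    (hh : h ∈ H a '' 𝒜) : dH a (σ h) (deriv σ h) = 1 := by
  have h1 := (hasFDerivAt_H a (σ h)).comp_hasDerivAt h (hσ.hasDerivAt h𝒜 hh)
  have h2 : H a ∘ σ =ᶠ[𝓝 h] id := by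
    filter_upwards [h𝒜.isOpen_image.mem_nhds hh] with s hs using hσ.level s hs
  exact (h1.congr_of_eventuallyEq h2.symm).unique (hasDerivAt_id h)

/-- In the plane, a vector parallel to one transversal to the level line cannot be tangent to that
line unless it is zero. -/
theorem eq_zero_of_dH_eq_zero {q v τ : ℝ × ℝ} (h1 : dH a q v = 0) (h2 : v.1 * τ.2 = v.2 * τ.1)
    (h3 : 0 < dH a q τ) : v = 0 := by
  rw [dH_apply] at h1 h3
  have e1 : v.1 * (frc a q.1 * τ.1 + q.2 * τ.2) = 0 := by
    linear_combination τ.1 * h1 + q.2 * h2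
  have e2 : v.2 * (frc a q.1 * τ.1 + q.2 * τ.2) = 0 := by
    linear_combination τ.2 * h1 - frc a q.1 * h2
  ext
  · exact (mul_eq_zero.1 e1).resolve_right h3.ne'
  · exact (mul_eq_zero.1 e2).resolve_right h3.ne'

/-- A function which cuts out the cross-section near one of its points and increases along the
orbits of the perturbed system. -/
theorem IsCrossSection.exists_chart (hσ : IsCrossSection a 𝒜 σ) (h𝒜 : IsPeriodAnnulus a 𝒜)
    (hh : h ∈ H a '' 𝒜) (A B : ℕ × ℕ → ℝ) : ∃ (G : ℝ × ℝ → ℝ) (ρ : ℝ), 0 < ρ ∧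
      (∀ z ∈ Metric.ball (σ h) ρ, H a z ∈ H a '' 𝒜 ∧ ContinuousAt G z ∧
        (G z = 0 ↔ z = σ (H a z))) ∧
      ∀ ε, |ε| < ρ → ∀ (γ : ℝ → ℝ × ℝ) (t : ℝ), γ t ∈ Metric.ball (σ h) ρ →
        HasDerivAt γ (field a A B ε (γ t)) t → ∃ c, 0 < c ∧ HasDerivAt (fun s => G (γ s)) c t := by
  set p := σ h with hp
  set τ := deriv σ h with hτ
  have hHp : H a p = h := hσ.level h hh
  set ℓ : ℝ × ℝ →L[ℝ] ℝ :=
    τ.2 • ContinuousLinearMap.fst ℝ ℝ ℝ - τ.1 • ContinuousLinearMap.snd ℝ ℝ ℝ with hℓ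
  have hℓa : ∀ v, ℓ v = τ.2 * v.1 - τ.1 * v.2 := fun v => rfl
  have hdτ : dH a p τ = 1 := hσ.dH_deriv h𝒜 hh
  -- W is the derivative of z ↦ ℓ(z − σ(H z)) along the perturbed field, where ℓ is chosen to
  -- annihilate σ'(h). At σ h and ε = 0 it equals dH(σ'(h)) = 1, so it is positive nearby.
  set W : (ℝ × ℝ) × ℝ → ℝ := fun z =>
    ℓ (field a A B z.2 z.1) - z.2 * drift a A B z.1 * ℓ (deriv σ (H a z.1)) with hW
  have hW0 : W (p, 0) = 1 := by
    simp only [hW, zero_mul, sub_zero, hℓa, field, zero_smul, add_zero, field₀_eq]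
    rw [dH_apply] at hdτ
    linarith
  have hWc : ContinuousAt W (p, 0) := by
    have h1 : ContinuousAt (fun z : (ℝ × ℝ) × ℝ => deriv σ (H a z.1)) (p, 0) := by
      refine ContinuousAt.comp (f := fun z : (ℝ × ℝ) × ℝ => H a z.1) (g := deriv σ) ?_
        ((continuous_H a).comp continuous_fst).continuousAt
      simp only [hHp]
      exact hσ.continuousAt_deriv h𝒜 hh
    have h2 : Continuous fun z : (ℝ × ℝ) × ℝ => field a A B z.2 z.1 := by
      unfold field
      have := (contDiff_field₀ a).continuous
      fun_prop
    have h3 : Continuous fun z : (ℝ × ℝ) × ℝ => z.2 * drift a A B z.1 := by fun_prop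
    exact (ℓ.continuous.comp h2).continuousAt.sub
      (h3.continuousAt.mul (ℓ.continuous.continuousAt.comp h1))
  have hσH : ContinuousAt (fun z => σ (H a z)) p := by
    refine ContinuousAt.comp (g := σ) ?_ (continuous_H a).continuousAt
    rw [hHp]
    exact (hσ.hasDerivAt h𝒜 hh).continuousAt
  have e1 : ∀ᶠ z in 𝓝 p, H a z ∈ H a '' 𝒜 :=
    (continuous_H a).continuousAt.eventually (h𝒜.isOpen_image.mem_nhds (by rwa [hHp]))
  have e2 : ∀ᶠ z in 𝓝 p, 0 < dH a z τ := by
    have : Continuous fun z : ℝ × ℝ => dH a z τ := by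
      simp only [dH_apply]; fun_prop
    exact this.continuousAt.eventually (lt_mem_nhds (show 0 < dH a p τ by rw [hdτ]; exact one_pos))
  obtain ⟨ρ₁, hρ₁, hb₁⟩ := Metric.eventually_nhds_iff_ball.1 e2
  have e3 : ∀ᶠ z in 𝓝 p, σ (H a z) ∈ Metric.ball p ρ₁ :=
    hσH.eventually (show Metric.ball p ρ₁ ∈ 𝓝 (σ (H a p)) by
      rw [hHp]; exact Metric.ball_mem_nhds _ hρ₁)
  have e4 : ∀ᶠ z in 𝓝 ((p, 0) : (ℝ × ℝ) × ℝ), 0 < W z :=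
    hWc.eventually (lt_mem_nhds (show 0 < W (p, 0) by rw [hW0]; exact one_pos))
  obtain ⟨ρ₂, hρ₂, hb₂⟩ := Metric.eventually_nhds_iff_ball.1 (e1.and e3)
  obtain ⟨ρ₃, hρ₃, hb₃⟩ := Metric.eventually_nhds_iff_ball.1 e4
  set ρ := min ρ₁ (min ρ₂ ρ₃) with hρ
  have hρ1 : ρ ≤ ρ₁ := min_le_left _ _
  have hρ2 : ρ ≤ ρ₂ := (min_le_right _ _).trans (min_le_left _ _)
  have hρ3 : ρ ≤ ρ₃ := (min_le_right _ _).trans (min_le_right _ _)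
  refine ⟨fun z => ℓ (z - σ (H a z)), ρ, by positivity, fun z hz => ?_, fun ε hε γ t hγ hd => ?_⟩
  · obtain ⟨hS, hz'⟩ := hb₂ z (Metric.ball_subset_ball hρ2 hz)
    refine ⟨hS, ?_, fun h0 => ?_, fun h0 => ?_⟩
    · refine ℓ.continuous.continuousAt.comp (continuousAt_id.sub ?_)
      exact ContinuousAt.comp (g := σ) (hσ.hasDerivAt h𝒜 hS).continuousAt
        (continuous_H a).continuousAt
    · set z' := σ (H a z) with hz'd
      have hHz : H a z' = H a z := hσ.level _ hS
      have hline : ∀ u : ℝ, HasDerivAt (fun u : ℝ => H a (z' + u • (z - z')))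
          (dH a (z' + u • (z - z')) (z - z')) u := fun u => by
        have h1 : HasDerivAt (fun u : ℝ => z' + u • (z - z')) (z - z') u := by
          simpa using ((hasDerivAt_id u).smul_const (z - z')).const_add z'
        exact (hasFDerivAt_H a _).comp_hasDerivAt u h1
      -- z and σ(H z) have the same energy, so Rolle on the segment between them gives a point where
      -- their difference is tangent to the level; ℓ = 0 makes it parallel to σ'(h).
      obtain ⟨u, hu, hu0⟩ := exists_hasDerivAt_eq_zero (zero_lt_one' ℝ)
        (fun u _ => (hline u).continuousAt.continuousWithinAt)
        (by simp [hHz]) (fun u _ => hline u)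
      have hball : z' + u • (z - z') ∈ Metric.ball p ρ₁ :=
        (convex_ball p ρ₁).add_smul_sub_mem hz' (Metric.ball_subset_ball hρ1 hz)
          (Ioo_subset_Icc_self hu)
      have := eq_zero_of_dH_eq_zero hu0 (by
        have h0' : ℓ (z - z') = 0 := h0
        rw [hℓa] at h0'
        linarith) (hb₁ _ hball)
      exact sub_eq_zero.1 this
    · change ℓ (z - σ (H a z)) = 0
      rw [← h0, sub_self, map_zero]
  · refine ⟨W (γ t, ε), hb₃ _ ?_, ?_⟩
    · rw [← ball_prod_same]
      refine ⟨Metric.ball_subset_ball hρ3 hγ, ?_⟩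
      rw [Metric.mem_ball, Real.dist_0_eq_abs]
      exact hε.trans_le hρ3
    · obtain ⟨hS, -⟩ := hb₂ (γ t) (Metric.ball_subset_ball hρ2 hγ)
      have h1 := (hasFDerivAt_H a (γ t)).comp_hasDerivAt t hd
      rw [dH_field] at h1
      have h2 := (hσ.hasDerivAt h𝒜 hS).scomp t h1
      refine (ℓ.hasFDerivAt.comp_hasDerivAt t (hd.sub h2)).congr_deriv ?_
      rw [map_sub, map_smul, smul_eq_mul]

/-- The first return of the perturbed orbit to the cross-section. -/
theorem exists_return (hσ : IsCrossSection a 𝒜 σ) (h𝒜 : IsPeriodAnnulus a 𝒜)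
    (hh : h ∈ H a '' 𝒜) (A B : ℕ × ℕ → ℝ) {γ₀ : ℝ → ℝ × ℝ} {T₀ : ℝ}
    (hγ₀ : IsClosedOrbit a (σ h) γ₀ T₀) :
    ∃ C, 0 ≤ C ∧ ∀ η, 0 < η → ∀ᶠ ε in 𝓝 (0 : ℝ), ∃ (γ : ℝ → ℝ × ℝ) (T : ℝ), 0 < T ∧
      |T - T₀| < η ∧ γ 0 = σ h ∧ H a (γ T) ∈ H a '' 𝒜 ∧ γ T = σ (H a (γ T)) ∧
      (∀ t ∈ Icc 0 T, HasDerivAt γ (field a A B ε (γ t)) t ∧ dist (γ t) (γ₀ t) ≤ C * |ε| ∧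
        |H a (γ t) - h| ≤ C * |ε|) ∧ ∀ t ∈ Ioo 0 T, γ t ∉ σ '' (H a '' 𝒜) := by
  have hT₀ := hγ₀.period_pos
  obtain ⟨C, hC, hev⟩ := exists_perturbed_orbit hγ₀.sol A B (T := T₀ + 1) (by linarith)
  rw [hγ₀.starts, hσ.level h hh] at hev
  obtain ⟨G, ρ, hρ, hG, hGd⟩ := hσ.exists_chart h𝒜 hh A B
  refine ⟨C, hC, fun η hη => ?_⟩
  have hnot : ∀ z ∈ Metric.ball (σ h) ρ, G z ≠ 0 → z ∉ σ '' (H a '' 𝒜) := by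
    rintro _ hz h0 ⟨s, hs, rfl⟩
    exact h0 ((hG _ hz).2.2.2 (by rw [hσ.level s hs]))
  have hc0 : ∀ᶠ t in 𝓝 (0 : ℝ), γ₀ t ∈ Metric.ball (σ h) (ρ / 2) :=
    hγ₀.sol.continuous.continuousAt.eventually
      (by rw [hγ₀.starts]; exact Metric.ball_mem_nhds _ (half_pos hρ))
  obtain ⟨η₁, hη₁, hb⟩ := Metric.eventually_nhds_iff_ball.1 hc0
  -- The period is cut at θ and T₀ − θ: on the outer pieces the orbit is in the chart and G
  -- increases, on the middle one the unperturbed orbit keeps a positive distance from σ h.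
  set θ := min (min (η₁ / 2) (η / 2)) (min (T₀ / 3) 1) with hθ
  have hθ0 : 0 < θ := by positivity
  have hθ1 : θ < η₁ := ((min_le_left _ _).trans (min_le_left _ _)).trans_lt (half_lt_self hη₁)
  have hθ2 : θ < η := ((min_le_left _ _).trans (min_le_right _ _)).trans_lt (half_lt_self hη)
  have hθ3 : θ ≤ T₀ / 3 := (min_le_right _ _).trans (min_le_left _ _)
  have hθ4 : θ ≤ 1 := (min_le_right _ _).trans (min_le_right _ _)
  have hnear : ∀ t ∈ Icc (-θ) θ, γ₀ t ∈ Metric.ball (σ h) (ρ / 2) := fun t ht => hb t (by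
    rw [Metric.mem_ball, Real.dist_0_eq_abs, abs_lt]
    constructor <;> linarith [ht.1, ht.2])
  have hnear' : ∀ t ∈ Icc (T₀ - θ) (T₀ + θ), γ₀ t ∈ Metric.ball (σ h) (ρ / 2) := fun t ht => by
    have := hnear (t - T₀) ⟨by linarith [ht.1], by linarith [ht.2]⟩
    rwa [hγ₀.periodic.sub_eq] at this
  have hmono : ∀ {ε : ℝ} {γ : ℝ → ℝ × ℝ} {u v : ℝ}, |ε| < ρ →
      (∀ t ∈ Icc u v, γ t ∈ Metric.ball (σ h) ρ ∧ HasDerivAt γ (field a A B ε (γ t)) t) →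
      StrictMonoOn (fun t => G (γ t)) (Icc u v) ∧ ContinuousOn (fun t => G (γ t)) (Icc u v) := by
    intro ε γ u v hε hγ
    have hcont : ContinuousOn (fun t => G (γ t)) (Icc u v) := fun t ht => by
      obtain ⟨c, -, hc⟩ := hGd ε hε γ t (hγ t ht).1 (hγ t ht).2
      exact hc.continuousAt.continuousWithinAt
    refine ⟨strictMonoOn_of_deriv_pos (convex_Icc _ _) hcont fun t ht => ?_, hcont⟩
    obtain ⟨c, hc0, hc⟩ := hGd ε hε γ t (hγ t (interior_subset ht)).1 (hγ t (interior_subset ht)).2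
    rwa [hc.deriv]
  have hsub : Metric.ball (σ h) (ρ / 2) ⊆ Metric.ball (σ h) ρ :=
    Metric.ball_subset_ball (half_le_self hρ.le)
  have hp0 : G (σ h) = 0 := by
    refine ((hG _ (Metric.mem_ball_self hρ)).2.2).2 ?_
    rw [hσ.level h hh]
  have hm₀ := (hmono (ε := 0) (γ := γ₀) (u := T₀ - θ) (v := T₀ + θ) (by rwa [abs_zero])
    fun t ht => ⟨hsub (hnear' t ht), by
      have := hγ₀.solves t
      simpa only [field, zero_smul, add_zero] using this⟩).1
  have hmem1 : T₀ - θ ∈ Icc (T₀ - θ) (T₀ + θ) := ⟨le_rfl, by linarith⟩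
  have hmem2 : T₀ ∈ Icc (T₀ - θ) (T₀ + θ) := ⟨by linarith, by linarith⟩
  have hmem3 : T₀ + θ ∈ Icc (T₀ - θ) (T₀ + θ) := ⟨by linarith, le_rfl⟩
  have hlo : G (γ₀ (T₀ - θ)) < 0 := by
    have : G (γ₀ (T₀ - θ)) < G (γ₀ T₀) := hm₀ hmem1 hmem2 (by linarith)
    rwa [hγ₀.closes, hp0] at this
  have hhi : 0 < G (γ₀ (T₀ + θ)) := by
    have : G (γ₀ T₀) < G (γ₀ (T₀ + θ)) := hm₀ hmem2 hmem3 (by linarith)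
    rwa [hγ₀.closes, hp0] at this
  obtain ⟨δ₁, hδ₁, hlo'⟩ := Metric.eventually_nhds_iff_ball.1
    ((hG _ (hsub (hnear' _ hmem1))).2.1.eventually (gt_mem_nhds hlo))
  obtain ⟨δ₂, hδ₂, hhi'⟩ := Metric.eventually_nhds_iff_ball.1
    ((hG _ (hsub (hnear' _ hmem3))).2.1.eventually (lt_mem_nhds hhi))
  obtain ⟨d, hd0, hd⟩ := (isCompact_Icc (a := θ) (b := T₀ - θ)).exists_forall_le'
    (f := fun t => dist (γ₀ t) (σ h)) (a := 0)
    (hγ₀.sol.continuous.dist continuous_const).continuousOn (fun t ht => dist_pos.2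
      (hγ₀.simple t ⟨by linarith [ht.1], by linarith [ht.2]⟩))
  obtain ⟨δ₃, hδ₃, hσc⟩ := Metric.continuousAt_iff.1 (hσ.hasDerivAt h𝒜 hh).continuousAt (d / 2)
    (half_pos hd0)
  filter_upwards [hev, eventually_mul_abs_lt C (half_pos hρ), eventually_mul_abs_lt 1 hρ,
    eventually_mul_abs_lt C hδ₁, eventually_mul_abs_lt C hδ₂, eventually_mul_abs_lt C hδ₃,
    eventually_mul_abs_lt C (half_pos hd0)] with ε ⟨γ, h0, hγ⟩ hε₁ hε₂ hε₃ hε₄ hε₅ hε₆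
  rw [one_mul] at hε₂
  have hin : ∀ t ∈ Icc 0 (T₀ + 1), γ₀ t ∈ Metric.ball (σ h) (ρ / 2) →
      γ t ∈ Metric.ball (σ h) ρ := fun t ht hb => by
    have h1 := (hγ t ht).2.1
    have h2 := dist_triangle (γ t) (γ₀ t) (σ h)
    rw [Metric.mem_ball] at hb ⊢
    linarith
  obtain ⟨hm₁, -⟩ := hmono (γ := γ) (u := 0) (v := θ) hε₂ fun t ht => by
    have ht' : t ∈ Icc 0 (T₀ + 1) := ⟨ht.1, by linarith [ht.2]⟩
    exact ⟨hin t ht' (hnear t ⟨by linarith [ht.1], ht.2⟩), (hγ t ht').1⟩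
  have hball₂ : ∀ t ∈ Icc (T₀ - θ) (T₀ + θ), γ t ∈ Metric.ball (σ h) ρ ∧
      HasDerivAt γ (field a A B ε (γ t)) t := fun t ht => by
    have ht' : t ∈ Icc 0 (T₀ + 1) := ⟨by linarith [ht.1], by linarith [ht.2]⟩
    exact ⟨hin t ht' (hnear' t ht), (hγ t ht').1⟩
  obtain ⟨hm₂, hc₂⟩ := hmono (γ := γ) (u := T₀ - θ) (v := T₀ + θ) hε₂ hball₂
  have hlo₂ : G (γ (T₀ - θ)) < 0 := hlo' _ (Metric.mem_ball.2
    ((hγ (T₀ - θ) ⟨by linarith, by linarith⟩).2.1.trans_lt hε₃))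
  have hhi₂ : 0 < G (γ (T₀ + θ)) := hhi' _ (Metric.mem_ball.2
    ((hγ (T₀ + θ) ⟨by linarith, by linarith⟩).2.1.trans_lt hε₄))
  -- G changes sign between T₀ − θ and T₀ + θ for the unperturbed orbit, hence for the perturbed
  -- one, and its zero is the return.
  obtain ⟨T, hT, hGT⟩ := intermediate_value_Icc (by linarith) hc₂ ⟨hlo₂.le, hhi₂.le⟩
  simp only at hGT
  have hTle : ∀ t ∈ Icc 0 T, t ∈ Icc 0 (T₀ + 1) := fun t ht =>
    ⟨ht.1, by linarith [ht.2, hT.2]⟩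
  obtain ⟨hS, -, hiff⟩ := hG _ (hball₂ T hT).1
  have hT0 : 0 < T := by linarith [hT.1]
  refine ⟨γ, T, hT0, ?_, h0, hS, hiff.1 hGT, fun t ht => hγ t (hTle t ht), fun t ht => ?_⟩
  · rw [abs_lt]
    constructor <;> linarith [hT.1, hT.2]
  · have ht' := hTle t ⟨ht.1.le, ht.2.le⟩
    rcases le_or_gt t θ with h1 | h1
    · refine hnot _ (hin t ht' (hnear t ⟨by linarith [ht.1], h1⟩)) (ne_of_gt ?_)
      have : G (γ 0) < G (γ t) := hm₁ ⟨le_rfl, hθ0.le⟩ ⟨ht.1.le, h1⟩ ht.1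
      rwa [h0, hp0] at this
    rcases le_or_gt t (T₀ - θ) with h2 | h2
    -- H stays within C|ε| of h along the orbit, so only section points close to σ h could be met,
    -- and the middle piece stays away from these.
    · rintro ⟨s, hs, hst⟩
      have h3 := (hγ t ht').2
      rw [← hst, hσ.level s hs] at h3
      have h4 := hσc (show dist s h < δ₃ by rw [Real.dist_eq]; linarith [h3.2])
      have h5 := hd t ⟨h1.le, h2⟩
      have h6 := dist_triangle (γ₀ t) (σ s) (σ h)
      rw [dist_comm (γ₀ t) (σ s)] at h6
      linarith [h3.1]
    · have ht₂ : t ∈ Icc (T₀ - θ) (T₀ + θ) := ⟨h2.le, by linarith [ht.2, hT.2]⟩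
      refine hnot _ (hball₂ t ht₂).1 (ne_of_lt ?_)
      have : G (γ t) < G (γ T) := hm₂ ht₂ hT ht.2
      rwa [hGT] at this

end CrossSection

/-! ### Expansion of the displacement map by successive multipliers. -/

open Asymptotics

theorem expansionCoeff_of_isLittleO {D : ℝ → ℝ} {M : ℝ} {k : ℕ} (hD : (fun ε => D ε - ε ^ k * M)
    =o[𝓝 (0 : ℝ)] fun ε => ε ^ k) : (∀ j < k, expansionCoeff D j = 0) ∧ expansionCoeff D k = M := by
  have hne : ∀ᶠ ε in 𝓝[≠] (0 : ℝ), ε ≠ 0 := eventually_mem_nhdsWithin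
  have hlim : ∀ j ≤ k, (∀ i < j, expansionCoeff D i = 0) →
      expansionCoeff D j = if j = k then M else 0 := by
    intro j hj hi
    rw [expansionCoeff]
    have e : ∀ ε : ℝ, ∑ i : Fin j, ε ^ (i : ℕ) * expansionCoeff D i = 0 := fun ε =>
      Finset.sum_eq_zero fun i _ => by rw [hi i i.2, mul_zero]
    simp_rw [e, sub_zero]
    refine Tendsto.limUnder_eq ?_
    have h1 : Tendsto (fun ε => (D ε - ε ^ k * M) / ε ^ k) (𝓝[≠] (0 : ℝ)) (𝓝 0) :=
      (hD.mono nhdsWithin_le_nhds).tendsto_div_nhds_zero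
    -- This function is D(ε)/ε^j for ε ≠ 0. The factor 0^(k−j) distinguishes j = k from j < k.
    have h2 : Tendsto (fun ε => ε ^ (k - j) * ((D ε - ε ^ k * M) / ε ^ k + M)) (𝓝[≠] (0 : ℝ))
        (𝓝 (0 ^ (k - j) * (0 + M))) := by
      refine Tendsto.mul ?_ (h1.add_const M)
      exact ((continuous_pow (k - j)).tendsto (0 : ℝ)).mono_left nhdsWithin_le_nhds
    have h3 : (0 : ℝ) ^ (k - j) * (0 + M) = if j = k then M else 0 := by
      split_ifs with hjk
      · rw [hjk, Nat.sub_self]; ring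
      · rw [zero_pow (by omega)]; ring
    rw [h3] at h2
    refine h2.congr' ?_
    filter_upwards [hne] with ε hε
    have h4 : ε ^ k = ε ^ (k - j) * ε ^ j := by rw [← pow_add, Nat.sub_add_cancel hj]
    rw [h4]
    field_simp
    ring
  have h0 : ∀ j < k, expansionCoeff D j = 0 := by
    intro j
    induction j using Nat.strong_induction_on with
    | _ j ih =>
      intro hj
      rw [hlim j hj.le fun i hi => ih i hi (hi.trans hj), if_neg hj.ne]
  exact ⟨h0, by rw [hlim k le_rfl h0, if_pos rfl]⟩

/-- The one-form `ω = g dx - f dy` of the perturbation. -/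
def form (A B : ℕ × ℕ → ℝ) (p : ℝ × ℝ) : ℝ × ℝ →L[ℝ] ℝ :=
  cubic B p • ContinuousLinearMap.fst ℝ ℝ ℝ - cubic A p • ContinuousLinearMap.snd ℝ ℝ ℝ

theorem form_apply (A B : ℕ × ℕ → ℝ) (p v : ℝ × ℝ) :
    form A B p v = cubic B p * v.1 - cubic A p * v.2 := rfl

theorem form_field (a : ℝ) (A B : ℕ × ℕ → ℝ) (ε : ℝ) (p : ℝ × ℝ) :
    form A B p (field a A B ε p) = drift a A B p := by
  simp only [form_apply, field, drift, field₀_eq, Prod.fst_add, Prod.snd_add, Prod.smul_fst,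
    Prod.smul_snd, smul_eq_mul]
  ring

/-- A chain of successive decompositions `qᵢ ω = dQ + qᵢ₊₁ dH`, `i < m`, with `q₀ = 1`. -/
structure IsChain (a : ℝ) (A B : ℕ × ℕ → ℝ) (m : ℕ) (q : ℕ → ℝ × ℝ → ℝ) : Prop where
  one : ∀ p, q 0 p = 1
  continuous : Continuous (q m)
  step : ∀ i < m, ∃ Q : ℝ × ℝ → ℝ, ∀ p,
    HasFDerivAt Q (q i p • form A B p - q (i + 1) p • dH a p) p

/-- The integral `∫ q Ω dt` over a closed orbit. -/
def orbitIntegral (a : ℝ) (A B : ℕ × ℕ → ℝ) (q : ℝ × ℝ → ℝ) (γ : ℝ → ℝ × ℝ) (T : ℝ) : ℝ :=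
  ∫ t in (0 : ℝ)..T, q (γ t) * drift a A B (γ t)

section CrossSection
variable {a : ℝ} {𝒜 : Set (ℝ × ℝ)} {σ : ℝ → ℝ × ℝ} {h : ℝ}

theorem eventually_existsUnique_firstReturn (hσ : IsCrossSection a 𝒜 σ) (h𝒜 : IsPeriodAnnulus a 𝒜)
    (hh : h ∈ H a '' 𝒜) (A B : ℕ × ℕ → ℝ) :
    ∀ᶠ ε in 𝓝 (0 : ℝ), ∃! h', FirstReturn a A B (H a '' 𝒜) σ ε h h' := by
  obtain ⟨γ₀, T₀, hγ₀⟩ := h𝒜.subset_periodicSet (hσ.mem h hh)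
  obtain ⟨C, -, hev⟩ := exists_return hσ h𝒜 hh A B hγ₀
  filter_upwards [hev 1 one_pos] with ε ⟨γ, T, hT, _, h0, hS, hγT, hγ, hn⟩
  have hr : FirstReturn a A B (H a '' 𝒜) σ ε h (H a (γ T)) :=
    ⟨γ, T, hT, fun t ht => (hγ t ht).1.hasDerivWithinAt, h0, hS, hγT, hn⟩
  exact ⟨_, hr, fun h' hh' => firstReturn_unique hσ.level hh' hr⟩

theorem displacement_eq (hσ : IsCrossSection a 𝒜 σ) {A B : ℕ × ℕ → ℝ} {ε h' : ℝ}
    (hr : FirstReturn a A B (H a '' 𝒜) σ ε h h') :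
    h + displacement a A B (H a '' 𝒜) σ h ε = h' := by
  refine firstReturn_unique hσ.level (Classical.epsilon_spec
    (p := fun d => FirstReturn a A B (H a '' 𝒜) σ ε h (h + d)) ⟨h' - h, ?_⟩) hr
  rwa [add_sub_cancel]

/-- Along a perturbed orbit the derivative of H − Σ ε^(i+1) Qᵢ telescopes to ε^(m+1) q_m Ω, with Ω
the `drift`. J is the integral of q_m Ω over the perturbed arc, which tends to the integral over the
closed orbit. -/
theorem eventually_displacement (hσ : IsCrossSection a 𝒜 σ) (h𝒜 : IsPeriodAnnulus a 𝒜)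
    (hh : h ∈ H a '' 𝒜) {A B : ℕ × ℕ → ℝ} {m : ℕ} {q : ℕ → ℝ × ℝ → ℝ} (hq : IsChain a A B m q)
    {Q : ℕ → ℝ × ℝ → ℝ} (hQ : ∀ i < m, ∀ p,
      HasFDerivAt (Q i) (q i p • form A B p - q (i + 1) p • dH a p) p)
    {γ₀ : ℝ → ℝ × ℝ} {T₀ : ℝ} (hγ₀ : IsClosedOrbit a (σ h) γ₀ T₀) :
    ∃ C, ∀ δ, 0 < δ → ∀ᶠ ε in 𝓝 (0 : ℝ),
      |displacement a A B (H a '' 𝒜) σ h ε| ≤ C * |ε| ∧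
      ∃ J, |J - orbitIntegral a A B (q m) γ₀ T₀| ≤ δ ∧
        displacement a A B (H a '' 𝒜) σ h ε - ∑ i ∈ Finset.range m, ε ^ (i + 1) *
          (Q i (σ (h + displacement a A B (H a '' 𝒜) σ h ε)) - Q i (σ h)) = ε ^ (m + 1) * J := by
  have hT₀ := hγ₀.period_pos
  obtain ⟨C, hC, hev⟩ := exists_return hσ h𝒜 hh A B hγ₀
  obtain ⟨R, hR⟩ := (isCompact_Icc (a := (0 : ℝ)) (b := T₀ + 1)).exists_bound_of_continuousOn
    hγ₀.sol.continuous.continuousOn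
  set G : ℝ × ℝ → ℝ := fun p => q m p * drift a A B p with hG
  have hGc : Continuous G := hq.continuous.mul (continuous_drift a A B)
  obtain ⟨N, hN⟩ := (isCompact_closedBall (0 : ℝ × ℝ) (R + 1)).exists_bound_of_continuousOn
    hGc.continuousOn
  have hunif := Metric.uniformContinuousOn_iff.1
    ((isCompact_closedBall (0 : ℝ × ℝ) (R + 1)).uniformContinuousOn_of_continuous hGc.continuousOn)
  refine ⟨C, fun δ hδ => ?_⟩
  -- Half of δ pays for the distance between the two arcs over a time at most T₀ + 1, the other half
  -- for the change of the return time.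
  obtain ⟨ρ, hρ, hGρ⟩ := hunif (δ / (2 * (T₀ + 1))) (by positivity)
  set η := min 1 (δ / (2 * (|N| + 1))) with hη
  have hη0 : 0 < η := by positivity
  filter_upwards [hev η hη0, eventually_mul_abs_lt C one_pos, eventually_mul_abs_lt C hρ]
    with ε ⟨γ, T, hT, hTT, h0, hS, hγT, hγ, hn⟩ hε₁ hε₂
  have hr : FirstReturn a A B (H a '' 𝒜) σ ε h (H a (γ T)) :=
    ⟨γ, T, hT, fun t ht => (hγ t ht).1.hasDerivWithinAt, h0, hS, hγT, hn⟩
  have hd := displacement_eq hσ hr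
  set d := displacement a A B (H a '' 𝒜) σ h ε
  have hd' : d = H a (γ T) - h := by linarith
  have hT1 : T ≤ T₀ + 1 := by
    have := (abs_lt.1 hTT).2
    linarith [min_le_left 1 (δ / (2 * (|N| + 1)))]
  have hγc : ContinuousOn γ (Icc 0 T) := fun t ht => (hγ t ht).1.continuousAt.continuousWithinAt
  have hGγ : IntervalIntegrable (fun t => G (γ t)) MeasureTheory.volume 0 T := by
    refine ContinuousOn.intervalIntegrable ?_
    rw [uIcc_of_le hT.le]
    exact hGc.comp_continuousOn hγc
  have hGγ₀ : ∀ u v, IntervalIntegrable (fun t => G (γ₀ t)) MeasureTheory.volume u v := fun u v =>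
    (hGc.comp hγ₀.sol.continuous).intervalIntegrable u v
  refine ⟨by rw [hd']; exact (hγ T ⟨hT.le, le_rfl⟩).2.2, ∫ t in (0 : ℝ)..T, G (γ t), ?_, ?_⟩
  · have e1 : (∫ t in (0 : ℝ)..T, G (γ t)) - orbitIntegral a A B (q m) γ₀ T₀ =
        (∫ t in (0 : ℝ)..T, (G (γ t) - G (γ₀ t))) + ∫ t in T₀..T, G (γ₀ t) := by
      rw [intervalIntegral.integral_sub hGγ (hGγ₀ _ _),
        ← intervalIntegral.integral_add_adjacent_intervals (hGγ₀ 0 T₀) (hGγ₀ T₀ T)]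
      simp only [orbitIntegral, hG]
      ring
    have e2 : ‖∫ t in (0 : ℝ)..T, (G (γ t) - G (γ₀ t))‖ ≤ δ / (2 * (T₀ + 1)) * |T - 0| := by
      refine intervalIntegral.norm_integral_le_of_norm_le_const fun t ht => ?_
      rw [uIoc_of_le hT.le] at ht
      have ht' : t ∈ Icc 0 T := ⟨ht.1.le, ht.2⟩
      have h1 := hR t ⟨ht.1.le, ht.2.trans hT1⟩
      have h2 := (hγ t ht').2.1
      have h3 : ‖γ t‖ ≤ ‖γ₀ t‖ + ‖γ t - γ₀ t‖ := by
        simpa using norm_add_le (γ₀ t) (γ t - γ₀ t)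
      rw [← dist_eq_norm] at h3
      rw [← dist_eq_norm]
      exact (hGρ _ (mem_closedBall_zero_iff.2 (by linarith)) _
        (mem_closedBall_zero_iff.2 (by linarith)) (h2.trans_lt hε₂)).le
    have e3 : ‖∫ t in T₀..T, G (γ₀ t)‖ ≤ |N| * |T - T₀| := by
      refine intervalIntegral.norm_integral_le_of_norm_le_const fun t ht => ?_
      have ht' : t ∈ Icc 0 (T₀ + 1) := by
        rcases le_total T₀ T with hle | hle
        · rw [uIoc_of_le hle] at ht
          exact ⟨by linarith [ht.1], ht.2.trans hT1⟩
        · rw [uIoc_of_ge hle] at ht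
          exact ⟨by linarith [ht.1], by linarith [ht.2]⟩
      exact (hN _ (mem_closedBall_zero_iff.2 (by linarith [hR t ht']))).trans (le_abs_self N)
    rw [e1]
    refine (abs_add_le _ _).trans ?_
    have e4 : δ / (2 * (T₀ + 1)) * |T - 0| ≤ δ / 2 := by
      rw [sub_zero, abs_of_pos hT]
      calc δ / (2 * (T₀ + 1)) * T ≤ δ / (2 * (T₀ + 1)) * (T₀ + 1) := by gcongr
        _ = δ / 2 := by field_simp
    have e5 : |N| * |T - T₀| ≤ δ / 2 := by
      calc |N| * |T - T₀| ≤ (|N| + 1) * (δ / (2 * (|N| + 1))) := by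
            refine mul_le_mul (by linarith) (hTT.le.trans (min_le_right _ _)) (abs_nonneg _)
              (by positivity)
        _ = δ / 2 := by field_simp
    rw [Real.norm_eq_abs] at e2 e3
    linarith
  · have hder : ∀ t ∈ uIcc 0 T, HasDerivAt (fun t => H a (γ t) - ∑ i ∈ Finset.range m,
        ε ^ (i + 1) * Q i (γ t)) (ε ^ (m + 1) * G (γ t)) t := by
      intro t ht
      rw [uIcc_of_le hT.le] at ht
      have h1 := (hasFDerivAt_H a (γ t)).comp_hasDerivAt t (hγ t ht).1
      have h2 : HasDerivAt (fun t => ∑ i ∈ Finset.range m, ε ^ (i + 1) * Q i (γ t))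
          (∑ i ∈ Finset.range m, ε ^ (i + 1) * ((q i (γ t) • form A B (γ t) -
            q (i + 1) (γ t) • dH a (γ t)) (field a A B ε (γ t)))) t :=
        HasDerivAt.fun_sum fun i hi => ((hQ i (Finset.mem_range.1 hi) (γ t)).comp_hasDerivAt t
          (hγ t ht).1).const_mul _
      refine (h1.sub h2).congr_deriv ?_
      have e : ∀ i, ε ^ (i + 1) * ((q i (γ t) • form A B (γ t) -
            q (i + 1) (γ t) • dH a (γ t)) (field a A B ε (γ t))) =
          ε ^ (i + 1) * (q i (γ t) * drift a A B (γ t)) -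
            ε ^ (i + 1 + 1) * (q (i + 1) (γ t) * drift a A B (γ t)) := by
        intro i
        rw [sub_apply, smul_apply,
          smul_apply, form_field, dH_field, smul_eq_mul, smul_eq_mul]
        ring
      simp_rw [e]
      rw [Finset.sum_range_sub' (fun i => ε ^ (i + 1) * (q i (γ t) * drift a A B (γ t))), dH_field,
        hq.one]
      simp only [hG]
      ring
    have hint := intervalIntegral.integral_eq_sub_of_hasDerivAt hder (hGγ.const_mul _)
    rw [intervalIntegral.integral_const_mul] at hint
    rw [hint, h0, hσ.level h hh, hd, ← hγT, hd']
    simp_rw [mul_sub]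
    rw [Finset.sum_sub_distrib]
    ring

/-- The expansion of the displacement map. -/
theorem displacement_isLittleO (hσ : IsCrossSection a 𝒜 σ) (h𝒜 : IsPeriodAnnulus a 𝒜)
    (hh : h ∈ H a '' 𝒜) {A B : ℕ × ℕ → ℝ} {m : ℕ} {q : ℕ → ℝ × ℝ → ℝ} (hq : IsChain a A B m q)
    {γ₀ : ℝ → ℝ × ℝ} {T₀ : ℝ} (hγ₀ : IsClosedOrbit a (σ h) γ₀ T₀) :
    (fun ε => displacement a A B (H a '' 𝒜) σ h ε -
      ε ^ (m + 1) * orbitIntegral a A B (q m) γ₀ T₀) =o[𝓝 (0 : ℝ)] fun ε => ε ^ (m + 1) := by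
  have hstep : ∀ i, ∃ Q : ℝ × ℝ → ℝ, i < m → ∀ p,
      HasFDerivAt Q (q i p • form A B p - q (i + 1) p • dH a p) p := by
    intro i
    by_cases hi : i < m
    · obtain ⟨Q, hQ⟩ := hq.step i hi
      exact ⟨Q, fun _ => hQ⟩
    · exact ⟨0, fun h => absurd h hi⟩
  choose Q hQ using hstep
  obtain ⟨C, hev⟩ := eventually_displacement hσ h𝒜 hh hq hQ hγ₀
  set D := displacement a A B (H a '' 𝒜) σ h
  set M := orbitIntegral a A B (q m) γ₀ T₀
  set R : ℝ → ℝ := fun ε => ∑ i ∈ Finset.range m, ε ^ (i + 1) * (Q i (σ (h + D ε)) - Q i (σ h))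
    with hR
  have hD0 : Tendsto D (𝓝 0) (𝓝 0) := by
    rw [← isLittleO_one_iff ℝ]
    have h1 : D =O[𝓝 0] fun ε : ℝ => ε :=
      IsBigO.of_bound C ((hev 1 one_pos).mono fun ε hε => hε.1)
    exact h1.trans_isLittleO ((isLittleO_one_iff ℝ).2 tendsto_id)
  have hhD : Tendsto (fun ε => h + D ε) (𝓝 0) (𝓝 h) := by
    simpa using hD0.const_add h
  -- Each Qᵢ ∘ σ is differentiable at h, so its increment is O(D), and the factor ε^(i+1) makes it
  -- o(D).
  have hRD : R =o[𝓝 0] D := by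
    refine IsLittleO.fun_sum (A := fun i ε => ε ^ (i + 1) * (Q i (σ (h + D ε)) - Q i (σ h)))
      fun i hi => ?_
    have h1 : HasDerivAt (fun s => Q i (σ s)) _ h :=
      (hQ i (Finset.mem_range.1 hi) (σ h)).comp_hasDerivAt h (hσ.hasDerivAt h𝒜 hh)
    have h2 : (fun ε => Q i (σ (h + D ε)) - Q i (σ h)) =O[𝓝 0] D := by
      have := h1.isBigO_sub.comp_tendsto hhD
      refine this.trans (isBigO_of_le _ fun ε => ?_)
      simp
    have h3 : (fun ε : ℝ => ε ^ (i + 1)) =o[𝓝 0] fun _ => (1 : ℝ) := by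
      rw [isLittleO_one_iff]
      have := (continuous_pow (i + 1)).tendsto (0 : ℝ)
      rwa [zero_pow (Nat.succ_ne_zero i)] at this
    simpa using h3.mul_isBigO h2
  -- Since R = o(D), D is controlled by D − R = ε^(m+1) J. This upgrades the a priori D = O(ε) and
  -- makes R negligible at order ε^(m+1).
  have hDO : D =O[𝓝 0] fun ε => ε ^ (m + 1) := by
    refine hRD.right_isBigO_sub.trans (IsBigO.of_bound (|M| + 1) ?_)
    filter_upwards [hev 1 one_pos] with ε ⟨_, J, hJ, he⟩
    rw [he, norm_mul, mul_comm]
    gcongr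
    rw [Real.norm_eq_abs]
    have := abs_add_le M (J - M)
    rw [add_sub_cancel] at this
    linarith
  have h1 : (fun ε => D ε - R ε - ε ^ (m + 1) * M) =o[𝓝 0] fun ε => ε ^ (m + 1) := by
    rw [isLittleO_iff]
    intro c hc
    filter_upwards [hev c hc] with ε ⟨_, J, hJ, he⟩
    rw [he, ← mul_sub, norm_mul, mul_comm]
    gcongr
    exact hJ
  refine (h1.add (hRD.trans_isBigO hDO)).congr_left fun ε => ?_
  ring

theorem melnikov_eq (hσ : IsCrossSection a 𝒜 σ) (h𝒜 : IsPeriodAnnulus a 𝒜)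
    (hh : h ∈ H a '' 𝒜) {A B : ℕ × ℕ → ℝ} {m : ℕ} {q : ℕ → ℝ × ℝ → ℝ} (hq : IsChain a A B m q)
    {γ₀ : ℝ → ℝ × ℝ} {T₀ : ℝ} (hγ₀ : IsClosedOrbit a (σ h) γ₀ T₀) :
    melnikov a A B (H a '' 𝒜) σ (m + 1) h = orbitIntegral a A B (q m) γ₀ T₀ :=
  (expansionCoeff_of_isLittleO (displacement_isLittleO hσ h𝒜 hh hq hγ₀)).2

end CrossSection

/-! ### Calculus of one-forms for the decompositions. -/

/-- `Q` has the partial derivatives `u`, `v` at `p`. -/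
def HasGrad (Q : ℝ × ℝ → ℝ) (u v : ℝ) (p : ℝ × ℝ) : Prop :=
  HasFDerivAt Q (u • ContinuousLinearMap.fst ℝ ℝ ℝ + v • ContinuousLinearMap.snd ℝ ℝ ℝ) p

namespace HasGrad
variable {Q Q' : ℝ × ℝ → ℝ} {u v u' v' : ℝ} {p : ℝ × ℝ}

theorem congr (h : HasGrad Q u v p) (hu : u = u') (hv : v = v') : HasGrad Q u' v' p := by
  subst hu hv; exact h

theorem poly (P : ℝ[X]) (p : ℝ × ℝ) :
    HasGrad (fun q => P.eval q.1) ((derivative P).eval p.1) 0 p := by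
  refine ((P.hasDerivAt p.1).comp_hasFDerivAt p hasFDerivAt_fst).congr_fderiv ?_
  ext <;> simp

theorem snd (p : ℝ × ℝ) : HasGrad (fun q => q.2) 0 1 p := by
  refine hasFDerivAt_snd.congr_fderiv ?_
  ext <;> simp

theorem energy (a : ℝ) (p : ℝ × ℝ) : HasGrad (H a) (frc a p.1) p.2 p := hasFDerivAt_H a p

theorem add (h : HasGrad Q u v p) (h' : HasGrad Q' u' v' p) :
    HasGrad (fun q => Q q + Q' q) (u + u') (v + v') p := by
  refine (HasFDerivAt.add h h').congr_fderiv ?_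
  ext <;> simp

theorem mul (h : HasGrad Q u v p) (h' : HasGrad Q' u' v' p) :
    HasGrad (fun q => Q q * Q' q) (u * Q' p + Q p * u') (v * Q' p + Q p * v') p := by
  refine (HasFDerivAt.mul h h').congr_fderiv ?_
  ext <;> simp <;> ring

theorem const_mul (c : ℝ) (h : HasGrad Q u v p) :
    HasGrad (fun q => c * Q q) (c * u) (c * v) p := by
  refine (HasFDerivAt.const_mul h c).congr_fderiv ?_
  ext <;> simp

theorem snd_pow (n : ℕ) (p : ℝ × ℝ) :
    HasGrad (fun q => q.2 ^ (n + 1)) 0 ((n + 1) * p.2 ^ n) p := by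
  refine ((hasDerivAt_pow (n + 1) p.2).comp_hasFDerivAt p hasFDerivAt_snd).congr_fderiv ?_
  ext <;> simp

theorem comp_isSol {a : ℝ} {γ : ℝ → ℝ × ℝ} (hγ : IsSol a γ) {t : ℝ} (h : HasGrad Q u v (γ t)) :
    HasDerivAt (fun s => Q (γ s)) (u * (γ t).2 - v * frc a (γ t).1) t := by
  refine (HasFDerivAt.comp_hasDerivAt t h (hγ t)).congr_deriv ?_
  simp [field₀_eq]
  ring

end HasGrad

/-- A decomposition `q ω = dR + q' dH + N y dx`. -/
def IsStep (a : ℝ) (A B : ℕ × ℕ → ℝ) (q q' : ℝ × ℝ → ℝ) (N : ℝ[X]) : Prop :=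
  ∃ R : ℝ × ℝ → ℝ, ∀ p, HasGrad R (q p * cubic B p - q' p * frc a p.1 - N.eval p.1 * p.2)
    (-(q p * cubic A p) - q' p * p.2) p

theorem IsStep.hasFDerivAt {a : ℝ} {A B : ℕ × ℕ → ℝ} {q q' : ℝ × ℝ → ℝ} (h : IsStep a A B q q' 0) :
    ∃ Q : ℝ × ℝ → ℝ, ∀ p, HasFDerivAt Q (q p • form A B p - q' p • dH a p) p := by
  obtain ⟨R, hR⟩ := h
  refine ⟨R, fun p => (hR p).congr_fderiv ?_⟩
  ext <;> simp [form_apply, dH_apply]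

/-- Because y dy = dH − U' dx, one has U' y dx = y dH − d(y³/3): a remainder bU' costs only the term
by in the next multiplier. -/
theorem IsStep.absorb {a : ℝ} {A B : ℕ × ℕ → ℝ} {q q' : ℝ × ℝ → ℝ} {b : ℝ}
    (h : IsStep a A B q q' (C b * frcPoly a)) : IsStep a A B q (fun p => q' p + b * p.2) 0 := by
  obtain ⟨R, hR⟩ := h
  refine ⟨fun p => R p + -(b / 3) * p.2 ^ (2 + 1), fun p =>
    ((hR p).add ((HasGrad.snd_pow 2 p).const_mul _)).congr ?_ ?_⟩
  · simp only [eval_mul, eval_C, eval_frcPoly, eval_zero]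
    ring
  · push_cast; ring

theorem integral_mul_snd_eq_zero {a : ℝ} {p : ℝ × ℝ} {γ : ℝ → ℝ × ℝ} {T : ℝ}
    (hγ : IsClosedOrbit a p γ T) (P : ℝ[X]) : ∫ t in (0 : ℝ)..T, P.eval (γ t).1 * (γ t).2 = 0 := by
  obtain ⟨W, hW, -⟩ := exists_antiderivative P
  have hd : ∀ t ∈ uIcc 0 T, HasDerivAt (fun t => W.eval (γ t).1) (P.eval (γ t).1 * (γ t).2) t :=
    fun t _ => by
      rw [← hW]
      exact (W.hasDerivAt (γ t).1).comp t (hγ.sol.fst t)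
  rw [intervalIntegral.integral_eq_sub_of_hasDerivAt hd (Continuous.intervalIntegrable
    (by have := hγ.sol.continuous; fun_prop) _ _), hγ.closes, hγ.starts, sub_self]

/-- Terms P(x) y dt = P(x) dx are exact and drop out over a closed orbit. Here P may depend on the
level, which is used at fourth order. -/
theorem orbitIntegral_eq {a : ℝ} {A B : ℕ × ℕ → ℝ} {q : ℝ × ℝ → ℝ} (hq : Continuous q)
    {p : ℝ × ℝ} {γ : ℝ → ℝ × ℝ} {T : ℝ} (hγ : IsClosedOrbit a p γ T) {N P : ℝ[X]} {R : ℝ × ℝ → ℝ}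
    (hR : ∀ t, HasDerivAt (fun s => R (γ s)) (q (γ t) * drift a A B (γ t) -
      N.eval (γ t).1 * (γ t).2 ^ 2 - P.eval (γ t).1 * (γ t).2) t) :
    orbitIntegral a A B q γ T = ∫ t in (0 : ℝ)..T, N.eval (γ t).1 * (γ t).2 ^ 2 := by
  have hc := hγ.sol.continuous
  have h1 := intervalIntegral.integral_eq_sub_of_hasDerivAt (a := 0) (b := T) (fun t _ => hR t)
    (Continuous.intervalIntegrable (by fun_prop) _ _)
  rw [hγ.closes, hγ.starts, sub_self, intervalIntegral.integral_sub
    (Continuous.intervalIntegrable (by fun_prop) _ _)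
    (Continuous.intervalIntegrable (by fun_prop) _ _), intervalIntegral.integral_sub
    (Continuous.intervalIntegrable (by fun_prop) _ _)
    (Continuous.intervalIntegrable (by fun_prop) _ _), integral_mul_snd_eq_zero hγ] at h1
  rw [orbitIntegral]
  linarith

theorem IsStep.orbitIntegral_eq {a : ℝ} {A B : ℕ × ℕ → ℝ} {q q' : ℝ × ℝ → ℝ} {N : ℝ[X]}
    (h : IsStep a A B q q' N) (hq : Continuous q) {p : ℝ × ℝ} {γ : ℝ → ℝ × ℝ} {T : ℝ}
    (hγ : IsClosedOrbit a p γ T) :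
    orbitIntegral a A B q γ T = ∫ t in (0 : ℝ)..T, N.eval (γ t).1 * (γ t).2 ^ 2 := by
  obtain ⟨R, hR⟩ := h
  refine CubicPerturbation.orbitIntegral_eq hq hγ (P := 0) (R := R) fun t =>
    ((hR (γ t)).comp_isSol hγ.sol).congr_deriv ?_
  simp only [drift, eval_zero]
  ring

/-! ### The normal form and the first four orders. -/

/-- The perturbation in the form `f = -Q_y`, `g = Q_x + κ y² + n y + ν y³`, where
`Q = P₀ + P₁ y + P₂ y² + P₃ y³ + c y⁴`. -/
structure NormalForm (A B : ℕ × ℕ → ℝ) (P₀ P₁ P₂ P₃ κ n : ℝ[X]) (c ν : ℝ) : Prop where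
  fst : ∀ p, cubic A p = -(P₁.eval p.1 + 2 * P₂.eval p.1 * p.2 + 3 * P₃.eval p.1 * p.2 ^ 2 +
    4 * c * p.2 ^ 3)
  snd : ∀ p, cubic B p = (derivative P₀).eval p.1 + (derivative P₁).eval p.1 * p.2 +
    (derivative P₂).eval p.1 * p.2 ^ 2 + (derivative P₃).eval p.1 * p.2 ^ 3 +
    κ.eval p.1 * p.2 ^ 2 + n.eval p.1 * p.2 + ν * p.2 ^ 3

theorem exists_normalForm (A B : ℕ × ℕ → ℝ) : ∃ (P₀ P₁ P₂ P₃ κ n : ℝ[X]) (c ν : ℝ),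
    NormalForm A B P₀ P₁ P₂ P₃ κ n c ν ∧ P₀.natDegree ≤ 4 ∧ P₁.natDegree ≤ 3 ∧
      P₂.natDegree ≤ 2 ∧ P₃.natDegree ≤ 1 ∧ κ.natDegree ≤ 1 ∧ n.natDegree ≤ 2 := by
  refine ⟨C (B (0, 0)) * X + C (B (1, 0) / 2) * X ^ 2 + C (B (2, 0) / 3) * X ^ 3 +
      C (B (3, 0) / 4) * X ^ 4,
    C (-A (0, 0)) + C (-A (1, 0)) * X + C (-A (2, 0)) * X ^ 2 + C (-A (3, 0)) * X ^ 3,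
    C (-A (0, 1) / 2) + C (-A (1, 1) / 2) * X + C (-A (2, 1) / 2) * X ^ 2,
    C (-A (0, 2) / 3) + C (-A (1, 2) / 3) * X,
    C (B (0, 2) + A (1, 1) / 2) + C (B (1, 2) + A (2, 1)) * X,
    C (B (0, 1) + A (1, 0)) + C (B (1, 1) + 2 * A (2, 0)) * X + C (B (2, 1) + 3 * A (3, 0)) * X ^ 2,
    -A (0, 3) / 4, B (0, 3) + A (1, 2) / 3, ⟨fun p => ?_, fun p => ?_⟩, ?_, ?_, ?_, ?_, ?_, ?_⟩
  · rw [← Prod.mk.eta (p := p), cubic_eq]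
    simp only [eval_add, eval_mul, eval_C, eval_X, eval_pow]
    ring
  · rw [← Prod.mk.eta (p := p), cubic_eq]
    simp only [derivative_add, derivative_mul, derivative_C, derivative_X, derivative_X_pow,
      eval_add, eval_mul, eval_C, eval_X, eval_pow, eval_zero, eval_one]
    push_cast
    ring
  all_goals compute_degree

section Steps
variable {a : ℝ} {A B : ℕ × ℕ → ℝ} {P₀ P₁ P₂ P₃ κ n : ℝ[X]} {c ν : ℝ}

theorem hasGrad_quartic (P₀ P₁ P₂ P₃ : ℝ[X]) (c : ℝ) (p : ℝ × ℝ) :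
    HasGrad (fun q => P₀.eval q.1 + P₁.eval q.1 * q.2 + P₂.eval q.1 * q.2 ^ (1 + 1) +
      P₃.eval q.1 * q.2 ^ (2 + 1) + c * q.2 ^ (3 + 1))
      ((derivative P₀).eval p.1 + (derivative P₁).eval p.1 * p.2 +
        (derivative P₂).eval p.1 * p.2 ^ 2 + (derivative P₃).eval p.1 * p.2 ^ 3)
      (P₁.eval p.1 + 2 * P₂.eval p.1 * p.2 + 3 * P₃.eval p.1 * p.2 ^ 2 + 4 * c * p.2 ^ 3) p := by
  refine (((((HasGrad.poly P₀ p).add ((HasGrad.poly P₁ p).mul (HasGrad.snd p))).add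
    ((HasGrad.poly P₂ p).mul (HasGrad.snd_pow 1 p))).add
    ((HasGrad.poly P₃ p).mul (HasGrad.snd_pow 2 p))).add
    ((HasGrad.snd_pow 3 p).const_mul c)).congr ?_ ?_
  · ring
  · push_cast; ring

/-- Use y² = 2(H − U) to write κy² dx = d(2KH) − 2K dH − 2κU dx, and integrate y³ dx by parts as
d(xy³) − 3xy dH + 3xU' y dx. -/
theorem NormalForm.isStep_first_order (nf : NormalForm A B P₀ P₁ P₂ P₃ κ n c ν) {K : ℝ[X]}
    (hK : derivative K = κ) :
    IsStep a A B (fun _ => 1) (fun p => -2 * K.eval p.1 - 3 * ν * p.1 * p.2)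
      (n + C (3 * ν) * X * frcPoly a) := by
  obtain ⟨V, hV, -⟩ := exists_antiderivative (κ * potPoly a)
  refine ⟨_, fun p => ((((hasGrad_quartic P₀ P₁ P₂ P₃ c p).add
    (((HasGrad.poly K p).mul (HasGrad.energy a p)).const_mul 2)).add
    ((HasGrad.poly V p).const_mul (-2))).add
    (((HasGrad.poly X p).mul (HasGrad.snd_pow 2 p)).const_mul ν)).congr ?_ ?_⟩
  · simp only [nf.snd, hK, hV, eval_add, eval_mul, eval_C, eval_X, eval_frcPoly, eval_potPoly,
      derivative_X, eval_one, H_eq]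
    ring
  · simp only [nf.fst, eval_X]
    push_cast
    ring

/-- The even part of the second multiplier, as a polynomial in `x` and `H`. -/
def evenMult (K V W : ℝ[X]) (c : ℝ) (x h : ℝ) : ℝ :=
  2 * K.eval x ^ 2 - 4 * W.eval x + 16 * c * V.eval x - 16 * c * K.eval x * h

/-- By parts, −2K dQ becomes 2κQ dx modulo exact forms. Even powers of y turn into powers of H with
coefficients in x, and integrating these gives `evenMult`. The odd ones leave 2κP₁ y dx and 2κP₃ y³
dx, the latter integrated by parts with L. -/
theorem NormalForm.isStep_second_order (nf : NormalForm A B P₀ P₁ P₂ P₃ κ 0 c 0) {K V W L : ℝ[X]}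
    (hK : derivative K = κ) (hV : derivative V = κ * potPoly a) (hW : derivative W = κ * P₂)
    (hL : derivative L = κ * P₃) :
    IsStep a A B (fun p => -2 * K.eval p.1)
      (fun p => evenMult K V W c p.1 (H a p) - 6 * L.eval p.1 * p.2)
      (C 2 * κ * P₁ + C 6 * L * frcPoly a) := by
  obtain ⟨Z, hZ, -⟩ := exists_antiderivative (C 2 * κ * P₀ - C 4 * κ * P₂ * potPoly a +
    C (8 * c) * κ * potPoly a ^ 2 + C 4 * K * κ * potPoly a)
  have h21 : ∀ p, HasGrad (fun q => (C 4 * W - C (16 * c) * V - C 2 * K ^ 2).eval q.1 * H a q) _ _ p :=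
    fun p => (HasGrad.poly _ p).mul (HasGrad.energy a p)
  have h22 : ∀ p, HasGrad (fun q => 8 * c * (K.eval q.1 * (H a q * H a q))) _ _ p :=
    fun p => ((HasGrad.poly K p).mul ((HasGrad.energy a p).mul (HasGrad.energy a p))).const_mul _
  refine ⟨_, fun p => ((((((HasGrad.poly K p).mul (hasGrad_quartic P₀ P₁ P₂ P₃ c p)).const_mul
    (-2)).add (((HasGrad.poly L p).mul (HasGrad.snd_pow 2 p)).const_mul 2)).add
    (HasGrad.poly Z p)).add ((h21 p).add (h22 p))).congr ?_ ?_⟩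
  · simp only [nf.snd, hK, hV, hW, hL, hZ, derivative_mul, derivative_pow, derivative_C,
      derivative_sub, eval_sub, evenMult, eval_pow, eval_zero,
      eval_add, eval_mul, eval_C, eval_frcPoly, eval_potPoly, H_eq]
    push_cast
    ring
  · simp only [nf.fst, evenMult, eval_sub, eval_mul, eval_C, eval_pow, H_eq]
    push_cast
    ring

/-- The third multiplier. -/
def thirdMult (a : ℝ) (P₁ P₂ K V W W₁ W₂ : ℝ[X]) (c s : ℝ) (p : ℝ × ℝ) : ℝ :=
  evenMult K V W c p.1 (H a p) * (2 * P₂.eval p.1 + 4 * c * p.2 ^ 2) - W₁.eval p.1 -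
    2 * H a p * W₂.eval p.1 - 2 * s * P₁.eval p.1 + 16 * c * K.eval p.1 * P₁.eval p.1 * p.2 -
    s * p.2 * (6 * K.eval p.1 + 2 * P₂.eval p.1 - 8 * c * p.2 ^ 2)

/-- The part of ω odd under y ↦ −y is d(P₁y), and the even part times `evenMult` is a polynomial in
H whose coefficients are integrated by `W₁`, `W₂` and one more primitive. Moving d off P₁y produces
κP₁ times a function of x and y, which κP₁ = sU' turns into an integrable term. The term 2sy is
handled directly. -/
theorem NormalForm.isStep_third_order (nf : NormalForm A B P₀ P₁ P₂ 0 κ 0 c 0) {s : ℝ}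
    (hs : κ * P₁ = C s * frcPoly a) {K V W W₁ W₂ : ℝ[X]}
    (hK : derivative K = κ) (hV : derivative V = κ * potPoly a) (hW : derivative W = κ * P₂)
    (hW₁ : derivative W₁ = (C 2 * K ^ 2 - C 4 * W + C (16 * c) * V) *
        (C 2 * derivative P₂ - C (8 * c) * frcPoly a + C 2 * κ) -
      C (16 * c) * K * (derivative P₀ - C 2 * derivative P₂ * potPoly a - C 2 * P₂ * frcPoly a +
        C (8 * c) * potPoly a * frcPoly a - C 2 * κ * potPoly a))
    (hW₂ : derivative W₂ =
      -C (16 * c) * K * (C 2 * derivative P₂ - C (8 * c) * frcPoly a + C 2 * κ)) :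
    IsStep a A B (fun p => evenMult K V W c p.1 (H a p) + 2 * s * p.2)
      (thirdMult a P₁ P₂ K V W W₁ W₂ c s)
      (C (2 * s) * derivative P₀ + C (6 * s) * (P₂ + C (1 / 3) * K) * frcPoly a) := by
  obtain ⟨W₀, hW₀, -⟩ := exists_antiderivative ((C 2 * K ^ 2 - C 4 * W + C (16 * c) * V) *
    (derivative P₀ - C 2 * derivative P₂ * potPoly a - C 2 * P₂ * frcPoly a +
      C (8 * c) * potPoly a * frcPoly a - C 2 * κ * potPoly a))
  obtain ⟨F, hF, -⟩ := exists_antiderivative (P₁ * frcPoly a)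
  have hev : ∀ p, HasGrad (fun q => (C 2 * K ^ 2 - C 4 * W + C (16 * c) * V).eval q.1 +
      (C (-16 * c) * K).eval q.1 * H a q) _ _ p := fun p =>
    (HasGrad.poly _ p).add ((HasGrad.poly _ p).mul (HasGrad.energy a p))
  refine ⟨_, fun p => (((((HasGrad.poly W₀ p).add ((HasGrad.poly W₁ p).mul
    (HasGrad.energy a p))).add ((HasGrad.poly W₂ p).mul ((HasGrad.energy a p).mul
    (HasGrad.energy a p)))).add ((hev p).mul ((HasGrad.poly P₁ p).mul (HasGrad.snd p)))).add
    (((((HasGrad.poly P₁ p).mul (HasGrad.snd_pow 1 p)).add (HasGrad.poly F p)).add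
    (((HasGrad.poly K p).add (HasGrad.poly P₂ p)).mul (HasGrad.snd_pow 2 p))).const_mul
    (2 * s))).congr ?_ ?_⟩
  · have hs' := congrArg (eval p.1) hs
    simp only [eval_mul, eval_C, eval_frcPoly] at hs'
    simp only [nf.snd, hK, hV, hW, hW₀, hW₁, hW₂, hF, thirdMult, evenMult, derivative_mul,
      derivative_pow, derivative_C, derivative_add, derivative_sub, derivative_zero, eval_sub,
      eval_pow, eval_zero, eval_add, eval_mul, eval_C, eval_frcPoly, eval_potPoly, eval_neg, H_eq]
    push_cast
    linear_combination 4 * p.2 * (K.eval p.1 - P₂.eval p.1 - 2 * c * p.2 ^ 2) * hs'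
  · simp only [nf.fst, thirdMult, evenMult, eval_sub, eval_mul, eval_C, eval_pow, eval_add,
      eval_zero, H_eq]
    push_cast
    ring

theorem continuous_thirdMult (a : ℝ) (P₁ P₂ K V W W₁ W₂ : ℝ[X]) (c s : ℝ) :
    Continuous (thirdMult a P₁ P₂ K V W W₁ W₂ c s) := by
  have := continuous_H a
  unfold thirdMult evenMult
  fun_prop

/-- Here the perturbed system is itself reversible in y. The multiplier is even in y and the drift
odd, so on a fixed level the integrand is a polynomial in x times y, hence exact. -/
theorem NormalForm.fourth_order_integral_even (nf : NormalForm A B P₀ 0 P₂ 0 κ 0 c 0)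
    (K V W W₁ W₂ : ℝ[X]) {p : ℝ × ℝ} {γ : ℝ → ℝ × ℝ} {T : ℝ} (hγ : IsClosedOrbit a p γ T) :
    orbitIntegral a A B (thirdMult a 0 P₂ K V W W₁ W₂ c 0) γ T = 0 := by
  obtain ⟨h, hh⟩ : ∃ h, h = H a p := ⟨_, rfl⟩
  have hE : ∀ t, h = (γ t).2 ^ 2 / 2 + pot a (γ t).1 := fun t => by rw [hh, hγ.energy]
  have := orbitIntegral_eq (A := A) (B := B) (R := fun _ => 0)
    (continuous_thirdMult a 0 P₂ K V W W₁ W₂ c 0) hγ (N := 0)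
    (P := ((C 2 * K ^ 2 - C 4 * W + C (16 * c) * V - C (16 * c * h) * K) *
      (C 2 * P₂ + C (8 * c) * (C h - potPoly a)) - W₁ - C (2 * h) * W₂) *
      (derivative P₀ + (derivative P₂ + κ) * (C 2 * (C h - potPoly a)) -
        (C 2 * P₂ + C (8 * c) * (C h - potPoly a)) * frcPoly a)) fun t => by
    refine (hasDerivAt_const t (0 : ℝ)).congr_deriv ?_
    simp only [drift, nf.fst, nf.snd, thirdMult, evenMult, derivative_zero, eval_sub, eval_pow,
      eval_zero, eval_add, eval_mul, eval_C, eval_frcPoly, eval_potPoly, H_eq]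
    rw [hE t]
    ring
  rw [this]
  simp

/-- On a fixed level even powers of y are polynomials in x. Removing a derivative and terms of the
form P(x) y, and using κP₁ = sU' together with the third-order conditions, leaves only 2sP₁P₁' y².
-/
theorem NormalForm.fourth_order_integral_odd {s m d : ℝ}
    (nf : NormalForm A B P₀ P₁ P₂ 0 κ 0 c 0) (hs : κ * P₁ = C s * frcPoly a) {K V W W₁ W₂ : ℝ[X]}
    (hP₂ : P₂ = C m - C (1 / 3) * K) (hP₀ : derivative P₀ = C d * frcPoly a)
    (hK : derivative K = κ) (hV : derivative V = κ * potPoly a) (hW : derivative W = κ * P₂)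
    (hW₁ : derivative W₁ = (C 2 * K ^ 2 - C 4 * W + C (16 * c) * V) *
        (C 2 * derivative P₂ - C (8 * c) * frcPoly a + C 2 * κ) -
      C (16 * c) * K * (derivative P₀ - C 2 * derivative P₂ * potPoly a - C 2 * P₂ * frcPoly a +
        C (8 * c) * potPoly a * frcPoly a - C 2 * κ * potPoly a))
    (hW₂ : derivative W₂ =
      -C (16 * c) * K * (C 2 * derivative P₂ - C (8 * c) * frcPoly a + C 2 * κ))
    {p : ℝ × ℝ} {γ : ℝ → ℝ × ℝ} {T : ℝ} (hγ : IsClosedOrbit a p γ T) :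
    orbitIntegral a A B (fun p => thirdMult a P₁ P₂ K V W W₁ W₂ c s p +
        (2 * s * d + 6 * s * m) * p.2) γ T =
      ∫ t in (0 : ℝ)..T, (C (2 * s) * P₁ * derivative P₁).eval (γ t).1 * (γ t).2 ^ 2 := by
  obtain ⟨h, hh⟩ : ∃ h, h = H a p := ⟨_, rfl⟩
  have hE : ∀ t, h = (γ t).2 ^ 2 / 2 + pot a (γ t).1 := fun t => by rw [hh, hγ.energy]
  have hc := continuous_thirdMult a P₁ P₂ K V W W₁ W₂ c s
  set e : ℝ[X] := C 2 * K ^ 2 - C 4 * W + C (16 * c) * V - C (16 * c * h) * K with he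
  set q : ℝ[X] := e * (C 2 * P₂ + C (8 * c) * (C h - potPoly a)) - W₁ - C (2 * h) * W₂ -
    C (2 * s) * P₁ with hq
  refine orbitIntegral_eq (A := A) (B := B) (R := fun p => (q * P₁).eval p.1 * p.2 +
    (C (4 / 3 * s * d) * K - C (2 / 3 * s) * e - C (2 / 3 * s * d ^ 2)).eval p.1 * p.2 ^ (2 + 1))
    (by fun_prop) hγ
    (P := q * (derivative P₀ - C 2 * derivative P₂ * potPoly a - C 2 * P₂ * frcPoly a +
        C (8 * c) * potPoly a * frcPoly a - C 2 * κ * potPoly a +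
        C h * (C 2 * derivative P₂ - C (8 * c) * frcPoly a + C 2 * κ)) +
      (C (16 * c) * K * P₁ - C s * (C (16 / 3) * K - C (4 * m) - C (16 * c) * (C h - potPoly a)) +
        C (2 * s * d)) * (C 2 * derivative P₁ * (C h - potPoly a) - P₁ * frcPoly a)) fun t => ?_
  refine ((((HasGrad.poly (q * P₁) (γ t)).mul (HasGrad.snd _)).add
    ((HasGrad.poly (C (4 / 3 * s * d) * K - C (2 / 3 * s) * e - C (2 / 3 * s * d ^ 2)) (γ t)).mul
      (HasGrad.snd_pow 2 _))).comp_isSol hγ.sol).congr_deriv ?_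
  have hs' := congrArg (eval (γ t).1) hs
  simp only [eval_mul, eval_C, eval_frcPoly] at hs'
  subst hP₂
  simp only [he, hq, drift, nf.fst, nf.snd, hK, hV, hW, hW₁, hW₂, hP₀, thirdMult, evenMult,
    derivative_potPoly, derivative_mul, derivative_pow, derivative_C, derivative_add,
    derivative_sub, derivative_zero, eval_sub, eval_pow, eval_zero, eval_add, eval_mul, eval_C,
    eval_frcPoly, eval_potPoly, eval_neg, H_eq]
  rw [hE t]
  generalize (γ t).1 = x at *
  generalize (γ t).2 = y at *
  push_cast
  linear_combination y ^ 2 * (4 * (4 / 3 * K.eval x - m - 2 * c * y ^ 2) *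
    (2 * (m - 1 / 3 * K.eval x) + 4 * c * y ^ 2) - 2 * (2 * K.eval x ^ 2 - 4 * W.eval x +
      16 * c * V.eval x - 16 * c * K.eval x * (y ^ 2 / 2 + pot a x))) * hs'

end Steps

/-! ### Multipliers and Melnikov coefficients. -/

/-- `r` is the last multiplier of a chain of length `m`. -/
def IsMultiplier (a : ℝ) (A B : ℕ × ℕ → ℝ) (m : ℕ) (r : ℝ × ℝ → ℝ) : Prop :=
  ∃ q, IsChain a A B m q ∧ q m = r

/-- The integral of `r Ω` over every closed orbit equals the elliptic integral `∮ N(x) y dx`. -/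
def IsReduced (a : ℝ) (A B : ℕ × ℕ → ℝ) (r : ℝ × ℝ → ℝ) (N : ℝ[X]) : Prop :=
  ∀ p γ T, IsClosedOrbit a p γ T →
    orbitIntegral a A B r γ T = ∫ t in (0 : ℝ)..T, N.eval (γ t).1 * (γ t).2 ^ 2

section Multiplier
variable {a : ℝ} {A B : ℕ × ℕ → ℝ} {m : ℕ} {r r' : ℝ × ℝ → ℝ} {N : ℝ[X]}

theorem isMultiplier_zero (a : ℝ) (A B : ℕ × ℕ → ℝ) : IsMultiplier a A B 0 fun _ => 1 :=
  ⟨fun _ _ => 1, ⟨fun _ => rfl, continuous_const, fun _ h => absurd h (Nat.not_lt_zero _)⟩, rfl⟩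

theorem IsMultiplier.continuous (h : IsMultiplier a A B m r) : Continuous r := by
  obtain ⟨q, hq, rfl⟩ := h
  exact hq.continuous

theorem IsMultiplier.succ (h : IsMultiplier a A B m r) (hs : IsStep a A B r r' 0)
    (hr' : Continuous r') : IsMultiplier a A B (m + 1) r' := by
  obtain ⟨q, hq, rfl⟩ := h
  refine ⟨Function.update q (m + 1) r', ⟨fun p => ?_, ?_, fun i hi => ?_⟩, ?_⟩
  · rw [Function.update_of_ne (by omega)]
    exact hq.one p
  · rwa [Function.update_self]
  · rw [Function.update_of_ne (show i ≠ m + 1 by omega)]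
    rcases eq_or_ne i m with rfl | hne
    · rw [Function.update_self]
      exact hs.hasFDerivAt
    · rw [Function.update_of_ne (show i + 1 ≠ m + 1 by omega)]
      exact hq.step i (by omega)
  · rw [Function.update_self]

theorem IsMultiplier.isReduced (h : IsMultiplier a A B m r) (hs : IsStep a A B r r' N) :
    IsReduced a A B r N := fun _ _ _ hγ => hs.orbitIntegral_eq h.continuous hγ

end Multiplier

section Annulus
variable {a : ℝ} {𝒜 : Set (ℝ × ℝ)} {σ : ℝ → ℝ × ℝ} {A B : ℕ × ℕ → ℝ} {m : ℕ} {r : ℝ × ℝ → ℝ}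
  {N : ℝ[X]}

theorem IsMultiplier.melnikov_eq (hr : IsMultiplier a A B m r) (hN : IsReduced a A B r N)
    (hσ : IsCrossSection a 𝒜 σ) (h𝒜 : IsPeriodAnnulus a 𝒜) {h : ℝ} (hh : h ∈ H a '' 𝒜)
    {γ : ℝ → ℝ × ℝ} {T : ℝ} (hγ : IsClosedOrbit a (σ h) γ T) :
    melnikov a A B (H a '' 𝒜) σ (m + 1) h =
      ∫ t in (0 : ℝ)..T, N.eval (γ t).1 * (γ t).2 ^ 2 := by
  obtain ⟨q, hq, rfl⟩ := hr
  rw [CubicPerturbation.melnikov_eq hσ h𝒜 hh hq hγ, hN _ _ _ hγ]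

theorem IsMultiplier.exists_eq_smul (hr : IsMultiplier a A B m r) (hN : IsReduced a A B r N)
    (ha : a ≠ 0) (ha8 : a ≠ 8 / 9) (hσ : IsCrossSection a 𝒜 σ) (h𝒜 : IsPeriodAnnulus a 𝒜)
    (hd : N.natDegree ≤ 6) (h0 : ∀ h ∈ H a '' 𝒜, melnikov a A B (H a '' 𝒜) σ (m + 1) h = 0) :
    ∃ b, N = C b * frcPoly a :=
  exists_eq_smul_of_annulus ha ha8 h𝒜 hσ hd fun h hh γ T hγ => by
    rw [← hr.melnikov_eq hN hσ h𝒜 hh hγ, h0 h hh]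

end Annulus

/-! ### Algebraic consequences of the vanishing of a Melnikov coefficient. -/

section Algebra
variable {a : ℝ}

theorem frcPoly_ne_zero (ha : a ≠ 0) : frcPoly a ≠ 0 := by
  intro h
  have := natDegree_frcPoly ha
  rw [h] at this
  simp at this

theorem eq_C_of_natDegree_mul_frcPoly (ha : a ≠ 0) {P R : ℝ[X]} (h : R = P * frcPoly a)
    (hR : R.natDegree ≤ 3) : ∃ d, P = C d := by
  rcases eq_or_ne P 0 with rfl | hP
  · exact ⟨0, by simp⟩
  · rw [h, natDegree_mul hP (frcPoly_ne_zero ha), natDegree_frcPoly ha] at hR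
    exact ⟨_, eq_C_of_natDegree_eq_zero (by omega)⟩

/-- n is a multiple of the cubic U' but has degree at most 2, so the cofactor b − 3νx is zero. -/
theorem eq_zero_of_first_order (ha : a ≠ 0) {n : ℝ[X]} (hn : n.natDegree ≤ 2) {ν b : ℝ}
    (h : n + C (3 * ν) * X * frcPoly a = C b * frcPoly a) : n = 0 ∧ ν = 0 := by
  have h1 : n = (C b - C (3 * ν) * X) * frcPoly a := by linear_combination h
  have h2 : C b - C (3 * ν) * X = 0 := by
    by_contra hne
    have := natDegree_mul hne (frcPoly_ne_zero ha)
    rw [← h1, natDegree_frcPoly ha] at this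
    omega
  refine ⟨by rw [h1, h2, zero_mul], ?_⟩
  have := congrArg (fun P => coeff P 1) h2
  simp only [coeff_sub, coeff_C_mul_X, coeff_zero, coeff_C, if_true, if_neg one_ne_zero] at this
  linarith

/-- κP₁ = (b/2 − 3L)U'. If P₃ ≠ 0, then L has degree deg κ + deg P₃ + 1 and the right side has
degree at least deg κ + 4, too large for κP₁. Thus P₃ = 0 and L is constant. -/
theorem eq_zero_of_second_order (ha : a ≠ 0) {κ P₁ P₃ L : ℝ[X]} (hP₁ : P₁.natDegree ≤ 3) (hκ : κ ≠ 0)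
    (hL : derivative L = κ * P₃) {b : ℝ}
    (h : C 2 * κ * P₁ + C 6 * L * frcPoly a = C b * frcPoly a) :
    P₃ = 0 ∧ ∃ s, κ * P₁ = C s * frcPoly a := by
  have h2 : (C (1 / 2) : ℝ[X]) * C 2 = 1 := by rw [← C_mul]; norm_num
  have h3 : (C (1 / 2) : ℝ[X]) * C 6 = C 3 := by rw [← C_mul]; norm_num
  have h1 : κ * P₁ = (C (1 / 2) * C b - C 3 * L) * frcPoly a := by
    linear_combination C (1 / 2) * h - κ * P₁ * h2 - L * frcPoly a * h3
  have hP₃ : P₃ = 0 := by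
    by_contra hne
    have hκP : κ * P₃ ≠ 0 := mul_ne_zero hκ hne
    have hd : derivative (C (1 / 2) * C b - C 3 * L) = C (-3) * (κ * P₃) := by
      rw [derivative_sub, ← C_mul, derivative_C, derivative_C_mul, hL, C_neg]
      ring
    have hdeg : (κ * P₃).natDegree ≤ (C (1 / 2) * C b - C 3 * L).natDegree - 1 := by
      rw [← natDegree_C_mul (show (-3 : ℝ) ≠ 0 by norm_num), ← hd]
      exact natDegree_derivative_le _
    have hne' : C (1 / 2) * C b - C 3 * L ≠ 0 := by
      intro h0
      rw [h0, derivative_zero] at hd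
      exact mul_ne_zero (C_ne_zero.2 (by norm_num)) hκP hd.symm
    have hpos : (C (1 / 2) * C b - C 3 * L).natDegree ≠ 0 := by
      intro h0
      rw [eq_C_of_natDegree_eq_zero h0, derivative_C] at hd
      exact mul_ne_zero (C_ne_zero.2 (by norm_num)) hκP hd.symm
    have e1 : (κ * P₁).natDegree = (C (1 / 2) * C b - C 3 * L).natDegree + 3 := by
      rw [h1, natDegree_mul hne' (frcPoly_ne_zero ha), natDegree_frcPoly ha]
    have e2 : (κ * P₁).natDegree ≤ κ.natDegree + P₁.natDegree := natDegree_mul_le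
    rw [natDegree_mul hκ hne] at hdeg
    omega
  refine ⟨hP₃, ?_⟩
  rw [hP₃, mul_zero] at hL
  have hLc := eq_C_of_natDegree_eq_zero (derivative_eq_zero.1 hL)
  refine ⟨1 / 2 * b - 3 * L.coeff 0, ?_⟩
  rw [h1, hLc]
  simp only [C_sub, C_mul, coeff_C_zero]

/-- P₀' has degree at most 3 and is a multiple of U', so the cofactor is constant, which makes P₂ +
K/3 constant as well. -/
theorem exists_of_third_order (ha : a ≠ 0) {P₀ P₂ K : ℝ[X]} (hP₀ : P₀.natDegree ≤ 4) {s b : ℝ}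
    (hs : s ≠ 0)
    (h : C (2 * s) * derivative P₀ + C (6 * s) * (P₂ + C (1 / 3) * K) * frcPoly a =
      C b * frcPoly a) :
    ∃ m d, P₂ = C m - C (1 / 3) * K ∧ derivative P₀ = C d * frcPoly a ∧
      b = 2 * s * d + 6 * s * m := by
  have e1 : (C (1 / (2 * s)) : ℝ[X]) * C (2 * s) = 1 := by
    rw [← C_mul, one_div_mul_cancel (by simpa using hs), C_1]
  have e2 : (C (1 / (2 * s)) : ℝ[X]) * C (6 * s) = C 3 := by
    rw [← C_mul]; congr 1; field_simp; norm_num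
  have h1 : derivative P₀ = (C (1 / (2 * s)) * C b - C 3 * (P₂ + C (1 / 3) * K)) * frcPoly a := by
    linear_combination C (1 / (2 * s)) * h - derivative P₀ * e1 -
      (P₂ + C (1 / 3) * K) * frcPoly a * e2
  obtain ⟨d, hd⟩ := eq_C_of_natDegree_mul_frcPoly ha h1
    ((natDegree_derivative_le _).trans (by omega))
  have e3 : (C (1 / 3) : ℝ[X]) * C 3 = 1 := by rw [← C_mul]; norm_num
  refine ⟨(1 / (2 * s) * b - d) / 3, d, ?_, by rw [h1, hd], by field_simp; ring⟩
  have : P₂ = C (1 / 3) * (C (1 / (2 * s)) * C b - C d) - C (1 / 3) * K := by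
    linear_combination -C (1 / 3) * hd - (P₂ + C (1 / 3) * K) * e3
  rw [this]
  simp only [← C_mul, ← C_sub]
  congr 2
  ring

end Algebra

/-! ### The first four Melnikov coefficients as elliptic integrals. -/

section MelnikovReduction
variable {a : ℝ} {𝒜 : Set (ℝ × ℝ)} {σ : ℝ → ℝ × ℝ} {A B : ℕ × ℕ → ℝ}

/-- Here ω = dQ is exact and the perturbed system is Hamiltonian, so no order contributes. -/
theorem isMultiplier_zero_of_kappa_eq_zero {P₀ P₁ P₂ P₃ : ℝ[X]} {c : ℝ}
    (nf : NormalForm A B P₀ P₁ P₂ P₃ 0 0 c 0) (m : ℕ) :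
    IsMultiplier a A B (m + 1) fun _ => 0 := by
  induction m with
  | zero =>
    have h1 := nf.isStep_first_order (a := a) (K := 0) derivative_zero
    refine (isMultiplier_zero a A B).succ ?_ continuous_const
    simpa using h1
  | succ m ih =>
    refine ih.succ ⟨fun _ => 0, fun p => ?_⟩ continuous_const
    refine (hasFDerivAt_const (0 : ℝ) p).congr_fderiv ?_
    simp

/-- The reduction of the Melnikov coefficients of order at most four to elliptic integrals. -/
theorem exists_reduced (ha : a ≠ 0) (ha8 : a ≠ 8 / 9) (h𝒜 : IsPeriodAnnulus a 𝒜)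
    (hσ : IsCrossSection a 𝒜 σ) (A B : ℕ × ℕ → ℝ) {m : ℕ} (hm : m ≤ 3)
    (hprev : ∀ j < m, ∀ h ∈ H a '' 𝒜, melnikov a A B (H a '' 𝒜) σ (j + 1) h = 0) :
    ∃ r N, IsMultiplier a A B m r ∧ N.natDegree ≤ 6 ∧ IsReduced a A B r N := by
  obtain ⟨P₀, P₁, P₂, P₃, κ, n, c, ν, nf, hP₀, hP₁, hP₂, hP₃, hκ, hn⟩ := exists_normalForm A B
  have hfrc := (natDegree_frcPoly ha).le
  obtain ⟨K, hK, hKd⟩ := exists_antiderivative κ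
  have step₁ := nf.isStep_first_order (a := a) hK
  have red₁ := (isMultiplier_zero a A B).isReduced step₁
  have deg₁ : (n + C (3 * ν) * X * frcPoly a).natDegree ≤ 6 := by
    have h1 : (C (3 * ν) * X).natDegree ≤ 1 := by compute_degree
    have h2 : (C (3 * ν) * X * frcPoly a).natDegree ≤ 4 := natDegree_mul_le_of_le h1 hfrc
    exact natDegree_add_le_of_degree_le (hn.trans (by norm_num)) (h2.trans (by norm_num))
  rcases Nat.eq_zero_or_pos m with rfl | hm1
  · exact ⟨_, _, isMultiplier_zero a A B, deg₁, red₁⟩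
  obtain ⟨b₁, hb₁⟩ := (isMultiplier_zero a A B).exists_eq_smul red₁ ha ha8 hσ h𝒜 deg₁
    (hprev 0 hm1)
  obtain ⟨rfl, rfl⟩ := eq_zero_of_first_order ha hn hb₁
  rcases eq_or_ne κ 0 with rfl | hκ0
  · obtain ⟨m, rfl⟩ := Nat.exists_eq_succ_of_ne_zero hm1.ne'
    refine ⟨_, 0, isMultiplier_zero_of_kappa_eq_zero nf m, by simp, fun p γ T _ => ?_⟩
    simp [orbitIntegral]
  have mult₁ : IsMultiplier a A B 1 fun p => -2 * K.eval p.1 := by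
    refine (isMultiplier_zero a A B).succ ?_ (by fun_prop)
    simpa using step₁
  obtain ⟨V, hV, -⟩ := exists_antiderivative (κ * potPoly a)
  obtain ⟨W, hW, -⟩ := exists_antiderivative (κ * P₂)
  obtain ⟨L, hL, hLd⟩ := exists_antiderivative (κ * P₃)
  have red₂ := mult₁.isReduced (nf.isStep_second_order hK hV hW hL)
  have deg₂ : (C 2 * κ * P₁ + C 6 * L * frcPoly a).natDegree ≤ 6 := by
    have h1 : (C 2 * κ).natDegree ≤ 1 := (natDegree_C_mul_le _ _).trans hκ
    have h2 : (C 2 * κ * P₁).natDegree ≤ 4 := natDegree_mul_le_of_le h1 hP₁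
    have h3 : (κ * P₃).natDegree ≤ 2 := natDegree_mul_le_of_le hκ hP₃
    have h4 : (C 6 * L).natDegree ≤ 3 := (natDegree_C_mul_le _ _).trans (hLd.trans (by omega))
    have h5 : (C 6 * L * frcPoly a).natDegree ≤ 6 := natDegree_mul_le_of_le h4 hfrc
    exact natDegree_add_le_of_degree_le (h2.trans (by norm_num)) h5
  rcases eq_or_lt_of_le (Nat.succ_le_of_lt hm1) with rfl | hm2
  · exact ⟨_, _, mult₁, deg₂, red₂⟩
  obtain ⟨b₂, hb₂⟩ := mult₁.exists_eq_smul red₂ ha ha8 hσ h𝒜 deg₂ (hprev 1 hm2)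
  obtain ⟨rfl, s, hs⟩ := eq_zero_of_second_order ha hP₁ hκ0 hL hb₂
  have mult₂ : IsMultiplier a A B 2 fun p => evenMult K V W c p.1 (H a p) + 2 * s * p.2 := by
    have h1 := nf.isStep_second_order (a := a) hK hV hW (L := 0) (by simp)
    have h2 : C 2 * κ * P₁ + C 6 * 0 * frcPoly a = C (2 * s) * frcPoly a := by
      rw [mul_assoc, hs, C_mul]; ring
    rw [h2] at h1
    have h3 := h1.absorb
    simp only [eval_zero, mul_zero, zero_mul, sub_zero] at h3
    refine mult₁.succ h3 ?_
    have := continuous_H a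
    unfold evenMult
    fun_prop
  obtain ⟨W₁, hW₁, -⟩ := exists_antiderivative ((C 2 * K ^ 2 - C 4 * W + C (16 * c) * V) *
        (C 2 * derivative P₂ - C (8 * c) * frcPoly a + C 2 * κ) -
      C (16 * c) * K * (derivative P₀ - C 2 * derivative P₂ * potPoly a - C 2 * P₂ * frcPoly a +
        C (8 * c) * potPoly a * frcPoly a - C 2 * κ * potPoly a))
  obtain ⟨W₂, hW₂, -⟩ := exists_antiderivative
    (-C (16 * c) * K * (C 2 * derivative P₂ - C (8 * c) * frcPoly a + C 2 * κ))
  have step₃ := nf.isStep_third_order hs hK hV hW hW₁ hW₂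
  have red₃ := mult₂.isReduced step₃
  have deg₃ : (C (2 * s) * derivative P₀ + C (6 * s) * (P₂ + C (1 / 3) * K) *
      frcPoly a).natDegree ≤ 6 := by
    have h1 : (C (2 * s) * derivative P₀).natDegree ≤ 3 :=
      (natDegree_C_mul_le _ _).trans ((natDegree_derivative_le _).trans (by omega))
    have h2 : (P₂ + C (1 / 3) * K).natDegree ≤ 2 :=
      natDegree_add_le_of_degree_le hP₂ ((natDegree_C_mul_le _ _).trans (hKd.trans (by omega)))
    have h3 : (C (6 * s) * (P₂ + C (1 / 3) * K)).natDegree ≤ 2 := (natDegree_C_mul_le _ _).trans h2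
    have h4 : (C (6 * s) * (P₂ + C (1 / 3) * K) * frcPoly a).natDegree ≤ 5 :=
      natDegree_mul_le_of_le h3 hfrc
    exact natDegree_add_le_of_degree_le (h1.trans (by norm_num)) (h4.trans (by norm_num))
  rcases eq_or_lt_of_le (Nat.succ_le_of_lt hm2) with rfl | hm3
  · exact ⟨_, _, mult₂, deg₃, red₃⟩
  obtain rfl : m = 3 := by omega
  -- If s = 0 then κP₁ = 0 forces P₁ = 0, the reversible case, and the fourth integral vanishes. If
  -- s ≠ 0, the condition M₃ ≡ 0 fixes P₀' and P₂.
  rcases eq_or_ne s 0 with rfl | hs0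
  · obtain rfl : P₁ = 0 := by
      rw [C_0, zero_mul] at hs
      exact (mul_eq_zero.1 hs).resolve_left hκ0
    refine ⟨_, 0, mult₂.succ ?_ (continuous_thirdMult a 0 P₂ K V W W₁ W₂ c 0), by simp,
      fun p γ T hγ => ?_⟩
    · simpa using step₃
    · rw [nf.fourth_order_integral_even K V W W₁ W₂ hγ]
      simp
  · obtain ⟨b, hb⟩ := mult₂.exists_eq_smul red₃ ha ha8 hσ h𝒜 deg₃ (hprev 2 hm3)
    obtain ⟨m, d, hm', hd, rfl⟩ := exists_of_third_order ha hP₀ hs0 hb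
    rw [hb] at step₃
    refine ⟨_, C (2 * s) * P₁ * derivative P₁, mult₂.succ step₃.absorb ?_, ?_, fun p γ T hγ =>
      nf.fourth_order_integral_odd hs hm' hd hK hV hW hW₁ hW₂ hγ⟩
    · have := continuous_thirdMult a P₁ P₂ K V W W₁ W₂ c s
      fun_prop
    · have h1 : (C (2 * s) * P₁).natDegree ≤ 3 := (natDegree_C_mul_le _ _).trans hP₁
      have h2 : (derivative P₁).natDegree ≤ 2 := (natDegree_derivative_le _).trans (by omega)
      exact (natDegree_mul_le_of_le h1 h2).trans (by norm_num)

end MelnikovReduction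

/-! ### Reduction to the integrals I₀, I₁, I₂. -/

section Reduction
variable {a : ℝ} {p : ℝ × ℝ} {γ : ℝ → ℝ × ℝ} {T : ℝ}

theorem ovalIntegral_eq (hγ : IsClosedOrbit a p γ T) (k : ℕ) :
    ovalIntegral a k p = ∫ t in (0 : ℝ)..T, (γ t).1 ^ k * (γ t).2 ^ 2 := by
  obtain ⟨γ', T', hγ', he⟩ := Classical.epsilon_spec (p := fun v : ℝ => ∃ γ T,
    IsClosedOrbit a p γ T ∧ v = ∫ t in (0 : ℝ)..T, (γ t).1 ^ k * (γ t).2 *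
      deriv (fun s => (γ s).1) t) ⟨_, γ, T, hγ, rfl⟩
  obtain ⟨rfl, rfl⟩ := hγ.unique hγ'
  refine he.trans (intervalIntegral.integral_congr fun t _ => ?_)
  simp only [(hγ.sol.fst t).deriv]
  ring

theorem integral_frc_eq_zero (hγ : IsClosedOrbit a p γ T) :
    ∫ t in (0 : ℝ)..T, frc a (γ t).1 * (γ t).2 ^ 2 = 0 := by
  have hc := hγ.sol.continuous
  have hd : ∀ t ∈ uIcc 0 T, HasDerivAt (fun t => -(1 / 3) * (γ t).2 ^ 3)
      (frc a (γ t).1 * (γ t).2 ^ 2) t := fun t _ =>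
    (((hγ.sol.snd t).pow 3).const_mul (-(1 / 3))).congr_deriv (by push_cast; ring)
  rw [intervalIntegral.integral_eq_sub_of_hasDerivAt hd (Continuous.intervalIntegrable
    (by fun_prop) _ _), hγ.closes, hγ.starts, sub_self]

theorem exists_reduction (ha : a ≠ 0) {N : ℝ[X]} (hN : N.natDegree ≤ 6) :
    ∃ α β δ : ℝ[X], α.natDegree ≤ 1 ∧ β.natDegree ≤ 1 ∧ δ.natDegree ≤ 1 ∧
      ∀ p γ T, IsClosedOrbit a p γ T →
        ∫ t in (0 : ℝ)..T, N.eval (γ t).1 * (γ t).2 ^ 2 =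
          α.eval (H a p) * ovalIntegral a 0 p + β.eval (H a p) * ovalIntegral a 1 p +
            δ.eval (H a p) * ovalIntegral a 2 p := by
  -- The derivative of (d₀ + d₁x + d₂x² + d₃x³) y³ integrates to zero; after y⁴ = 2(h − U) y² its
  -- leading part removes x⁶, x⁵, x⁴, x³ in turn. The divisors come from the coefficients a/4 of U
  -- and a of U', and the terms in h from the 2h part of y².
  obtain ⟨d₃, h₃⟩ : ∃ d, 9 / 2 * a * d = N.coeff 6 := ⟨N.coeff 6 * (2 / (9 * a)), by field_simp⟩
  obtain ⟨d₂, h₂⟩ : ∃ d, 4 * a * d = N.coeff 5 + 10 * d₃ :=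
    ⟨(N.coeff 5 + 10 * d₃) / (4 * a), by field_simp⟩
  obtain ⟨d₁, h₁⟩ : ∃ d, 7 / 2 * a * d = N.coeff 4 - 6 * d₃ + 26 / 3 * d₂ :=
    ⟨(N.coeff 4 - 6 * d₃ + 26 / 3 * d₂) * (2 / (7 * a)), by field_simp⟩
  obtain ⟨d₀, h₀⟩ : ∃ d, 3 * a * d = N.coeff 3 - 5 * d₂ + 22 / 3 * d₁ :=
    ⟨(N.coeff 3 - 5 * d₂ + 22 / 3 * d₁) / (3 * a), by field_simp⟩
  refine ⟨C (N.coeff 0) + C (2 * d₁) * X, C (N.coeff 1 - 3 * d₀) + C (4 * d₂) * X,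
    C (N.coeff 2 - 4 * d₁ + 6 * d₀) + C (6 * d₃) * X, by compute_degree, by compute_degree,
    by compute_degree, fun p γ T hγ => ?_⟩
  have hc := hγ.sol.continuous
  obtain ⟨h, hh⟩ : ∃ h, h = H a p := ⟨_, rfl⟩
  have hE : ∀ t, (γ t).2 ^ 2 / 2 + pot a (γ t).1 = h := fun t => by rw [hh, hγ.energy]
  rw [ovalIntegral_eq hγ, ovalIntegral_eq hγ, ovalIntegral_eq hγ, ← hh]
  simp only [eval_add, eval_mul, eval_C, eval_X]
  set F : ℝ → ℝ := fun t => (d₀ + d₁ * (γ t).1 + d₂ * (γ t).1 ^ 2 + d₃ * (γ t).1 ^ 3) *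
    (γ t).2 ^ 3
  have hF : ∀ t ∈ uIcc 0 T, HasDerivAt F
      ((d₁ + 2 * d₂ * (γ t).1 + 3 * d₃ * (γ t).1 ^ 2) * (γ t).2 ^ 4 -
        3 * (d₀ + d₁ * (γ t).1 + d₂ * (γ t).1 ^ 2 + d₃ * (γ t).1 ^ 3) * (γ t).2 ^ 2 *
          frc a (γ t).1) t := fun t _ => by
    have hx := hγ.sol.fst t
    refine (((((hx.const_mul d₁).const_add d₀).add ((hx.pow 2).const_mul d₂)).add
      ((hx.pow 3).const_mul d₃)).mul ((hγ.sol.snd t).pow 3)).congr_deriv ?_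
    simp only [Pi.add_apply, Pi.pow_apply]
    push_cast
    ring
  have hi : ∀ {φ : ℝ → ℝ}, Continuous φ → IntervalIntegrable φ MeasureTheory.volume 0 T :=
    fun h => h.intervalIntegrable _ _
  have h0 := intervalIntegral.integral_eq_sub_of_hasDerivAt hF (hi (by fun_prop))
  simp only [F, hγ.closes, hγ.starts, sub_self] at h0
  have hJ : ∫ t in (0 : ℝ)..T, (N.eval (γ t).1 * (γ t).2 ^ 2 +
      ((d₁ + 2 * d₂ * (γ t).1 + 3 * d₃ * (γ t).1 ^ 2) * (γ t).2 ^ 4 -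
        3 * (d₀ + d₁ * (γ t).1 + d₂ * (γ t).1 ^ 2 + d₃ * (γ t).1 ^ 3) * (γ t).2 ^ 2 *
          frc a (γ t).1)) = ∫ t in (0 : ℝ)..T, ((N.coeff 0 + 2 * d₁ * h) *
        ((γ t).1 ^ 0 * (γ t).2 ^ 2) + (N.coeff 1 - 3 * d₀ + 4 * d₂ * h) *
        ((γ t).1 ^ 1 * (γ t).2 ^ 2) + (N.coeff 2 - 4 * d₁ + 6 * d₀ + 6 * d₃ * h) *
        ((γ t).1 ^ 2 * (γ t).2 ^ 2)) := by
    refine intervalIntegral.integral_congr fun t _ => ?_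
    simp only [eval_eq_sum_range' (Nat.lt_succ_of_le hN), Finset.sum_range_succ,
      Finset.sum_range_zero, ← hE t, pot, frc]
    generalize (γ t).1 = x
    generalize (γ t).2 = y
    linear_combination -(x ^ 6 * y ^ 2 * h₃ + x ^ 5 * y ^ 2 * h₂ + x ^ 4 * y ^ 2 * h₁ +
      x ^ 3 * y ^ 2 * h₀)
  rw [intervalIntegral.integral_add (hi (by fun_prop)) (hi (by fun_prop)), h0, add_zero,
    intervalIntegral.integral_add (hi (by fun_prop)) (hi (by fun_prop)),
    intervalIntegral.integral_add (hi (by fun_prop)) (hi (by fun_prop)),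
    intervalIntegral.integral_const_mul, intervalIntegral.integral_const_mul,
    intervalIntegral.integral_const_mul] at hJ
  exact hJ

end Reduction

/-! ### Every such elliptic integral is a second Melnikov coefficient. -/

section Realization
variable {a : ℝ}

theorem exists_natDegree_sub_le {P Q : ℝ[X]} {n : ℕ} (hP : P.natDegree ≤ n + 1)
    (hQ : Q.natDegree = n + 1) : ∃ c, (P - C c * Q).natDegree ≤ n := by
  refine ⟨P.coeff (n + 1) / Q.coeff (n + 1), natDegree_le_iff_coeff_eq_zero.2 fun i hi => ?_⟩
  rw [coeff_sub, coeff_C_mul]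
  rcases eq_or_lt_of_le (Nat.succ_le_of_lt hi) with rfl | hi'
  · have : Q.coeff (n + 1) ≠ 0 := by
      rw [← hQ]
      exact leadingCoeff_ne_zero.2 fun h => by simp [h] at hQ
    change P.coeff (n + 1) - P.coeff (n + 1) / Q.coeff (n + 1) * Q.coeff (n + 1) = 0
    field_simp
    ring
  · rw [coeff_eq_zero_of_natDegree_lt (hP.trans_lt hi'),
      coeff_eq_zero_of_natDegree_lt (p := Q) (hQ.trans_lt hi'), mul_zero, sub_zero]

theorem exists_frc_ne_zero (a : ℝ) : ∃ x, frc a x ≠ 0 := by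
  by_contra! h
  have h1 := h 1
  have h2 := h 2
  simp only [frc] at h1 h2
  linarith

/-- Since U'(x₀) ≠ 0, subtracting bU' makes N vanish at x₀. The quotient by x − x₀ has degree at
most 5, and multiples of (x − x₀)²U' and (x − x₀)U' lower it to 3. The result has the shape of the
second-order integrand with κ = x − x₀. -/
theorem exists_decomposition (ha : a ≠ 0) {N : ℝ[X]} (hN : N.natDegree ≤ 6) :
    ∃ (x₀ b l₂ l₃ : ℝ) (P : ℝ[X]), P.natDegree ≤ 3 ∧ N = C b * frcPoly a +
      (C 2 * (X - C x₀) * P +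
        C 6 * (C l₂ * (X - C x₀) ^ 2 + C l₃ * (X - C x₀) ^ 3) * frcPoly a) := by
  obtain ⟨x₀, hx₀⟩ := exists_frc_ne_zero a
  have hf := natDegree_frcPoly ha
  have hf0 := frcPoly_ne_zero ha
  have hX0 := X_sub_C_ne_zero x₀
  obtain ⟨b, hb⟩ : ∃ b, b * frc a x₀ = N.eval x₀ := ⟨_, div_mul_cancel₀ _ hx₀⟩
  obtain ⟨N₁, hN₁⟩ : X - C x₀ ∣ N - C b * frcPoly a := by
    rw [dvd_iff_isRoot, IsRoot.def, eval_sub, eval_mul, eval_C, eval_frcPoly, hb, sub_self]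
  have hd₁ : N₁.natDegree ≤ 4 + 1 := by
    rcases eq_or_ne N₁ 0 with rfl | h0
    · simp
    have h2 : (C b * frcPoly a).natDegree ≤ 6 :=
      (natDegree_C_mul_le _ _).trans (hf.le.trans (by norm_num))
    have h1 : (N - C b * frcPoly a).natDegree ≤ 6 := natDegree_sub_le_of_le hN h2
    rw [hN₁, natDegree_mul hX0 h0, natDegree_X_sub_C] at h1
    omega
  obtain ⟨c₃, h₃⟩ := exists_natDegree_sub_le hd₁ (Q := (X - C x₀) ^ 2 * frcPoly a) (by
    rw [natDegree_mul (pow_ne_zero _ hX0) hf0, natDegree_pow, natDegree_X_sub_C, hf])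
  obtain ⟨c₂, h₂⟩ := exists_natDegree_sub_le (n := 3) h₃ (Q := (X - C x₀) * frcPoly a) (by
    rw [natDegree_mul hX0 hf0, natDegree_X_sub_C, hf])
  have e2 : (C 2 : ℝ[X]) * C (1 / 2) = 1 := by rw [← C_mul]; norm_num
  have e6 : (C 6 : ℝ[X]) * C (1 / 6) = 1 := by rw [← C_mul]; norm_num
  refine ⟨x₀, b, 1 / 6 * c₂, 1 / 6 * c₃, C (1 / 2) * (N₁ - C c₃ * ((X - C x₀) ^ 2 * frcPoly a) -
    C c₂ * ((X - C x₀) * frcPoly a)), (natDegree_C_mul_le _ _).trans h₂, ?_⟩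
  rw [C_mul, C_mul]
  linear_combination hN₁ - (X - C x₀) * (N₁ - C c₃ * ((X - C x₀) ^ 2 * frcPoly a) -
    C c₂ * ((X - C x₀) * frcPoly a)) * e2 -
    (C c₂ * (X - C x₀) ^ 2 + C c₃ * (X - C x₀) ^ 3) * frcPoly a * e6

theorem exists_perturbation {P : ℝ[X]} (hP : P.natDegree ≤ 3) (x₀ l₂ l₃ : ℝ) :
    ∃ A B, NormalForm A B 0 P 0 (C (2 * l₂) + C (3 * l₃) * (X - C x₀)) (X - C x₀) 0 0 0 := by
  refine ⟨fun ij => if ij.2 = 0 then -P.coeff ij.1 else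
    if ij = (0, 2) then -3 * (2 * l₂ - 3 * l₃ * x₀) else if ij = (1, 2) then -9 * l₃ else 0,
    fun ij => if ij.2 = 1 then (ij.1 + 1) * P.coeff (ij.1 + 1) else
    if ij = (0, 2) then -x₀ else if ij = (1, 2) then 1 else if ij = (0, 3) then 3 * l₃ else 0,
    ⟨fun p => ?_, fun p => ?_⟩⟩
  · rw [← Prod.mk.eta (p := p), cubic_eq, eval_eq_sum_range' (Nat.lt_succ_of_le hP)]
    simp [Finset.sum_range_succ]
    ring
  · have hP' : P = C (P.coeff 0) + C (P.coeff 1) * X + C (P.coeff 2) * X ^ 2 +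
        C (P.coeff 3) * X ^ 3 := by
      refine Polynomial.funext fun x => ?_
      rw [eval_eq_sum_range' (Nat.lt_succ_of_le hP)]
      simp [Finset.sum_range_succ]
    have hd : (derivative P).eval p.1 = P.coeff 1 + 2 * P.coeff 2 * p.1 +
        3 * P.coeff 3 * p.1 ^ 2 := by
      conv_lhs => rw [hP']
      simp
      ring
    rw [hd, ← Prod.mk.eta (p := p), cubic_eq]
    simp
    ring

/-- Every elliptic integral of the relevant degree is a second Melnikov coefficient. -/
theorem exists_second_melnikov (ha : a ≠ 0) {𝒜 : Set (ℝ × ℝ)} {σ : ℝ → ℝ × ℝ}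
    (hσ : IsCrossSection a 𝒜 σ) (h𝒜 : IsPeriodAnnulus a 𝒜) {N : ℝ[X]} (hN : N.natDegree ≤ 6) :
    ∃ A B : ℕ × ℕ → ℝ, (∀ h ∈ H a '' 𝒜, melnikov a A B (H a '' 𝒜) σ 1 h = 0) ∧
      ∀ h ∈ H a '' 𝒜, ∀ γ T, IsClosedOrbit a (σ h) γ T →
        melnikov a A B (H a '' 𝒜) σ 2 h = ∫ t in (0 : ℝ)..T, N.eval (γ t).1 * (γ t).2 ^ 2 := by
  obtain ⟨x₀, b, l₂, l₃, P, hP, hNP⟩ := exists_decomposition ha hN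
  obtain ⟨A, B, nf⟩ := exists_perturbation hP x₀ l₂ l₃
  obtain ⟨K, hK, -⟩ := exists_antiderivative (X - C x₀)
  obtain ⟨V, hV, -⟩ := exists_antiderivative ((X - C x₀) * potPoly a)
  have step₁ := nf.isStep_first_order (a := a) hK
  have h₁ : (0 + C (3 * 0) * X * frcPoly a : ℝ[X]) = 0 := by simp
  rw [h₁] at step₁
  have mult₁ : IsMultiplier a A B 1 fun p => -2 * K.eval p.1 := by
    refine (isMultiplier_zero a A B).succ ?_ (by fun_prop)
    simpa using step₁
  -- L is the primitive of κP₃ that vanishes at x₀, matching the decomposition of N. The remaining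
  -- multiple of U' integrates to zero.
  have step₂ := nf.isStep_second_order hK hV (W := 0) (by simp)
    (L := C l₂ * (X - C x₀) ^ 2 + C l₃ * (X - C x₀) ^ 3) (by
      simp only [derivative_add, derivative_mul, derivative_C, derivative_X_sub_C_pow, C_mul]
      norm_num
      rw [show (C 2 : ℝ[X]) = 2 from map_ofNat C 2, show (C 3 : ℝ[X]) = 3 from map_ofNat C 3]
      ring)
  refine ⟨A, B, fun h hh => ?_, fun h hh γ T hγ => ?_⟩
  · obtain ⟨γ, T, hγ⟩ := h𝒜.subset_periodicSet (hσ.mem h hh)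
    rw [(isMultiplier_zero a A B).melnikov_eq ((isMultiplier_zero a A B).isReduced step₁) hσ h𝒜 hh
      hγ]
    simp
  · have hc := hγ.sol.continuous
    rw [mult₁.melnikov_eq (mult₁.isReduced step₂) hσ h𝒜 hh hγ]
    conv_rhs => rw [hNP]
    simp only [eval_add (p := C b * frcPoly a), eval_mul (p := C b), eval_C, eval_frcPoly, add_mul]
    rw [intervalIntegral.integral_add (Continuous.intervalIntegrable (by fun_prop) _ _)
      (Continuous.intervalIntegrable (by fun_prop) _ _)]
    simp_rw [mul_assoc b]
    rw [intervalIntegral.integral_const_mul, integral_frc_eq_zero hγ, mul_zero, zero_add]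

end Realization

/-! ### Zero counts and the conclusion. -/

theorem zeroCount_congr {S : Set ℝ} {M M' : ℝ → ℝ} (h : EqOn M M' S) :
    zeroCount S M = zeroCount S M' := by
  unfold zeroCount
  congr 1
  ext x
  simp only [mem_ofPred_eq]
  exact and_congr_right fun hx => by rw [h hx]

/-- Multiplicity depends on the germ at each point, so openness is needed to turn equality on S into
equality near the point. -/
theorem zeroCountMult_congr {S : Set ℝ} (hS : IsOpen S) {M M' : ℝ → ℝ} (h : EqOn M M' S) :
    zeroCountMult S M = zeroCountMult S M' :=
  tsum_congr fun x => analyticOrderAt_congr (h.eventuallyEq_of_mem (hS.mem_nhds x.2))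

end CubicPerturbation
end

theorem theorem2 (a : ℝ) (ha0 : a ≠ 0) (ha : a ≠ 8 / 9)
    (𝒜 : Set (ℝ × ℝ)) (h𝒜 : CubicPerturbation.IsPeriodAnnulus a 𝒜)
    (S : Set ℝ) (hS : S = CubicPerturbation.H a '' 𝒜)
    (σ : ℝ → ℝ × ℝ) (hσ : CubicPerturbation.IsCrossSection a 𝒜 σ)
    (k : ℕ) (hk1 : 1 ≤ k) (hk4 : k ≤ 4)
    (A B : ℕ × ℕ → ℝ)
    (hprev : ∀ j, 1 ≤ j → j < k → ∀ h ∈ S, CubicPerturbation.melnikov a A B S σ j h = 0) :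
    -- the displacement map is well defined and its expansion up to order `k` holds
    (∀ h ∈ S, (∀ᶠ ε in 𝓝 (0 : ℝ), ∃! h', CubicPerturbation.FirstReturn a A B S σ ε h h') ∧
      (fun ε => CubicPerturbation.displacement a A B S σ h ε
          - ε ^ k * CubicPerturbation.melnikov a A B S σ k h)
        =o[𝓝 (0 : ℝ)] fun ε => ε ^ k) ∧
    -- the form of `M_k`
    (∃ α β γ : Polynomial ℝ, α.natDegree ≤ 1 ∧ β.natDegree ≤ 1 ∧ γ.natDegree ≤ 1 ∧
      ∀ h ∈ S, CubicPerturbation.melnikov a A B S σ k h =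
        α.eval h * CubicPerturbation.ovalIntegral a 0 (σ h) +
        β.eval h * CubicPerturbation.ovalIntegral a 1 (σ h) +
        γ.eval h * CubicPerturbation.ovalIntegral a 2 (σ h)) ∧
    -- the maximality of the number of zeros of `M_2`
    ((∃ h ∈ S, CubicPerturbation.melnikov a A B S σ k h ≠ 0) →
      ∃ A' B' : ℕ × ℕ → ℝ,
        (∀ h ∈ S, CubicPerturbation.melnikov a A' B' S σ 1 h = 0) ∧
        (∃ h ∈ S, CubicPerturbation.melnikov a A' B' S σ 2 h ≠ 0) ∧
        CubicPerturbation.zeroCount S (CubicPerturbation.melnikov a A B S σ k) ≤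
          CubicPerturbation.zeroCount S (CubicPerturbation.melnikov a A' B' S σ 2) ∧
        CubicPerturbation.zeroCountMult S (CubicPerturbation.melnikov a A B S σ k) ≤
          CubicPerturbation.zeroCountMult S (CubicPerturbation.melnikov a A' B' S σ 2)) := by
  subst hS
  obtain ⟨m, rfl⟩ : ∃ m, k = m + 1 := ⟨k - 1, by omega⟩
  obtain ⟨r, N, hr, hN, hred⟩ := CubicPerturbation.exists_reduced ha0 ha h𝒜 hσ A B (m := m)
    (by omega) fun j hj h hh => hprev (j + 1) (by omega) (by omega) h hh
  have hM : ∀ h ∈ CubicPerturbation.H a '' 𝒜, ∀ γ T, CubicPerturbation.IsClosedOrbit a (σ h) γ T →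
      CubicPerturbation.melnikov a A B (CubicPerturbation.H a '' 𝒜) σ (m + 1) h =
        ∫ t in (0 : ℝ)..T, N.eval (γ t).1 * (γ t).2 ^ 2 :=
    fun h hh γ T hγ => hr.melnikov_eq hred hσ h𝒜 hh hγ
  refine ⟨fun h hh => ⟨CubicPerturbation.eventually_existsUnique_firstReturn hσ h𝒜 hh A B, ?_⟩,
    ?_, fun hne => ?_⟩
  · obtain ⟨γ, T, hγ⟩ := h𝒜.subset_periodicSet (hσ.mem h hh)
    obtain ⟨q, hq, rfl⟩ := hr
    rw [CubicPerturbation.melnikov_eq hσ h𝒜 hh hq hγ]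
    exact CubicPerturbation.displacement_isLittleO hσ h𝒜 hh hq hγ
  · obtain ⟨α, β, δ, hα, hβ, hδ, hint⟩ := CubicPerturbation.exists_reduction ha0 hN
    refine ⟨α, β, δ, hα, hβ, hδ, fun h hh => ?_⟩
    obtain ⟨γ, T, hγ⟩ := h𝒜.subset_periodicSet (hσ.mem h hh)
    rw [hM h hh γ T hγ, hint _ γ T hγ, hσ.level h hh]
  · obtain ⟨A', B', h1, h2⟩ := CubicPerturbation.exists_second_melnikov ha0 hσ h𝒜 hN
    -- Both coefficients are the same elliptic integral, so the second Melnikov coefficient equals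
    -- M_k on the whole interval and the two inequalities are equalities.
    have heq : EqOn (CubicPerturbation.melnikov a A B (CubicPerturbation.H a '' 𝒜) σ (m + 1))
        (CubicPerturbation.melnikov a A' B' (CubicPerturbation.H a '' 𝒜) σ 2)
        (CubicPerturbation.H a '' 𝒜) := fun h hh => by
      obtain ⟨γ, T, hγ⟩ := h𝒜.subset_periodicSet (hσ.mem h hh)
      rw [hM h hh γ T hγ, h2 h hh γ T hγ]
    obtain ⟨h, hh, h0⟩ := hne
    exact ⟨A', B', h1, ⟨h, hh, by rwa [← heq hh]⟩,
      (CubicPerturbation.zeroCount_congr heq).le,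
      (CubicPerturbation.zeroCountMult_congr h𝒜.isOpen_image heq).le⟩
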